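/- Let $k$ be a field of characteristic zero and let $G$ be an affine algebraic supergroup over $k$, given by its superalgebra of functions $\mathcal{O}(G)$, a finitely generated supercommutative Hopf superalgebra with comultiplication $\mu^*$ and antipode $i^*$. Let $G(k)$ be the group of $k$-points of $G$ (superalgebra morphisms $\mathcal{O}(G)\to k$), with unit $e$, and let $k|G|$ be its group algebra. For $x\in G(k)$ let $\mathrm{ev}_x$ be the evaluation at $x$, $m_x=\ker(\mathrm{ev}_x)$, and let $D(G,x)\subset\mathcal{O}(G)^*$ be the space of linear functionals that vanish on $m_x^{n+1}$ for some $n\ge 0$; put $D(G)=\sum_{x\in G(k)}D(G,x)\subset \mathcal{O}(G)^*$. Let $\phi\star\psi=(\phi\otimes\psi)\mu^*$ be the convolution product, where $(\phi\otimes\psi)(f\otimes h)=(-1)^{|\psi||f|}\phi(f)\psi(h)$. Let $\mathfrak{g}=\mathrm{Lie}(G)$ be the Lie superalgebra of the functionals that vanish on $1$ and on $m_e^2$, with the supercommutator for $\star$ as bracket, let $\mathcal{U}(\mathfrak{g})$ be its universal enveloping superalgebra, and let $\alpha:\mathcal{U}(\mathfrak{g})\to(\mathcal{O}(G)^*,\star)$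 be the algebra morphism extending the inclusion of $\mathfrak{g}$. Then $\alpha$ is injective with image $D(G,e)$; identify $\mathcal{U}(\mathfrak{g})$ with $D(G,e)$ through $\alpha$. There is a linear isomorphism $$\Psi: D(G)\longrightarrow k|G|\otimes\mathcal{U}(\mathfrak{g}),\qquad \phi_g\longmapsto g\otimes\phi_e \quad (g\in G(k),\ \phi_g\in D(G,g)),\qquad \phi_e:=\mathrm{ev}_{g^{-1}}\star\phi_g .$$ The space $D(G)$ is a Hopf superalgebra with product $\star$, unit $\mathrm{ev}_e$, comultiplication $\Delta(\phi)(f\otimes h)=\phi(fh)$ (with the same sign convention for $D(G)\otimes D(G)\subset(\mathcal{O}(G)\otimes\mathcal{O}(G))^*$), counit $\eta(\phi)=\phi(1)$, antipode $S(\phi)=\phi\circ i^*$, and the parity of functionals. Through $\Psi$ it endows $k|G|\otimes\mathcal{U}(\mathfrak{g})$ with a Hopf superalgebra structure. The grading, unit, comultiplication and counit of this structure are those of the tensor product of the natural Hopf structures of $k|G|$ (with $\Delta(g)=g\otimes g$ for $g\in G(k)$, purely even) and of $\mathcal{U}(\mathfrak{g})$ (with $\Delta(U)=U\otimes1+1\otimes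 U$ for $U\in\mathfrak{g}$); its antipode is $a\otimes X\mapsto(1\otimes S(X))\,(S(a)\otimes1)$; and its product is $$(g\otimes X)(h\otimes Y)=gh\otimes(h^{-1}X)\,Y,\qquad g,h\in G(k),\ X,Y\in\mathcal{U}(\mathfrak{g}),\qquad h^{-1}X:=\mathrm{ev}_{h^{-1}}\star X\star \mathrm{ev}_h .$$ -/

import Mathlib

open scoped TensorProduct

noncomputable section

/-! ### Super vector spaces -/

section SuperSpace

variable (k : Type*) [Field k] {V : Type*} [AddCommGroup V] [Module k V]

/-- The sign `(-1)^(i j)` of the Koszul rule. -/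
def koszulSign (i j : ZMod 2) : k := if i = 1 ∧ j = 1 then -1 else 1

variable {k}

/-- The projection of `V = V₀ ⊕ V₁` onto its component of parity `i`. -/
def superProj (gr : ZMod 2 → Submodule k V) (h : DirectSum.IsInternal gr) (i : ZMod 2) :
    V →ₗ[k] V :=
  letI := h.chooseDecomposition
  (gr i).subtype ∘ₗ DirectSum.component k (ZMod 2) (fun i => gr i) i ∘ₗ
    (DirectSum.decomposeLinearEquiv gr).toLinearMap

/- Elementary facts on the projections. -/

theorem superProj_mem (gr : ZMod 2 → Submodule k V) (h : DirectSum.IsInternal gr)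
    (i : ZMod 2) (x : V) : superProj gr h i x ∈ gr i := by
  simp [superProj]

theorem superProj_of_mem (gr : ZMod 2 → Submodule k V) (h : DirectSum.IsInternal gr)
    {i : ZMod 2} {x : V} (hx : x ∈ gr i) (j : ZMod 2) :
    superProj gr h j x = if j = i then x else 0 := by
  let := h.chooseDecomposition
  change (DirectSum.decompose gr x j : V) = _
  split_ifs with hji
  · subst hji
    exact DirectSum.decompose_of_mem_same gr hx
  · exact DirectSum.decompose_of_mem_ne gr hx (Ne.symm hji)

theorem sum_zmod_two {M : Type*} [AddCommMonoid M] (f : ZMod 2 → M) :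
    ∑ i : ZMod 2, f i = f 0 + f 1 := Fin.sum_univ_two f

theorem zmod_two_cases (i : ZMod 2) : i = 0 ∨ i = 1 := by
  revert i; decide

theorem superProj_add (gr : ZMod 2 → Submodule k V) (h : DirectSum.IsInternal gr) (x : V) :
    superProj gr h 0 x + superProj gr h 1 x = x := by
  classical
  let := h.chooseDecomposition
  have h1 := congrArg (DirectSum.decompose gr).symm
    (DirectSum.sum_univ_of (DirectSum.decompose gr x))
  rw [DirectSum.decompose_symm_sum, Equiv.symm_apply_apply, sum_zmod_two,
    DirectSum.decompose_symm_of, DirectSum.decompose_symm_of] at h1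
  exact h1

theorem isInternal_of_isCompl (gr : ZMod 2 → Submodule k V) (h : IsCompl (gr 0) (gr 1)) :
    DirectSum.IsInternal gr :=
  (DirectSum.isInternal_submodule_iff_isCompl gr (i := 0) (j := 1) zero_ne_one
    (by ext i; simpa using zmod_two_cases i)).2 h

/-- The part of parity `l` of `V ⊗ V`. -/
def superTensorGr (gr : ZMod 2 → Submodule k V) (l : ZMod 2) : Submodule k (V ⊗[k] V) :=
  ⨆ i : ZMod 2, LinearMap.range (TensorProduct.map (gr i).subtype (gr (l - i)).subtype)

/-- For a bilinear product on a super vector space `V`, the product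
`(a ⊗ b) (c ⊗ d) = (-1)^(|b| |c|) a c ⊗ b d` on `V ⊗ V`. -/
def superTensorMul (gr : ZMod 2 → Submodule k V) (h : DirectSum.IsInternal gr)
    (mul : V →ₗ[k] V →ₗ[k] V) : V ⊗[k] V →ₗ[k] V ⊗[k] V →ₗ[k] V ⊗[k] V :=
  ∑ i : ZMod 2, ∑ j : ZMod 2, koszulSign k i j •
    (TensorProduct.map₂ mul mul).compl₁₂
      (LinearMap.lTensor V (superProj gr h i)) (LinearMap.rTensor V (superProj gr h j))

/-- The map `a ⊗ b ↦ (-1)^(|a| |b|) a ⊗ b`. -/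
def koszulTwist (gr : ZMod 2 → Submodule k V) (h : DirectSum.IsInternal gr) :
    V ⊗[k] V →ₗ[k] V ⊗[k] V :=
  ∑ i : ZMod 2, ∑ j : ZMod 2, koszulSign k i j •
    TensorProduct.map (superProj gr h i) (superProj gr h j)

/-- The tensor product of two linear functionals on a super vector space, with the Koszul sign:
`(φ ⊗ ψ) (a ⊗ b) = (-1)^(|ψ| |a|) φ a * ψ b`. (A functional of parity `i` vanishes on
the elements of the other parity, so the sign can be read off from `|a|` and `|b|`.) -/
def superDualDistrib (gr : ZMod 2 → Submodule k V) (h : DirectSum.IsInternal gr) :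
    Module.Dual k V ⊗[k] Module.Dual k V →ₗ[k] Module.Dual k (V ⊗[k] V) :=
  (koszulTwist gr h).dualMap ∘ₗ TensorProduct.dualDistrib k V V

/-- The functionals of parity `i`: those that vanish on the elements of the other parity. -/
def dualGr (gr : ZMod 2 → Submodule k V) (i : ZMod 2) : Submodule k (Module.Dual k V) :=
  (gr (i + 1)).dualAnnihilator

end SuperSpace

/-! ### Hopf superalgebras -/

/-- A Hopf superalgebra: an associative unital superalgebra which is also a coalgebra, all structure
maps being even, with a comultiplication and a counit that are morphisms of superalgebras, and with
an antipode. -/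
structure HopfSuperalgebra (k : Type*) (H : Type*) [Field k] [AddCommGroup H] [Module k H]
    extends Coalgebra k H where
  /-- the even part `gr 0` and the odd part `gr 1` -/
  gr : ZMod 2 → Submodule k H
  isInternal : DirectSum.IsInternal gr
  mul : H →ₗ[k] H →ₗ[k] H
  one : H
  mul_assoc : ∀ a b c, mul (mul a b) c = mul a (mul b c)
  one_mul : ∀ a, mul one a = a
  mul_one : ∀ a, mul a one = a
  one_mem : one ∈ gr 0
  mul_mem : ∀ i j, ∀ a ∈ gr i, ∀ b ∈ gr j, mul a b ∈ gr (i + j)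
  counit_odd : ∀ a ∈ gr 1, counit a = 0
  comul_mem : ∀ i, ∀ a ∈ gr i, comul a ∈ superTensorGr gr i
  counit_one : counit one = 1
  counit_mul : ∀ a b, counit (mul a b) = counit a * counit b
  comul_one : comul one = one ⊗ₜ[k] one
  comul_mul : ∀ a b, comul (mul a b) = superTensorMul gr isInternal mul (comul a) (comul b)
  antipode : H →ₗ[k] H
  antipode_mem : ∀ i, ∀ a ∈ gr i, antipode a ∈ gr i
  antipode_left : ∀ a,
    TensorProduct.lift mul (LinearMap.rTensor H antipode (comul a)) = counit a • one
  antipode_right : ∀ a,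
    TensorProduct.lift mul (LinearMap.lTensor H antipode (comul a)) = counit a • one

/-- The linear isomorphism `e` is an isomorphism of Hopf superalgebras from `H₁` to `H₂`. -/
structure HopfSuperalgebra.IsIso {k V W : Type*} [Field k] [AddCommGroup V] [Module k V]
    [AddCommGroup W] [Module k W] (H₁ : HopfSuperalgebra k V) (H₂ : HopfSuperalgebra k W)
    (e : V ≃ₗ[k] W) : Prop where
  map_gr : ∀ i, (H₁.gr i).map e.toLinearMap = H₂.gr i
  map_mul : ∀ a b, e (H₁.mul a b) = H₂.mul (e a) (e b)
  map_one : e H₁.one = H₂.one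
  map_comul : ∀ a, TensorProduct.map e.toLinearMap e.toLinearMap (H₁.comul a) = H₂.comul (e a)
  map_counit : ∀ a, H₁.counit a = H₂.counit (e a)
  map_antipode : ∀ a, e (H₁.antipode a) = H₂.antipode (e a)

/-! ### Lie superalgebras and their enveloping superalgebras -/

/-- A Lie superalgebra over a field of characteristic different from 2 and 3. -/
structure LieSuperalgebra (k : Type*) (L : Type*) [Field k] [AddCommGroup L] [Module k L] where
  gr : ZMod 2 → Submodule k L
  isInternal : DirectSum.IsInternal gr
  bracket : L →ₗ[k] L →ₗ[k] L
  bracket_mem : ∀ i j, ∀ x ∈ gr i, ∀ y ∈ gr j, bracket x y ∈ gr (i + j)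
  skew : ∀ i j, ∀ x ∈ gr i, ∀ y ∈ gr j, bracket x y = -(koszulSign k i j • bracket y x)
  jacobi : ∀ i j, ∀ x ∈ gr i, ∀ y ∈ gr j, ∀ z,
    bracket x (bracket y z) = bracket (bracket x y) z + koszulSign k i j • bracket y (bracket x z)

namespace LieSuperalgebra

variable {k L : Type*} [Field k] [AddCommGroup L] [Module k L] (𝔤 : LieSuperalgebra k L)

/-- The relations `x y = (-1)^(|x| |y|) y x + [x, y]` of the enveloping superalgebra. -/
inductive EnvRel : TensorAlgebra k L → TensorAlgebra k L → Prop
  | comm (i j : ZMod 2) (x y : L) (hx : x ∈ 𝔤.gr i) (hy : y ∈ 𝔤.gr j) :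
      EnvRel (TensorAlgebra.ι k x * TensorAlgebra.ι k y)
        (koszulSign k i j • (TensorAlgebra.ι k y * TensorAlgebra.ι k x) +
          TensorAlgebra.ι k (𝔤.bracket x y))

/-- The universal enveloping superalgebra `U(𝔤)`. -/
abbrev Env : Type _ := RingQuot 𝔤.EnvRel

/-- The canonical map `𝔤 → U(𝔤)`. -/
def ι : L →ₗ[k] 𝔤.Env :=
  (RingQuot.mkAlgHom k 𝔤.EnvRel).toLinearMap ∘ₗ TensorAlgebra.ι k

/-- The Hopf superalgebra structure `U` on `U(𝔤)` is the natural one: its product and unit are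
those of `U(𝔤)`, and each homogeneous `x ∈ 𝔤` keeps its parity in `U(𝔤)` and is primitive. -/
structure IsNaturalHopf (U : HopfSuperalgebra k 𝔤.Env) : Prop where
  mul_eq : ∀ a b, U.mul a b = a * b
  one_eq : U.one = 1
  ι_mem : ∀ i, ∀ x ∈ 𝔤.gr i, 𝔤.ι x ∈ U.gr i
  comul_ι : ∀ x, U.comul (𝔤.ι x) = 𝔤.ι x ⊗ₜ[k] 1 + 1 ⊗ₜ[k] 𝔤.ι x

end LieSuperalgebra

/-! ### Affine algebraic supergroups -/

/-- An affine algebraic supergroup `G` over `k`, given by its superalgebra of functions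
`A = 𝒪(G)`: a finitely generated supercommutative Hopf superalgebra. -/
structure AffineSupergroup (k : Type*) (A : Type*) [Field k] [Ring A] [Algebra k A]
    extends HopfSuperalgebra k A where
  mul_eq : ∀ a b, mul a b = a * b
  one_eq : one = 1
  supercomm : ∀ i j, ∀ a ∈ gr i, ∀ b ∈ gr j, a * b = koszulSign k i j • (b * a)
  finiteType : Algebra.FiniteType k A

namespace AffineSupergroup

variable {k A : Type*} [Field k] [Ring A] [Algebra k A] (G : AffineSupergroup k A)

/-- The group `G(k)` of `k`-points: the morphisms of superalgebras `𝒪(G) → k`. -/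
def Points : Type _ := {x : A →ₐ[k] k // ∀ a ∈ G.gr 1, x a = 0}

/-- Evaluation at the point `x`, as a functional on `𝒪(G)`. -/
def ev {G : AffineSupergroup k A} (x : G.Points) : Module.Dual k A := x.1.toLinearMap


variable {G}

theorem Points.ext {x y : G.Points} (h : ∀ a, x.1 a = y.1 a) : x = y :=
  Subtype.ext (AlgHom.ext h)

theorem Points.proj_one (x : G.Points) (a : A) :
    x.1 (superProj G.gr G.isInternal 1 a) = 0 := x.2 _ (superProj_mem _ _ _ _)

theorem Points.proj_zero (x : G.Points) (a : A) :
    x.1 (superProj G.gr G.isInternal 0 a) = x.1 a := by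
  conv_rhs => rw [← superProj_add G.gr G.isInternal a, map_add, x.proj_one, add_zero]

/-- The convolution product without signs. -/
def uconv (G : AffineSupergroup k A) (φ ψ : Module.Dual k A) : Module.Dual k A :=
  LinearMap.mul' k k ∘ₗ TensorProduct.map φ ψ ∘ₗ G.comul

theorem superTensorMul_tmul (a b c d : A) :
    superTensorMul G.gr G.isInternal G.mul (a ⊗ₜ b) (c ⊗ₜ d) =
      ∑ i : ZMod 2, ∑ j : ZMod 2, koszulSign k i j •
        ((a * superProj G.gr G.isInternal j c) ⊗ₜ[k] (superProj G.gr G.isInternal i b * d)) := by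
  simp [superTensorMul, G.mul_eq, LinearMap.sum_apply]

theorem uconv_grade (φ ψ : Module.Dual k A) (i j : ZMod 2) (hφ : φ ∈ dualGr G.gr i)
    (hψ : ψ ∈ dualGr G.gr j) : G.uconv φ ψ ∈ dualGr G.gr (i + j) := by
  rw [dualGr, Submodule.mem_dualAnnihilator] at *
  intro a ha
  have h2 : superTensorGr G.gr (i + j + 1) ≤
      LinearMap.ker (LinearMap.mul' k k ∘ₗ TensorProduct.map φ ψ) := by
    refine iSup_le fun l => ?_
    rintro _ ⟨t, rfl⟩
    induction t with
    | zero => simp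
    | add s t hs ht => rw [map_add]; exact add_mem hs ht
    | tmul u v =>
      simp only [TensorProduct.map_tmul, Submodule.subtype_apply, LinearMap.mem_ker,
        LinearMap.comp_apply, LinearMap.mul'_apply]
      by_cases hl : l = i + 1
      · subst hl
        rw [hφ _ u.2, zero_mul]
      · have h3 := v.2
        have h4 : i + j + 1 - l = j + 1 := by
          clear * - hl
          revert i j l; decide
        rw [hψ _ (h4 ▸ h3 : (v : A) ∈ G.gr (j + 1)), mul_zero]
  exact h2 (G.comul_mem _ a ha)

theorem Points.ev_mem (x : G.Points) : ev x ∈ dualGr G.gr 0 := by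
  rw [dualGr, Submodule.mem_dualAnnihilator]
  exact x.2

theorem Points.map_superTensorMul (x y : G.Points) (s t : A ⊗[k] A) :
    (LinearMap.mul' k k ∘ₗ TensorProduct.map (ev x) (ev y))
      (superTensorMul G.gr G.isInternal G.mul s t) =
    (LinearMap.mul' k k ∘ₗ TensorProduct.map (ev x) (ev y)) s *
    (LinearMap.mul' k k ∘ₗ TensorProduct.map (ev x) (ev y)) t := by
  induction s with
  | zero => simp
  | add s s' hs hs' => simp only [map_add, LinearMap.add_apply, hs, hs', add_mul]
  | tmul a b =>
    induction t with
    | zero => simp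
    | add t t' ht ht' => simp only [map_add, ht, ht', mul_add]
    | tmul c d =>
      rw [superTensorMul_tmul]
      simp [sum_zmod_two, koszulSign, ev, Points.proj_one, Points.proj_zero]
      ring

instance : Mul G.Points :=
  ⟨fun x y => ⟨AlgHom.ofLinearMap (G.uconv (ev x) (ev y))
    (by
      have := G.comul_one
      rw [G.one_eq] at this
      simp [uconv, this, ev])
    (fun a b => by
      have h := G.comul_mul a b
      rw [G.mul_eq] at h
      have h2 := Points.map_superTensorMul x y (G.comul a) (G.comul b)
      rw [← h] at h2
      exact h2),
    fun a ha => by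
      have := uconv_grade _ _ 0 0 x.ev_mem y.ev_mem
      rw [dualGr, Submodule.mem_dualAnnihilator] at this
      exact this a (by simpa using ha)⟩⟩

instance : One G.Points :=
  ⟨⟨AlgHom.ofLinearMap G.counit (by simpa [G.one_eq] using G.counit_one)
    (fun a b => by simpa [G.mul_eq] using G.counit_mul a b), G.counit_odd⟩⟩

theorem uconv_assoc (φ ψ χ : Module.Dual k A) :
    G.uconv (G.uconv φ ψ) χ = G.uconv φ (G.uconv ψ χ) := by
  let := G.toCoalgebra
  exact congrArg WithConv.ofConv
    (mul_assoc (WithConv.toConv φ) (WithConv.toConv ψ) (WithConv.toConv χ))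

theorem counit_uconv (φ : Module.Dual k A) : G.uconv G.counit φ = φ := by
  let := G.toCoalgebra
  exact congrArg WithConv.ofConv (one_mul (WithConv.toConv φ))

theorem uconv_counit (φ : Module.Dual k A) : G.uconv φ G.counit = φ := by
  let := G.toCoalgebra
  exact congrArg WithConv.ofConv (mul_one (WithConv.toConv φ))

theorem lift_mul_eq : TensorProduct.lift G.mul = LinearMap.mul' k A := by
  ext a b
  simp [G.mul_eq]

/-- The functional `x ∘ S`. -/
def Points.evInv (x : G.Points) : Module.Dual k A := ev x ∘ₗ G.antipode

theorem Points.uconv_evInv_left (x : G.Points) : G.uconv x.evInv (ev x) = G.counit := by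
  ext a
  have h := congrArg x.1 (G.antipode_left a)
  rw [lift_mul_eq, G.one_eq, map_smul, map_one, smul_eq_mul, mul_one] at h
  rw [← h]
  simp only [uconv, LinearMap.comp_apply]
  generalize G.comul a = t
  induction t with
  | zero => simp
  | add s t hs ht => simp only [map_add, hs, ht]
  | tmul u v => simp [evInv, ev]

theorem Points.uconv_evInv_right (x : G.Points) : G.uconv (ev x) x.evInv = G.counit := by
  ext a
  have h := congrArg x.1 (G.antipode_right a)
  rw [lift_mul_eq, G.one_eq, map_smul, map_one, smul_eq_mul, mul_one] at h
  rw [← h]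
  simp only [uconv, LinearMap.comp_apply]
  generalize G.comul a = t
  induction t with
  | zero => simp
  | add s t hs ht => simp only [map_add, hs, ht]
  | tmul u v => simp [evInv, ev]

theorem Points.evInv_mul (x : G.Points) (a b : A) :
    x.evInv (a * b) = x.evInv a * x.evInv b := by
  let := G.toCoalgebra
  let X : WithConv (A ⊗[k] A →ₗ[k] k) :=
    WithConv.toConv (LinearMap.mul' k k ∘ₗ TensorProduct.map (ev x) (ev x))
  let Y : WithConv (A ⊗[k] A →ₗ[k] k) :=
    WithConv.toConv (LinearMap.mul' k k ∘ₗ TensorProduct.map x.evInv x.evInv)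
  let Z : WithConv (A ⊗[k] A →ₗ[k] k) := WithConv.toConv (x.evInv ∘ₗ LinearMap.mul' k A)
  have hXY : X * Y = 1 := by
    ext a b
    have h1 : ∀ s t : A ⊗[k] A, LinearMap.mul' k k (TensorProduct.map X.ofConv Y.ofConv
        (TensorProduct.tensorTensorTensorComm k A A A A (s ⊗ₜ t))) =
        LinearMap.mul' k k (TensorProduct.map (ev x) x.evInv s) *
        LinearMap.mul' k k (TensorProduct.map (ev x) x.evInv t) := by
      intro s t
      induction s with
      | zero => simp
      | add s s' hs hs' => simp only [TensorProduct.add_tmul, map_add, hs, hs', add_mul]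
      | tmul a b =>
        induction t with
        | zero => simp
        | add t t' ht ht' => simp only [TensorProduct.tmul_add, map_add, ht, ht', mul_add]
        | tmul c d =>
          simp [X, Y]
          ring
    have h2 := LinearMap.congr_fun x.uconv_evInv_right
    refine (h1 _ _).trans ((congrArg₂ (· * ·) (h2 a) (h2 b)).trans ?_)
    simp
    exact mul_comm _ _
  have hZX : Z * X = 1 := by
    ext a b
    have h1 : ∀ s t : A ⊗[k] A, LinearMap.mul' k k (TensorProduct.map Z.ofConv X.ofConv
        (TensorProduct.tensorTensorTensorComm k A A A A (s ⊗ₜ t))) =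
        LinearMap.mul' k k (TensorProduct.map x.evInv (ev x)
          (superTensorMul G.gr G.isInternal G.mul s t)) := by
      intro s t
      induction s with
      | zero => simp
      | add s s' hs hs' =>
        simp only [TensorProduct.add_tmul, map_add, hs, hs', LinearMap.add_apply]
      | tmul a b =>
        induction t with
        | zero => simp
        | add t t' ht ht' => simp only [TensorProduct.tmul_add, map_add, ht, ht']
        | tmul c d =>
          rw [superTensorMul_tmul]
          conv_lhs => rw [← superProj_add G.gr G.isInternal c]
          simp [sum_zmod_two, X, Z, koszulSign, ev, mul_add, Points.proj_one, Points.proj_zero]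
          ring
    have h2 := LinearMap.congr_fun x.uconv_evInv_left (a * b)
    have h3 := G.comul_mul a b
    rw [G.mul_eq] at h3
    refine (h1 (G.comul a) (G.comul b)).trans ?_
    rw [← h3]
    refine Eq.trans h2 ?_
    rw [← G.mul_eq, G.counit_mul]
    simp
    exact mul_comm _ _
  have := left_inv_eq_right_inv hZX hXY
  exact LinearMap.congr_fun (congrArg WithConv.ofConv this) (a ⊗ₜ b)

instance : Inv G.Points :=
  ⟨fun x => ⟨AlgHom.ofLinearMap x.evInv
    (by
      have h := G.antipode_left 1
      have h1 := G.comul_one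
      have h2 := G.counit_one
      rw [G.one_eq] at h1 h2
      rw [lift_mul_eq, h1, h2, G.one_eq] at h
      simp at h
      simp [Points.evInv, ev, h])
    x.evInv_mul,
    fun a ha => x.2 _ (G.antipode_mem 1 a ha)⟩⟩

/-- The group structure of `G(k)`: `x y = (x ⊗ y) ∘ μ^*`, the unit is the counit of `𝒪(G)`, and the
inverse of `x` is its composition with the antipode of `𝒪(G)`. -/
instance : Group G.Points where
  mul_assoc x y z := Points.ext (LinearMap.congr_fun (uconv_assoc (ev x) (ev y) (ev z)))
  one_mul x := Points.ext (LinearMap.congr_fun (counit_uconv (ev x)))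
  mul_one x := Points.ext (LinearMap.congr_fun (uconv_counit (ev x)))
  inv_mul_cancel x := Points.ext (LinearMap.congr_fun x.uconv_evInv_left)

/-! ### Distributions -/

variable (G)

/-- The convolution product `φ ⋆ ψ = (φ ⊗ ψ) ∘ μ^*` of two functionals on `𝒪(G)`. -/
def conv : Module.Dual k A →ₗ[k] Module.Dual k A →ₗ[k] Module.Dual k A :=
  (TensorProduct.mk k (Module.Dual k A) (Module.Dual k A)).compr₂
    (G.comul.dualMap ∘ₗ superDualDistrib G.gr G.isInternal)

variable {G}

theorem conv_apply (φ ψ : Module.Dual k A) :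
    G.conv φ ψ = ∑ i : ZMod 2, ∑ j : ZMod 2, koszulSign k i j •
      G.uconv (φ ∘ₗ superProj G.gr G.isInternal i) (ψ ∘ₗ superProj G.gr G.isInternal j) := by
  ext a
  simp only [conv, superDualDistrib, koszulTwist, uconv, LinearMap.compr₂_apply,
    TensorProduct.mk_apply, LinearMap.comp_apply, LinearMap.dualMap_apply, sum_zmod_two,
    LinearMap.add_apply, LinearMap.smul_apply, map_add, map_smul]
  generalize G.comul a = t
  induction t with
  | zero => simp
  | add s t hs ht => simp only [map_add, smul_add] at hs ht ⊢; linear_combination hs + ht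
  | tmul u v => simp

theorem comp_proj_of_mem {φ : Module.Dual k A} {i : ZMod 2} (hφ : φ ∈ dualGr G.gr i) (j : ZMod 2) :
    φ ∘ₗ superProj G.gr G.isInternal j = if j = i then φ else 0 := by
  rw [dualGr, Submodule.mem_dualAnnihilator] at hφ
  have key : ∀ a, φ (superProj G.gr G.isInternal (i + 1) a) = 0 :=
    fun a => hφ _ (superProj_mem _ _ _ _)
  ext a
  rw [LinearMap.comp_apply]
  rcases zmod_two_cases i with rfl | rfl <;> rcases zmod_two_cases j with rfl | rfl
  · conv_rhs => rw [if_pos rfl, ← superProj_add G.gr G.isInternal a, map_add]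
    have := key a
    rw [zero_add] at this
    rw [this, add_zero]
  · simpa using key a
  · simpa [show (1 : ZMod 2) + 1 = 0 from rfl] using key a
  · conv_rhs => rw [if_pos rfl, ← superProj_add G.gr G.isInternal a, map_add]
    have := key a
    rw [show (1 : ZMod 2) + 1 = 0 from rfl] at this
    rw [this, zero_add]

theorem comp_proj_mem (φ : Module.Dual k A) (i : ZMod 2) :
    φ ∘ₗ superProj G.gr G.isInternal i ∈ dualGr G.gr i := by
  rw [dualGr, Submodule.mem_dualAnnihilator]
  intro a ha
  rw [LinearMap.comp_apply, superProj_of_mem _ _ ha, if_neg (by clear ha; revert i; decide), map_zero]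

theorem comp_proj_add (φ : Module.Dual k A) :
    φ ∘ₗ superProj G.gr G.isInternal 0 + φ ∘ₗ superProj G.gr G.isInternal 1 = φ := by
  ext a
  simp only [LinearMap.add_apply, LinearMap.comp_apply]
  rw [← map_add, superProj_add]

theorem exists_homogeneous (φ : Module.Dual k A) :
    ∃ φ₀ ∈ dualGr G.gr 0, ∃ φ₁ ∈ dualGr G.gr 1, φ = φ₀ + φ₁ :=
  ⟨_, comp_proj_mem φ 0, _, comp_proj_mem φ 1, (comp_proj_add φ).symm⟩

theorem conv_homogeneous {φ ψ : Module.Dual k A} {i j : ZMod 2} (hφ : φ ∈ dualGr G.gr i)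
    (hψ : ψ ∈ dualGr G.gr j) : G.conv φ ψ = koszulSign k i j • G.uconv φ ψ := by
  rw [conv_apply, Finset.sum_eq_single i, Finset.sum_eq_single j]
  · rw [comp_proj_of_mem hφ, comp_proj_of_mem hψ, if_pos rfl, if_pos rfl]
  · intro l _ hl
    rw [comp_proj_of_mem hψ, if_neg hl]
    simp [uconv]
  · simp
  · intro l _ hl
    rw [comp_proj_of_mem hφ, if_neg hl]
    simp [uconv]
  · simp

theorem conv_mem {φ ψ : Module.Dual k A} {i j : ZMod 2} (hφ : φ ∈ dualGr G.gr i)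
    (hψ : ψ ∈ dualGr G.gr j) : G.conv φ ψ ∈ dualGr G.gr (i + j) := by
  rw [conv_homogeneous hφ hψ]
  exact Submodule.smul_mem _ _ (uconv_grade _ _ _ _ hφ hψ)

theorem uconv_smul (c : k) (φ ψ : Module.Dual k A) :
    G.uconv φ (c • ψ) = c • G.uconv φ ψ := by
  simp [uconv, TensorProduct.map_smul_right, LinearMap.smul_comp, LinearMap.comp_smul]

theorem smul_uconv (c : k) (φ ψ : Module.Dual k A) :
    G.uconv (c • φ) ψ = c • G.uconv φ ψ := by
  simp [uconv, TensorProduct.map_smul_left, LinearMap.smul_comp, LinearMap.comp_smul]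

theorem koszulSign_cocycle (i j l : ZMod 2) :
    koszulSign k (i + j) l * koszulSign k i j = koszulSign k i (j + l) * koszulSign k j l := by
  rcases zmod_two_cases i with rfl | rfl <;> rcases zmod_two_cases j with rfl | rfl <;>
  rcases zmod_two_cases l with rfl | rfl <;> simp [koszulSign, show (1 : ZMod 2) + 1 = 0 from rfl]

theorem conv_assoc_homogeneous {φ ψ χ : Module.Dual k A} {i j l : ZMod 2}
    (hφ : φ ∈ dualGr G.gr i) (hψ : ψ ∈ dualGr G.gr j) (hχ : χ ∈ dualGr G.gr l) :
    G.conv (G.conv φ ψ) χ = G.conv φ (G.conv ψ χ) := by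
  rw [conv_homogeneous (conv_mem hφ hψ) hχ, conv_homogeneous hφ (conv_mem hψ hχ),
    conv_homogeneous hφ hψ, conv_homogeneous hψ hχ, smul_uconv, uconv_smul, smul_smul, smul_smul,
    uconv_assoc, koszulSign_cocycle]

theorem conv_assoc (φ ψ χ : Module.Dual k A) :
    G.conv (G.conv φ ψ) χ = G.conv φ (G.conv ψ χ) := by
  obtain ⟨φ₀, h0, φ₁, h1, rfl⟩ := exists_homogeneous (G := G) φ
  obtain ⟨ψ₀, h2, ψ₁, h3, rfl⟩ := exists_homogeneous (G := G) ψ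
  obtain ⟨χ₀, h4, χ₁, h5, rfl⟩ := exists_homogeneous (G := G) χ
  simp only [map_add, LinearMap.add_apply, conv_assoc_homogeneous h0 h2 h4,
    conv_assoc_homogeneous h0 h2 h5, conv_assoc_homogeneous h0 h3 h4,
    conv_assoc_homogeneous h0 h3 h5, conv_assoc_homogeneous h1 h2 h4,
    conv_assoc_homogeneous h1 h2 h5, conv_assoc_homogeneous h1 h3 h4,
    conv_assoc_homogeneous h1 h3 h5]

theorem ev_one_conv (φ : Module.Dual k A) : G.conv (ev (1 : G.Points)) φ = φ := by
  have key : ∀ i, ∀ ψ ∈ dualGr G.gr i, G.conv (ev (1 : G.Points)) ψ = ψ := fun i ψ hψ => by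
    rw [conv_homogeneous (Points.ev_mem _) hψ]
    simp only [koszulSign, zero_ne_one, false_and, if_false, one_smul]
    exact counit_uconv ψ
  obtain ⟨φ₀, h0, φ₁, h1, rfl⟩ := exists_homogeneous (G := G) φ
  rw [map_add, key 0 _ h0, key 1 _ h1]

theorem conv_ev_one (φ : Module.Dual k A) : G.conv φ (ev (1 : G.Points)) = φ := by
  have key : ∀ i, ∀ ψ ∈ dualGr G.gr i, G.conv ψ (ev (1 : G.Points)) = ψ := fun i ψ hψ => by
    rw [conv_homogeneous hψ (Points.ev_mem _)]
    simp only [koszulSign, zero_ne_one, and_false, if_false, one_smul]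
    exact uconv_counit ψ
  obtain ⟨φ₀, h0, φ₁, h1, rfl⟩ := exists_homogeneous (G := G) φ
  rw [map_add, LinearMap.add_apply, key 0 _ h0, key 1 _ h1]

variable (G)

/-- The space `𝒪(G)^*` of all functionals, as an algebra for the convolution product. -/
def ConvAlgebra (_ : AffineSupergroup k A) : Type _ := Module.Dual k A

instance : AddCommGroup G.ConvAlgebra := inferInstanceAs (AddCommGroup (Module.Dual k A))

instance : Module k G.ConvAlgebra := inferInstanceAs (Module k (Module.Dual k A))

instance : Ring G.ConvAlgebra where
  __ := (inferInstance : AddCommGroup G.ConvAlgebra)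
  mul φ ψ := G.conv φ ψ
  one := ev (1 : G.Points)
  mul_assoc := conv_assoc
  one_mul := ev_one_conv
  mul_one := conv_ev_one
  left_distrib φ := map_add (G.conv φ)
  right_distrib φ ψ χ := G.conv.map_add₂ φ ψ χ
  zero_mul φ := G.conv.map_zero₂ φ
  mul_zero φ := map_zero (G.conv φ)

instance : Algebra k G.ConvAlgebra :=
  Algebra.ofModule (fun c φ ψ => G.conv.map_smul₂ c φ ψ) (fun c φ ψ => map_smul (G.conv φ) c ψ)

/-- The maximal ideal `m_x` of the functions that vanish at `x`. -/
def maxIdeal {G : AffineSupergroup k A} (x : G.Points) : Submodule k A := LinearMap.ker (ev x)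

/-- `D_n(G, x)`: the distributions supported at `x` of order at most `n`, that is,
the functionals on `𝒪(G)` that vanish on `m_x ^ (n + 1)`. -/
def distOrder {G : AffineSupergroup k A} (x : G.Points) (n : ℕ) : Submodule k (Module.Dual k A) :=
  (maxIdeal x ^ (n + 1)).dualAnnihilator

/-- `D(G, x)`: the distributions supported at `x`, that is, the union of the increasing sequence of
the `D_n(G, x)`. -/
def distAt {G : AffineSupergroup k A} (x : G.Points) : Submodule k (Module.Dual k A) :=
  ⨆ n : ℕ, distOrder x n

/-- `D(G)`: the distributions of finite order, that is, the finite sums of distributions supported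
at the `k`-points of `G`. -/
def dist : Submodule k (Module.Dual k A) := ⨆ x : G.Points, distAt x

/-- `D(G)` as a vector space. -/
def Dist : Type _ := G.dist

instance : AddCommGroup G.Dist := inferInstanceAs (AddCommGroup G.dist)

instance : Module k G.Dist := inferInstanceAs (Module k G.dist)

/-- The inclusion of `D(G)` in `𝒪(G)^*`. -/
def distInclusion : G.Dist →ₗ[k] Module.Dual k A := G.dist.subtype

/-! ### The Lie superalgebra of a supergroup -/

/-- The space `Lie(G) = D₁(G, e)⁺`: the distributions at `e` of order at most `1` that vanish on
the constants. It is dual to `m_e / m_e²`. -/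
def lieSpace : Submodule k (Module.Dual k A) :=
  distOrder (1 : G.Points) 1 ⊓ LinearMap.ker (Module.Dual.eval k A 1)

variable {G}

theorem mem_lieSpace {X : Module.Dual k A} : X ∈ G.lieSpace ↔
    ∀ a b, X (a * b) = X a * G.counit b + G.counit a * X b := by
  have e1 : G.counit (1 : A) = 1 := by rw [← G.one_eq, G.counit_one]
  have em : ∀ a b, G.counit (a * b) = G.counit a * G.counit b := fun a b => by
    rw [← G.mul_eq, G.counit_mul]
  have hm : ∀ a, a ∈ maxIdeal (1 : G.Points) ↔ G.counit a = 0 := fun a => Iff.rfl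
  rw [lieSpace, Submodule.mem_inf, distOrder, Submodule.mem_dualAnnihilator, LinearMap.mem_ker,
    Module.Dual.eval_apply, pow_succ, pow_one]
  constructor
  · rintro ⟨h1, h2⟩ a b
    have h3 := h1 ((a - G.counit a • 1) * (b - G.counit b • 1))
      (Submodule.mul_mem_mul ((hm _).2 (by simp [e1])) ((hm _).2 (by simp [e1])))
    simp [sub_mul, mul_sub, h2] at h3
    linear_combination h3
  · intro h
    refine ⟨fun w hw => ?_, ?_⟩
    · induction hw using Submodule.mul_induction_on' with
      | mem_mul_mem a ha b hb =>
        rw [h, (hm a).1 ha, (hm b).1 hb]; simp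
      | add x _ y _ hx hy => rw [map_add, hx, hy, add_zero]
    · have := h 1 1
      simpa [e1] using this

theorem counit_proj (i : ZMod 2) (a : A) :
    G.counit (superProj G.gr G.isInternal i a) = if i = 0 then G.counit a else 0 := by
  rcases zmod_two_cases i with rfl | rfl
  · exact (1 : G.Points).proj_zero a
  · exact (1 : G.Points).proj_one a

theorem proj_mul (i : ZMod 2) (a b : A) : superProj G.gr G.isInternal i (a * b) =
    superProj G.gr G.isInternal 0 a * superProj G.gr G.isInternal i b +
    superProj G.gr G.isInternal 1 a * superProj G.gr G.isInternal (i + 1) b := by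
  have hm : ∀ j l, superProj G.gr G.isInternal i
      (superProj G.gr G.isInternal j a * superProj G.gr G.isInternal l b) =
      if i = j + l then superProj G.gr G.isInternal j a * superProj G.gr G.isInternal l b
      else 0 := fun j l => by
    apply superProj_of_mem
    rw [← G.mul_eq]
    exact G.mul_mem _ _ _ (superProj_mem _ _ _ _) _ (superProj_mem _ _ _ _)
  conv_lhs => rw [← superProj_add G.gr G.isInternal a, ← superProj_add G.gr G.isInternal b]
  simp only [add_mul, mul_add, map_add, hm]
  rcases zmod_two_cases i with rfl | rfl <;>
    simp [show (1 : ZMod 2) + 1 = 0 from rfl, add_comm]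

theorem lieSpace_comp_proj {X : Module.Dual k A} (hX : X ∈ G.lieSpace) (i : ZMod 2) :
    X ∘ₗ superProj G.gr G.isInternal i ∈ G.lieSpace := by
  rw [mem_lieSpace] at *
  intro a b
  simp only [LinearMap.comp_apply, proj_mul, map_add, hX, counit_proj]
  rcases zmod_two_cases i with rfl | rfl <;>
    simp [show (1 : ZMod 2) + 1 = 0 from rfl, add_comm]

variable (G) in
/-- The supercommutator `[φ, ψ] = φ ⋆ ψ - (-1)^(|φ| |ψ|) ψ ⋆ φ` for the convolution product. -/
def superCommutator : Module.Dual k A →ₗ[k] Module.Dual k A →ₗ[k] Module.Dual k A :=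
  G.conv + ∑ i : ZMod 2, ∑ j : ZMod 2, (-koszulSign k i j) •
    G.conv.flip.compl₁₂ (superProj G.gr G.isInternal i).dualMap
      (superProj G.gr G.isInternal j).dualMap

theorem superCommutator_homogeneous {φ ψ : Module.Dual k A} {i j : ZMod 2}
    (hφ : φ ∈ dualGr G.gr i) (hψ : ψ ∈ dualGr G.gr j) :
    G.superCommutator φ ψ = G.conv φ ψ - koszulSign k i j • G.conv ψ φ := by
  have h1 : ∀ l, (superProj G.gr G.isInternal l).dualMap φ = if l = i then φ else 0 :=
    comp_proj_of_mem hφ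
  have h2 : ∀ l, (superProj G.gr G.isInternal l).dualMap ψ = if l = j then ψ else 0 :=
    comp_proj_of_mem hψ
  simp only [superCommutator, sum_zmod_two, LinearMap.add_apply,
    LinearMap.smul_apply, LinearMap.compl₁₂_apply, LinearMap.flip_apply, h1, h2, sub_eq_add_neg]
  rcases zmod_two_cases i with rfl | rfl <;> rcases zmod_two_cases j with rfl | rfl <;> simp

theorem uconv_mul_of_lieSpace {X Y : Module.Dual k A} {i j : ZMod 2} (hX : X ∈ G.lieSpace)
    (hY : Y ∈ G.lieSpace) (hXi : X ∈ dualGr G.gr i) (hYj : Y ∈ dualGr G.gr j) (a b : A) :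
    G.uconv X Y (a * b) = G.uconv X Y a * G.counit b + X a * Y b +
      koszulSign k i j * Y a * X b + G.counit a * G.uconv X Y b := by
  rw [mem_lieSpace] at hX hY
  have pX : ∀ l c, X (superProj G.gr G.isInternal l c) = if l = i then X c else 0 := fun l c => by
    have := LinearMap.congr_fun (comp_proj_of_mem hXi l) c
    rw [LinearMap.comp_apply] at this
    rw [this]; split_ifs <;> simp
  have pY : ∀ l c, Y (superProj G.gr G.isInternal l c) = if l = j then Y c else 0 := fun l c => by
    have := LinearMap.congr_fun (comp_proj_of_mem hYj l) c
    rw [LinearMap.comp_apply] at this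
    rw [this]; split_ifs <;> simp
  let P : Module.Dual k A → Module.Dual k A → A ⊗[k] A →ₗ[k] k :=
    fun φ ψ => LinearMap.mul' k k ∘ₗ TensorProduct.map φ ψ
  have key : ∀ s t : A ⊗[k] A, P X Y (superTensorMul G.gr G.isInternal G.mul s t) =
      P X Y s * P G.counit G.counit t + P X G.counit s * P G.counit Y t +
      koszulSign k i j * P G.counit Y s * P X G.counit t +
      P G.counit G.counit s * P X Y t := by
    intro s t
    induction s with
    | zero => simp
    | add s s' hs hs' => simp only [map_add, LinearMap.add_apply, hs, hs']; ring
    | tmul c d =>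
      induction t with
      | zero => simp
      | add t t' ht ht' => simp only [map_add, ht, ht']; ring
      | tmul e f =>
        rw [superTensorMul_tmul]
        simp only [P, sum_zmod_two, map_add, map_smul, LinearMap.comp_apply,
          TensorProduct.map_tmul, LinearMap.mul'_apply, hX, hY, pX, pY, counit_proj, smul_eq_mul]
        rcases zmod_two_cases i with rfl | rfl <;> rcases zmod_two_cases j with rfl | rfl <;>
          simp [koszulSign] <;> ring
  have h3 := G.comul_mul a b
  rw [G.mul_eq] at h3
  have h4 := key (G.comul a) (G.comul b)
  rw [← h3] at h4
  have c1 : ∀ φ a, P φ G.counit (G.comul a) = φ a := fun φ => LinearMap.congr_fun (uconv_counit φ)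
  have c2 : ∀ φ a, P G.counit φ (G.comul a) = φ a := fun φ => LinearMap.congr_fun (counit_uconv φ)
  simp only [c1, c2] at h4
  exact h4

theorem koszulSign_comm (i j : ZMod 2) : koszulSign k i j = koszulSign k j i := by
  simp [koszulSign, and_comm]

theorem koszulSign_mul_self (i j : ZMod 2) : koszulSign k i j * koszulSign k i j = 1 := by
  unfold koszulSign; split_ifs <;> simp

theorem superCommutator_mem_homogeneous {X Y : Module.Dual k A} {i j : ZMod 2}
    (hX : X ∈ G.lieSpace) (hY : Y ∈ G.lieSpace) (hXi : X ∈ dualGr G.gr i)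
    (hYj : Y ∈ dualGr G.gr j) : G.superCommutator X Y ∈ G.lieSpace := by
  rw [superCommutator_homogeneous hXi hYj, conv_homogeneous hXi hYj, conv_homogeneous hYj hXi,
    mem_lieSpace]
  intro a b
  simp only [LinearMap.sub_apply, LinearMap.smul_apply, smul_eq_mul,
    uconv_mul_of_lieSpace hX hY hXi hYj, uconv_mul_of_lieSpace hY hX hYj hXi,
    koszulSign_comm j i]
  linear_combination (-(koszulSign k i j * X a * Y b)) * koszulSign_mul_self (k := k) i j

theorem superCommutator_mem {X Y : Module.Dual k A}
    (hX : X ∈ G.lieSpace) (hY : Y ∈ G.lieSpace) : G.superCommutator X Y ∈ G.lieSpace := by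
  rw [← comp_proj_add (G := G) X, ← comp_proj_add (G := G) Y]
  simp only [map_add, LinearMap.add_apply]
  have h := fun i j => superCommutator_mem_homogeneous (lieSpace_comp_proj hX i)
    (lieSpace_comp_proj hY j) (comp_proj_mem X i) (comp_proj_mem Y j)
  exact add_mem (add_mem (h 0 0) (h 1 0)) (add_mem (h 0 1) (h 1 1))

theorem superCommutator_grade {φ ψ : Module.Dual k A} {i j : ZMod 2}
    (hφ : φ ∈ dualGr G.gr i) (hψ : ψ ∈ dualGr G.gr j) :
    G.superCommutator φ ψ ∈ dualGr G.gr (i + j) := by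
  rw [superCommutator_homogeneous hφ hψ]
  exact sub_mem (conv_mem hφ hψ)
    (Submodule.smul_mem _ _ (add_comm i j ▸ conv_mem hψ hφ))

theorem superCommutator_skew {φ ψ : Module.Dual k A} {i j : ZMod 2}
    (hφ : φ ∈ dualGr G.gr i) (hψ : ψ ∈ dualGr G.gr j) :
    G.superCommutator φ ψ = -(koszulSign k i j • G.superCommutator ψ φ) := by
  rw [superCommutator_homogeneous hφ hψ, superCommutator_homogeneous hψ hφ, smul_sub, smul_smul,
    koszulSign_comm j i, koszulSign_mul_self, one_smul]
  abel

theorem superCommutator_jacobi_homogeneous {φ ψ χ : Module.Dual k A} {i j l : ZMod 2}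
    (hφ : φ ∈ dualGr G.gr i) (hψ : ψ ∈ dualGr G.gr j) (hχ : χ ∈ dualGr G.gr l) :
    G.superCommutator φ (G.superCommutator ψ χ) =
      G.superCommutator (G.superCommutator φ ψ) χ +
        koszulSign k i j • G.superCommutator ψ (G.superCommutator φ χ) := by
  rw [superCommutator_homogeneous hφ (superCommutator_grade hψ hχ),
    superCommutator_homogeneous (superCommutator_grade hφ hψ) hχ,
    superCommutator_homogeneous hψ (superCommutator_grade hφ hχ),
    superCommutator_homogeneous hφ hψ, superCommutator_homogeneous hφ hχ,
    superCommutator_homogeneous hψ hχ]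
  simp only [map_sub, map_smul, LinearMap.sub_apply, LinearMap.smul_apply, conv_assoc]
  rcases zmod_two_cases i with rfl | rfl <;> rcases zmod_two_cases j with rfl | rfl <;>
  rcases zmod_two_cases l with rfl | rfl <;>
  simp only [koszulSign, show (1 : ZMod 2) + 1 = 0 from rfl, zero_add, add_zero, and_true,
    true_and, and_self, if_true, if_false, zero_ne_one] <;> module

theorem superCommutator_jacobi {φ ψ : Module.Dual k A} {i j : ZMod 2}
    (hφ : φ ∈ dualGr G.gr i) (hψ : ψ ∈ dualGr G.gr j) (χ : Module.Dual k A) :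
    G.superCommutator φ (G.superCommutator ψ χ) =
      G.superCommutator (G.superCommutator φ ψ) χ +
        koszulSign k i j • G.superCommutator ψ (G.superCommutator φ χ) := by
  obtain ⟨χ₀, h4, χ₁, h5, rfl⟩ := exists_homogeneous (G := G) χ
  simp only [map_add, superCommutator_jacobi_homogeneous hφ hψ h4,
    superCommutator_jacobi_homogeneous hφ hψ h5, smul_add]
  abel

variable (G)

/-- `Lie(G)` as a vector space. -/
def Lie : Type _ := G.lieSpace

instance : AddCommGroup G.Lie := inferInstanceAs (AddCommGroup G.lieSpace)

instance : Module k G.Lie := inferInstanceAs (Module k G.lieSpace)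

/-- The inclusion of `Lie(G)` in `𝒪(G)^*`. -/
def lieInclusion : G.Lie →ₗ[k] Module.Dual k A := G.lieSpace.subtype

theorem lieInclusion_injective : Function.Injective G.lieInclusion :=
  G.lieSpace.subtype_injective

/-- The part of parity `i` of `Lie(G)`. -/
def lieGr (i : ZMod 2) : Submodule k G.Lie := (dualGr G.gr i).comap G.lieInclusion

theorem lieGr_isCompl : IsCompl (G.lieGr 0) (G.lieGr 1) := by
  constructor
  · rw [Submodule.disjoint_def]
    rintro X h0 h1
    refine G.lieInclusion_injective (LinearMap.ext fun a => ?_)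
    have h0' := LinearMap.congr_fun (comp_proj_of_mem (G := G) h0 1) a
    have h1' := LinearMap.congr_fun (comp_proj_of_mem (G := G) h1 1) a
    rw [if_neg one_ne_zero] at h0'
    rw [if_pos rfl] at h1'
    rw [map_zero]
    exact h1'.symm.trans h0'
  · rw [codisjoint_iff, eq_top_iff]
    rintro X -
    exact Submodule.mem_sup.2 ⟨⟨_, lieSpace_comp_proj X.2 0⟩, comp_proj_mem X.1 0,
      ⟨_, lieSpace_comp_proj X.2 1⟩, comp_proj_mem X.1 1,
      G.lieInclusion_injective (comp_proj_add X.1)⟩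

/-- The bracket of `Lie(G)`: the supercommutator of distributions. -/
def lieBracket : G.Lie →ₗ[k] G.Lie →ₗ[k] G.Lie :=
  LinearMap.mk₂ k
    (fun X Y => ⟨G.superCommutator (G.lieInclusion X) (G.lieInclusion Y),
      superCommutator_mem X.2 Y.2⟩)
    (fun X Y Z => G.lieInclusion_injective (G.superCommutator.map_add₂ X.1 Y.1 Z.1))
    (fun c X Y => G.lieInclusion_injective (G.superCommutator.map_smul₂ c X.1 Y.1))
    (fun X Y Z => G.lieInclusion_injective (map_add (G.superCommutator X.1) Y.1 Z.1))
    (fun c X Y => G.lieInclusion_injective (map_smul (G.superCommutator X.1) c Y.1))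

theorem lieInclusion_bracket (X Y : G.Lie) : G.lieInclusion (G.lieBracket X Y) =
    G.superCommutator (G.lieInclusion X) (G.lieInclusion Y) := rfl

/-- The Lie superalgebra `Lie(G)`. -/
def lie : LieSuperalgebra k G.Lie where
  gr := G.lieGr
  isInternal := isInternal_of_isCompl G.lieGr G.lieGr_isCompl
  bracket := G.lieBracket
  bracket_mem i j X hX Y hY := by
    rw [lieGr, Submodule.mem_comap, lieInclusion_bracket]
    exact superCommutator_grade hX hY
  skew i j X hX Y hY := G.lieInclusion_injective (by
    rw [map_neg, map_smul, lieInclusion_bracket, lieInclusion_bracket]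
    exact superCommutator_skew hX hY)
  jacobi i j X hX Y hY Z := G.lieInclusion_injective (by
    rw [map_add, map_smul]
    simp only [lieInclusion_bracket]
    exact superCommutator_jacobi hX hY _)

/-- The morphism of algebras `α : U(Lie(G)) → 𝒪(G)^*` that extends the inclusion
`Lie(G) ⊆ 𝒪(G)^*`. -/
def alphaHom : G.lie.Env →ₐ[k] G.ConvAlgebra :=
  RingQuot.liftAlgHom k ⟨TensorAlgebra.lift k
    (show G.Lie →ₗ[k] G.ConvAlgebra from G.lieInclusion), by
    rintro _ _ ⟨i, j, X, Y, hX, hY⟩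
    have h := superCommutator_homogeneous (G := G) hX hY
    rw [map_mul, map_add, map_smul, map_mul, TensorAlgebra.lift_ι_apply,
      TensorAlgebra.lift_ι_apply, TensorAlgebra.lift_ι_apply]
    exact (add_sub_cancel (koszulSign k i j • G.conv Y.1 X.1) (G.conv X.1 Y.1)).symm.trans
      (congrArg _ h.symm)⟩

/-- The morphism `α` as a linear map into the space of functionals. -/
def alpha : G.lie.Env →ₗ[k] Module.Dual k A := G.alphaHom.toLinearMap

/-- The Hopf superalgebra structure `D` on `D(G)` is the one given by the convolution product with
unit `ev_e`, and by `Δ(φ)(f ⊗ h) = φ(f h)`, `η(φ) = φ(1)`, `S(φ)(f) = φ(i^* f)`; the parity of a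
distribution is its parity as a functional. -/
structure IsDistributionHopf (D : HopfSuperalgebra k G.Dist) : Prop where
  gr_eq : ∀ i, D.gr i = (dualGr G.gr i).comap G.distInclusion
  mul_eq : ∀ φ ψ, G.distInclusion (D.mul φ ψ) = G.conv (G.distInclusion φ) (G.distInclusion ψ)
  one_eq : G.distInclusion D.one = ev (1 : G.Points)
  comul_eq : ∀ φ f h, superDualDistrib G.gr G.isInternal
    (TensorProduct.map G.distInclusion G.distInclusion (D.comul φ)) (f ⊗ₜ[k] h) =
      G.distInclusion φ (f * h)
  counit_eq : ∀ φ, D.counit φ = G.distInclusion φ 1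
  antipode_eq : ∀ φ f, G.distInclusion (D.antipode φ) f = G.distInclusion φ (G.antipode f)

end AffineSupergroup

end

/-! Everything is computed inside $\mathcal O(G)^*$. Let $j:V\to\mathcal O(G)^*$ be an injective
linear map whose image is closed under convolution, parity projections and $\phi\mapsto\phi\circ
i^*$, contains $\mathrm{ev}_e$, and is such that $\phi\circ\mathrm{mult}$ comes from $V\otimes V$
for each $\phi$ in the image. Then $V$ carries a Hopf superalgebra structure, each axiom being the
transpose of one for $\mathcal O(G)$, and $j$ determines it (`IsHopfSubspace.exists_isDualHopf`,
`IsDualHopf.isIso`). This applies to $D(G)$ with its inclusion, to $\mathcal U(\mathfrak g)$ with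
$\alpha$, and to $k|G|\otimes\mathcal U(\mathfrak g)$ with $g\otimes
X\mapsto\mathrm{ev}_g\star\alpha(X)$ (`smashMap`). The first and the third have the same image,
whence $\Psi$; the formulas for the structure become identities between functionals.

Three facts make this work.

The map $\alpha$ is injective with image $D(G,e)$ (`alpha_injective`, `range_alpha`). Take
homogeneous functions $f_i$ that form a basis of $m_e/m_e^2$ and the dual basis $x_i$ of $\mathfrak
g$. Monomials of degree $n$ in the $f_i$ without repeated odd index span $m_e^n$ modulo $m_e^{n+1}$,
and the words in the $x_i$ with the same indices span the $n$-th layer of $\mathcal U(\mathfrak g)$.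
The $x_i$ act as superderivations, so the pairing of these two families is a diagonal matrix, with
nonzero diagonal in characteristic zero. Injectivity and surjectivity follow by induction on $n$;
the Poincaré–Birkhoff–Witt theorem is not needed.

Convolution with $\mathrm{ev}_g$ is the transpose of an algebra endomorphism of $\mathcal O(G)$, so
it translates $D(G,x)$ to $D(G,gx)$. With the range of $\alpha$ being a subalgebra, this gives
closure under products (`conv_mem_distAt`); closure under the antipode is an induction on the order
(`comp_antipode_mem_distAt`).

The spaces $D(G,x)$ are independent, being contained in joint generalized eigenspaces of the even
functions with distinct eigenvalues (`iSupIndep_distAt`). -/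

open scoped TensorProduct Pointwise

noncomputable section

universe u

/-! ### Pairings of tensor products -/

section Pairing

variable {k : Type*} [Field k]

/-- The pairing of `V ⊗ W` with `A ⊗ B` obtained from two families of functionals. -/
def dualPair {V W A B : Type*} [AddCommGroup V] [Module k V] [AddCommGroup W] [Module k W]
    [AddCommGroup A] [Module k A] [AddCommGroup B] [Module k B]
    (j : V →ₗ[k] Module.Dual k A) (l : W →ₗ[k] Module.Dual k B) :
    V ⊗[k] W →ₗ[k] Module.Dual k (A ⊗[k] B) :=
  TensorProduct.dualDistrib k A B ∘ₗ TensorProduct.map j l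

theorem dualPair_tmul {V W A B : Type*} [AddCommGroup V] [Module k V] [AddCommGroup W] [Module k W]
    [AddCommGroup A] [Module k A] [AddCommGroup B] [Module k B]
    (j : V →ₗ[k] Module.Dual k A) (l : W →ₗ[k] Module.Dual k B) (v : V) (w : W) (a : A) (b : B) :
    dualPair j l (v ⊗ₜ w) (a ⊗ₜ b) = j v a * l w b := by
  simp [dualPair]

/-- Write $t=\sum m_i\otimes c_i$ over a basis $c$ of $W$. Contracting the first slot with $a\in A$
gives $\sum j(m_i)(a)\,c_i$, which `l` sends to zero; independence of the $c_i$ kills every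
coefficient. It lets identities in $V\otimes W$ be tested on functions. -/
theorem dualPair_injective {V W A B : Type*} [AddCommGroup V] [Module k V] [AddCommGroup W]
    [Module k W] [AddCommGroup A] [Module k A] [AddCommGroup B] [Module k B]
    {j : V →ₗ[k] Module.Dual k A} {l : W →ₗ[k] Module.Dual k B}
    (hj : Function.Injective j) (hl : Function.Injective l) :
    Function.Injective (dualPair j l) := by
  rw [← LinearMap.ker_eq_bot, LinearMap.ker_eq_bot']
  intro t ht
  let c := Module.Basis.ofVectorSpace k W
  obtain ⟨b, rfl⟩ := TensorProduct.eq_repr_basis_right c t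
  have h1 : ∀ a, (b.sum fun i m => j m a • c i) = 0 := by
    intro a
    apply hl
    ext x
    have := LinearMap.congr_fun ht (a ⊗ₜ x)
    rw [Finsupp.sum, map_sum, LinearMap.sum_apply] at this
    simp only [dualPair_tmul] at this
    rw [Finsupp.sum, map_sum, LinearMap.sum_apply]
    simpa using this
  have h2 : b = 0 := by
    ext i
    apply hj
    ext a
    rw [Finsupp.zero_apply, map_zero]
    have h3 := (linearIndependent_iff'.1 c.linearIndependent) b.support (fun i => j (b i) a) (h1 a)
    by_cases hi : i ∈ b.support
    · exact h3 i hi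
    · rw [Finsupp.notMem_support_iff.1 hi]; simp
  rw [h2, Finsupp.sum_zero_index]

/-- The factorization of a linear map through an injective one. -/
def factorThrough {U V W : Type*} [AddCommGroup U] [Module k U] [AddCommGroup V] [Module k V]
    [AddCommGroup W] [Module k W] (g : V →ₗ[k] W) (hg : Function.Injective g) (f : U →ₗ[k] W)
    (h : ∀ u, f u ∈ LinearMap.range g) : U →ₗ[k] V :=
  (LinearEquiv.ofInjective g hg).symm.toLinearMap ∘ₗ f.codRestrict _ h

theorem factorThrough_apply {U V W : Type*} [AddCommGroup U] [Module k U] [AddCommGroup V]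
    [Module k V] [AddCommGroup W] [Module k W] (g : V →ₗ[k] W) (hg : Function.Injective g)
    (f : U →ₗ[k] W) (h : ∀ u, f u ∈ LinearMap.range g) (u : U) :
    g (factorThrough g hg f h u) = f u := by
  have := LinearEquiv.apply_symm_apply (LinearEquiv.ofInjective g hg) (f.codRestrict _ h u)
  exact congrArg Subtype.val this

end Pairing

/-! ### Homogeneous elements of super vector spaces -/

section SuperTensor

variable {k : Type*} [Field k] {V : Type*} [AddCommGroup V] [Module k V]
  (gr : ZMod 2 → Submodule k V)

theorem koszulSign_zero_left (i : ZMod 2) : koszulSign k 0 i = 1 := by simp [koszulSign]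

theorem koszulSign_zero_right (i : ZMod 2) : koszulSign k i 0 = 1 := by simp [koszulSign]

theorem koszulSign_ne_zero (i j : ZMod 2) : koszulSign k i j ≠ 0 := by
  unfold koszulSign; split_ifs <;> simp

theorem super_induction (h : DirectSum.IsInternal gr) {P : V → Prop} (hom : ∀ i, ∀ x ∈ gr i, P x)
    (add : ∀ x y, P x → P y → P (x + y)) (x : V) : P x := by
  rw [← superProj_add gr h x]
  exact add _ _ (hom 0 _ (superProj_mem _ _ _ _)) (hom 1 _ (superProj_mem _ _ _ _))

theorem super_tensor_ext (h : DirectSum.IsInternal gr) {W : Type*} [AddCommGroup W] [Module k W] {p q : V ⊗[k] V →ₗ[k] W}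
    (H : ∀ i j, ∀ x ∈ gr i, ∀ y ∈ gr j, p (x ⊗ₜ y) = q (x ⊗ₜ y)) : p = q := by
  refine TensorProduct.ext' fun x y => ?_
  induction x using super_induction gr h with
  | add x x' hx hx' => simp only [TensorProduct.add_tmul, map_add, hx, hx']
  | hom i x hx =>
    induction y using super_induction gr h with
    | add y y' hy hy' => simp only [TensorProduct.tmul_add, map_add, hy, hy']
    | hom j y hy => exact H i j x hx y hy

theorem koszulTwist_tmul (h : DirectSum.IsInternal gr) {i j : ZMod 2} {x y : V} (hx : x ∈ gr i) (hy : y ∈ gr j) :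
    koszulTwist gr h (x ⊗ₜ y) = koszulSign k i j • (x ⊗ₜ[k] y) := by
  simp only [koszulTwist, LinearMap.smul_apply, TensorProduct.map_tmul,
    superProj_of_mem gr h hx, superProj_of_mem gr h hy, sum_zmod_two, LinearMap.add_apply]
  rcases zmod_two_cases i with rfl | rfl <;> rcases zmod_two_cases j with rfl | rfl <;> simp

theorem koszulTwist_koszulTwist (h : DirectSum.IsInternal gr) (t : V ⊗[k] V) : koszulTwist gr h (koszulTwist gr h t) = t := by
  have : koszulTwist gr h ∘ₗ koszulTwist gr h = LinearMap.id := by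
    refine super_tensor_ext gr h fun i j x hx y hy => ?_
    rw [LinearMap.comp_apply, koszulTwist_tmul gr h hx hy, map_smul, koszulTwist_tmul gr h hx hy,
      smul_smul, AffineSupergroup.koszulSign_mul_self, one_smul, LinearMap.id_apply]
  exact LinearMap.congr_fun this t

theorem superTensorMul_of_mem (h : DirectSum.IsInternal gr) (mul : V →ₗ[k] V →ₗ[k] V) {i j : ZMod 2} (a d : V) {b c : V}
    (hb : b ∈ gr i) (hc : c ∈ gr j) : superTensorMul gr h mul (a ⊗ₜ b) (c ⊗ₜ d) =
      koszulSign k i j • (mul a c ⊗ₜ[k] mul b d) := by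
  simp only [superTensorMul, LinearMap.smul_apply, LinearMap.compl₁₂_apply,
    LinearMap.lTensor_tmul, LinearMap.rTensor_tmul, TensorProduct.map₂_apply_tmul,
    superProj_of_mem gr h hb, superProj_of_mem gr h hc, sum_zmod_two, LinearMap.add_apply]
  rcases zmod_two_cases i with rfl | rfl <;> rcases zmod_two_cases j with rfl | rfl <;> simp

theorem tmul_mem_superTensorGr {i j l : ZMod 2} {x y : V} (hx : x ∈ gr i) (hy : y ∈ gr j)
    (hl : i + j = l) : x ⊗ₜ[k] y ∈ superTensorGr gr l := by
  have hj : l - i = j := by rw [← hl]; ring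
  refine Submodule.mem_iSup_of_mem i ⟨⟨x, hx⟩ ⊗ₜ ⟨y, hj ▸ hy⟩, ?_⟩
  simp

/-- Supplies homogeneous Sweedler expansions of coproducts, on which Koszul signs can be read off
term by term. -/
theorem exists_sum_of_mem_superTensorGr {l : ZMod 2} {t : V ⊗[k] V} (ht : t ∈ superTensorGr gr l) :
    ∃ (ι : Type) (_ : Fintype ι) (x y : ι → V) (p : ι → ZMod 2),
      (∀ i, x i ∈ gr (p i)) ∧ (∀ i, y i ∈ gr (l - p i)) ∧ t = ∑ i, x i ⊗ₜ[k] y i := by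
  have hadd : ∀ s t : V ⊗[k] V,
      (∃ (ι : Type) (_ : Fintype ι) (x y : ι → V) (p : ι → ZMod 2),
        (∀ i, x i ∈ gr (p i)) ∧ (∀ i, y i ∈ gr (l - p i)) ∧ s = ∑ i, x i ⊗ₜ[k] y i) →
      (∃ (ι : Type) (_ : Fintype ι) (x y : ι → V) (p : ι → ZMod 2),
        (∀ i, x i ∈ gr (p i)) ∧ (∀ i, y i ∈ gr (l - p i)) ∧ t = ∑ i, x i ⊗ₜ[k] y i) →
      (∃ (ι : Type) (_ : Fintype ι) (x y : ι → V) (p : ι → ZMod 2),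
        (∀ i, x i ∈ gr (p i)) ∧ (∀ i, y i ∈ gr (l - p i)) ∧ s + t = ∑ i, x i ⊗ₜ[k] y i) := by
    rintro _ _ ⟨ι, _, x, y, p, hx, hy, rfl⟩ ⟨κ, _, x', y', p', hx', hy', rfl⟩
    refine ⟨ι ⊕ κ, inferInstance, Sum.elim x x', Sum.elim y y', Sum.elim p p', ?_, ?_, ?_⟩
    · rintro (i | i) <;> simp [hx, hx']
    · rintro (i | i) <;> simp [hy, hy']
    · simp [Fintype.sum_sum_type]
  have hzero : ∃ (ι : Type) (_ : Fintype ι) (x y : ι → V) (p : ι → ZMod 2),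
      (∀ i, x i ∈ gr (p i)) ∧ (∀ i, y i ∈ gr (l - p i)) ∧
        (0 : V ⊗[k] V) = ∑ i, x i ⊗ₜ[k] y i :=
    ⟨Empty, inferInstance, Empty.elim, Empty.elim, Empty.elim, fun i => i.elim, fun i => i.elim,
      by simp⟩
  refine Submodule.iSup_induction _ (motive := fun t => ∃ (ι : Type) (_ : Fintype ι)
    (x y : ι → V) (p : ι → ZMod 2), (∀ i, x i ∈ gr (p i)) ∧ (∀ i, y i ∈ gr (l - p i)) ∧
      t = ∑ i, x i ⊗ₜ[k] y i) ht ?_ hzero hadd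
  rintro i _ ⟨t, rfl⟩
  induction t with
  | zero => simpa using hzero
  | add s t hs ht => rw [map_add]; exact hadd _ _ hs ht
  | tmul x y =>
    exact ⟨Unit, inferInstance, fun _ => x, fun _ => y, fun _ => i, fun _ => x.2, fun _ => y.2,
      by simp⟩

end SuperTensor

/-! ### Hopf structures dual to $\mathcal O(G)$ along an embedding. -/

namespace AffineSupergroup

variable {k A : Type*} [Field k] [Ring A] [Algebra k A] (G : AffineSupergroup k A)

theorem superDualDistrib_tmul (t : Module.Dual k A ⊗[k] Module.Dual k A) {i j : ZMod 2} {a b : A}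
    (ha : a ∈ G.gr i) (hb : b ∈ G.gr j) : superDualDistrib G.gr G.isInternal t (a ⊗ₜ b) =
      koszulSign k i j * TensorProduct.dualDistrib k A A t (a ⊗ₜ b) := by
  rw [superDualDistrib, LinearMap.comp_apply, LinearMap.dualMap_apply, koszulTwist_tmul _ _ ha hb,
    map_smul, smul_eq_mul]

/-- The Koszul twist is an involution, so the sign does not affect the injectivity of the pairing. A
coproduct is therefore determined by the functional that it induces on $A\otimes A$. -/
theorem superDualDistrib_map_injective {V : Type*} [AddCommGroup V] [Module k V]
    {j : V →ₗ[k] Module.Dual k A} (hj : Function.Injective j) : Function.Injective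
      (superDualDistrib G.gr G.isInternal ∘ₗ TensorProduct.map j j) := by
  intro s t hst
  refine dualPair_injective hj hj (LinearMap.ext fun w => ?_)
  have := LinearMap.congr_fun hst (koszulTwist G.gr G.isInternal w)
  simpa [superDualDistrib, koszulTwist_koszulTwist, dualPair] using this

theorem koszulTwist_map {T T' : A →ₗ[k] A} (hT : ∀ i, ∀ a ∈ G.gr i, T a ∈ G.gr i)
    (hT' : ∀ i, ∀ a ∈ G.gr i, T' a ∈ G.gr i) (w : A ⊗[k] A) :
    koszulTwist G.gr G.isInternal (TensorProduct.map T T' w) =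
      TensorProduct.map T T' (koszulTwist G.gr G.isInternal w) := by
  refine LinearMap.congr_fun (f := koszulTwist G.gr G.isInternal ∘ₗ TensorProduct.map T T')
    (g := TensorProduct.map T T' ∘ₗ koszulTwist G.gr G.isInternal)
    (super_tensor_ext G.gr G.isInternal fun i l a ha b hb => ?_) w
  rw [LinearMap.comp_apply, LinearMap.comp_apply, TensorProduct.map_tmul,
    koszulTwist_tmul _ _ (hT i a ha) (hT' l b hb), koszulTwist_tmul _ _ ha hb, map_smul,
    TensorProduct.map_tmul]

theorem superDualDistrib_map_dualMap {T T' : A →ₗ[k] A} (hT : ∀ i, ∀ a ∈ G.gr i, T a ∈ G.gr i)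
    (hT' : ∀ i, ∀ a ∈ G.gr i, T' a ∈ G.gr i) (t : Module.Dual k A ⊗[k] Module.Dual k A) :
    superDualDistrib G.gr G.isInternal (TensorProduct.map T.dualMap T'.dualMap t) =
      superDualDistrib G.gr G.isInternal t ∘ₗ TensorProduct.map T T' := by
  have key : ∀ w, TensorProduct.dualDistrib k A A (TensorProduct.map T.dualMap T'.dualMap t) w =
      TensorProduct.dualDistrib k A A t (TensorProduct.map T T' w) := by
    intro w
    induction t with
    | zero => simp
    | add s t hs ht => simp only [map_add, hs, ht, LinearMap.add_apply]
    | tmul u v =>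
      induction w with
      | zero => simp
      | add s t hs ht => simp only [map_add, hs, ht]
      | tmul a b => simp
  refine LinearMap.ext fun w => ?_
  simp only [superDualDistrib, LinearMap.comp_apply, LinearMap.dualMap_apply, key,
    G.koszulTwist_map hT hT']

/-- A Hopf superalgebra structure on `V` is dual to that of `𝒪(G)` along `j`. -/
structure IsDualHopf {V : Type*} [AddCommGroup V] [Module k V] (j : V →ₗ[k] Module.Dual k A)
    (D : HopfSuperalgebra k V) : Prop where
  gr_eq : ∀ i, D.gr i = (dualGr G.gr i).comap j
  mul_eq : ∀ φ ψ, j (D.mul φ ψ) = G.conv (j φ) (j ψ)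
  one_eq : j D.one = ev (1 : G.Points)
  comul_eq : ∀ φ, superDualDistrib G.gr G.isInternal (TensorProduct.map j j (D.comul φ)) =
      j φ ∘ₗ LinearMap.mul' k A
  counit_eq : ∀ φ, D.counit φ = j φ 1
  antipode_eq : ∀ φ, j (D.antipode φ) = j φ ∘ₗ G.antipode

-- Each operation is determined by its image in $\mathcal O(G)^*$, so a linear isomorphism
-- compatible with the embeddings respects all of them.
variable {G} in
theorem IsDualHopf.isIso {V W : Type*} [AddCommGroup V] [Module k V] [AddCommGroup W] [Module k W]
    {j : V →ₗ[k] Module.Dual k A} {l : W →ₗ[k] Module.Dual k A} {D : HopfSuperalgebra k V}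
    {E : HopfSuperalgebra k W} (hD : G.IsDualHopf j D) (hE : G.IsDualHopf l E)
    (hl : Function.Injective l) (e : V ≃ₗ[k] W) (he : ∀ v, l (e v) = j v) :
    HopfSuperalgebra.IsIso D E e where
  map_gr i := by
    ext w
    rw [hD.gr_eq, hE.gr_eq]
    simp only [Submodule.mem_map, Submodule.mem_comap]
    constructor
    · rintro ⟨v, hv, rfl⟩
      exact (he v).symm ▸ hv
    · intro hw
      refine ⟨e.symm w, ?_, e.apply_symm_apply w⟩
      rwa [← he, e.apply_symm_apply]
  map_mul a b := hl (by rw [he, hD.mul_eq, hE.mul_eq, he, he])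
  map_one := hl (by rw [he, hD.one_eq, hE.one_eq])
  map_comul a := G.superDualDistrib_map_injective hl (by
    have h1 : TensorProduct.map l l ∘ₗ TensorProduct.map e.toLinearMap e.toLinearMap =
        TensorProduct.map j j := by
      rw [← TensorProduct.map_comp]
      congr 1 <;> exact LinearMap.ext he
    have h2 := LinearMap.congr_fun h1 (D.comul a)
    rw [LinearMap.comp_apply] at h2
    rw [LinearMap.comp_apply, LinearMap.comp_apply, h2, hD.comul_eq, hE.comul_eq, he])
  map_counit a := by rw [hD.counit_eq, hE.counit_eq, he]
  map_antipode a := hl (by rw [he, hD.antipode_eq, hE.antipode_eq, he])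

end AffineSupergroup

/-! ### The Hopf superalgebra axioms, by transposition. -/

namespace AffineSupergroup

variable {k A : Type*} [Field k] [Ring A] [Algebra k A]

theorem sum_reverse {I L M N R : Type*} [Fintype I] [Fintype L] [Fintype M] [Fintype N]
    [AddCommMonoid R] (F : N → M → I → L → R) :
    ∑ n, ∑ m, ∑ i, ∑ l, F n m i l = ∑ l, ∑ i, ∑ m, ∑ n, F n m i l := by
  calc ∑ n, ∑ m, ∑ i, ∑ l, F n m i l = ∑ n, ∑ l, ∑ i, ∑ m, F n m i l := by
        refine Finset.sum_congr rfl fun n _ => ?_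
        rw [Finset.sum_comm, Finset.sum_comm (s := (Finset.univ : Finset L))]
        exact Finset.sum_congr rfl fun i _ => Finset.sum_comm
    _ = ∑ l, ∑ i, ∑ m, ∑ n, F n m i l := by
        rw [Finset.sum_comm]
        refine Finset.sum_congr rfl fun l _ => ?_
        rw [Finset.sum_comm]
        exact Finset.sum_congr rfl fun i _ => Finset.sum_comm

/-- The signs in $\Delta(uv)=\Delta(u)\Delta(v)$ for $\Delta(u)=x\otimes x'$ and $\Delta(v)=y\otimes
y'$, with $a,b,c,d$ the parities of $x,y,x',y'$. -/
theorem koszulSign_shuffle (k : Type*) [Field k] (a b c d : ZMod 2) :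
    koszulSign k (a + b) (c + d) * (koszulSign k (a + c) (b + d) *
      (koszulSign k b c * koszulSign k a c * koszulSign k b d)) =
    koszulSign k c b * koszulSign k a b * koszulSign k c d := by
  rcases zmod_two_cases a with rfl | rfl <;> rcases zmod_two_cases b with rfl | rfl <;>
  rcases zmod_two_cases c with rfl | rfl <;> rcases zmod_two_cases d with rfl | rfl <;>
  simp [koszulSign, show (1 : ZMod 2) + 1 = 0 from rfl]

/-- Linear maps on `V` that correspond, along an embedding in `𝒪(G)^*`, to the operations on
functionals which are dual to the structure maps of `𝒪(G)`. -/
structure DualHopfMaps (G : AffineSupergroup k A) (V : Type*) [AddCommGroup V] [Module k V] where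
  j : V →ₗ[k] Module.Dual k A
  injective : Function.Injective j
  proj : ZMod 2 → V →ₗ[k] V
  mul : V →ₗ[k] V →ₗ[k] V
  one : V
  comul : V →ₗ[k] V ⊗[k] V
  antipode : V →ₗ[k] V
  j_proj : ∀ i v, j (proj i v) = j v ∘ₗ superProj G.gr G.isInternal i
  j_mul : ∀ u v, j (mul u v) = G.conv (j u) (j v)
  j_one : j one = ev (1 : G.Points)
  j_comul : ∀ v, superDualDistrib G.gr G.isInternal (TensorProduct.map j j (comul v)) =
      j v ∘ₗ LinearMap.mul' k A
  j_antipode : ∀ v, j (antipode v) = j v ∘ₗ G.antipode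

namespace DualHopfMaps

variable {G : AffineSupergroup k A} {V : Type*} [AddCommGroup V] [Module k V]
  (D : DualHopfMaps G V)

/-- The parity of the elements of `V`. -/
def gr (i : ZMod 2) : Submodule k V := (dualGr G.gr i).comap D.j

theorem mem_gr {i : ZMod 2} {v : V} : v ∈ D.gr i ↔ D.j v ∈ dualGr G.gr i := Iff.rfl

theorem apply_eq_zero {i l : ZMod 2} {v : V} (hv : v ∈ D.gr i) {a : A} (ha : a ∈ G.gr l)
    (h : l ≠ i) : D.j v a = 0 := by
  rw [mem_gr, dualGr, Submodule.mem_dualAnnihilator] at hv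
  refine hv a ?_
  have : l = i + 1 := by clear ha hv; revert l i; decide
  exact this ▸ ha

theorem mem_gr_of_apply {i : ZMod 2} {v : V} (h : ∀ l, l ≠ i → ∀ a ∈ G.gr l, D.j v a = 0) :
    v ∈ D.gr i := by
  rw [mem_gr, dualGr, Submodule.mem_dualAnnihilator]
  exact h (i + 1) (by clear h; revert i; decide)

theorem proj_mem (i : ZMod 2) (v : V) : D.proj i v ∈ D.gr i := by
  rw [mem_gr, D.j_proj]
  exact comp_proj_mem _ _

theorem proj_add (v : V) : D.proj 0 v + D.proj 1 v = v :=
  D.injective (by rw [map_add, D.j_proj, D.j_proj, comp_proj_add])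

theorem isInternal : DirectSum.IsInternal D.gr := by
  refine isInternal_of_isCompl _ ⟨?_, ?_⟩
  · rw [Submodule.disjoint_def]
    intro v h0 h1
    refine D.injective (LinearMap.ext fun a => ?_)
    rw [map_zero, LinearMap.zero_apply]
    induction a using super_induction G.gr G.isInternal with
    | add a b ha hb => rw [map_add, ha, hb, add_zero]
    | hom i a ha =>
      by_cases hi : i = 0
      · exact D.apply_eq_zero h1 ha (by rw [hi]; exact zero_ne_one)
      · exact D.apply_eq_zero h0 ha hi
  · rw [codisjoint_iff, eq_top_iff]
    intro v _
    exact Submodule.mem_sup.2 ⟨_, D.proj_mem 0 v, _, D.proj_mem 1 v, D.proj_add v⟩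

/-- The pairing without sign, so that the sign stands explicitly in the formula; the coalgebra
axioms are checked through it. -/
theorem dualPair_comul (v : V) {i l : ZMod 2} {a b : A} (ha : a ∈ G.gr i) (hb : b ∈ G.gr l) :
    dualPair D.j D.j (D.comul v) (a ⊗ₜ b) = koszulSign k i l * D.j v (a * b) := by
  have h := LinearMap.congr_fun (D.j_comul v) (a ⊗ₜ b)
  rw [superDualDistrib_tmul G _ ha hb, LinearMap.comp_apply, LinearMap.mul'_apply] at h
  rw [← h, ← mul_assoc, koszulSign_mul_self, one_mul]
  rfl

theorem tensor_ext {s t : V ⊗[k] V} (h : ∀ i l, ∀ a ∈ G.gr i, ∀ b ∈ G.gr l,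
    dualPair D.j D.j s (a ⊗ₜ b) = dualPair D.j D.j t (a ⊗ₜ b)) : s = t :=
  dualPair_injective D.injective D.injective (super_tensor_ext G.gr G.isInternal h)

theorem mul_mem_gr {i l : ZMod 2} {a b : A} (ha : a ∈ G.gr i) (hb : b ∈ G.gr l) :
    a * b ∈ G.gr (i + l) := by
  rw [← G.mul_eq]
  exact G.mul_mem _ _ _ ha _ hb

theorem dualPair_lTensor_comul (t : V ⊗[k] V) (a : A) {i l : ZMod 2} {b c : A} (hb : b ∈ G.gr i)
    (hc : c ∈ G.gr l) : dualPair D.j (dualPair D.j D.j) (D.comul.lTensor V t) (a ⊗ₜ (b ⊗ₜ c)) =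
      koszulSign k i l * dualPair D.j D.j t (a ⊗ₜ (b * c)) := by
  induction t with
  | zero => simp
  | add s t hs ht => simp only [map_add, LinearMap.add_apply, hs, ht, mul_add]
  | tmul u v =>
    rw [LinearMap.lTensor_tmul, dualPair_tmul, dualPair_tmul, D.dualPair_comul v hb hc]
    ring

theorem dualPair_assoc_rTensor_comul (t : V ⊗[k] V) {i l : ZMod 2} {a b : A} (c : A)
    (ha : a ∈ G.gr i) (hb : b ∈ G.gr l) : dualPair D.j (dualPair D.j D.j)
      (TensorProduct.assoc k V V V (D.comul.rTensor V t)) (a ⊗ₜ (b ⊗ₜ c)) =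
      koszulSign k i l * dualPair D.j D.j t ((a * b) ⊗ₜ c) := by
  have key : ∀ (w : V ⊗[k] V) (v : V), dualPair D.j (dualPair D.j D.j)
      (TensorProduct.assoc k V V V (w ⊗ₜ v)) (a ⊗ₜ (b ⊗ₜ c)) =
      dualPair D.j D.j w (a ⊗ₜ b) * D.j v c := by
    intro w v
    induction w with
    | zero => simp
    | add s t hs ht =>
      simp only [TensorProduct.add_tmul, map_add, LinearMap.add_apply, hs, ht, add_mul]
    | tmul x y => simp only [TensorProduct.assoc_tmul, dualPair_tmul, mul_assoc]
  induction t with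
  | zero => simp
  | add s t hs ht => simp only [map_add, LinearMap.add_apply, hs, ht, mul_add]
  | tmul u v =>
    rw [LinearMap.rTensor_tmul, key, dualPair_tmul, D.dualPair_comul u ha hb]
    ring

/-- Paired with $a\otimes b\otimes c$, both sides give $j(v)(abc)$ up to a sign, and the two signs
agree because $(-1)^{ij}$ is a 2-cocycle. -/
theorem coassoc : TensorProduct.assoc k V V V ∘ₗ D.comul.rTensor V ∘ₗ D.comul =
    D.comul.lTensor V ∘ₗ D.comul := by
  ext v
  refine dualPair_injective D.injective (dualPair_injective D.injective D.injective)
    (TensorProduct.ext' fun a w => ?_)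
  simp only [LinearMap.comp_apply, LinearEquiv.coe_coe]
  induction a using super_induction G.gr G.isInternal with
  | add a a' ha ha' => simp only [TensorProduct.add_tmul, map_add, ha, ha']
  | hom i a ha =>
    induction w with
    | zero => simp
    | add s t hs ht => simp only [TensorProduct.tmul_add, map_add, hs, ht]
    | tmul b c =>
      induction b using super_induction G.gr G.isInternal with
      | add a a' ha ha' =>
        simp only [TensorProduct.add_tmul, TensorProduct.tmul_add, map_add, ha, ha']
      | hom l b hb =>
        induction c using super_induction G.gr G.isInternal with
        | add a a' ha ha' => simp only [TensorProduct.tmul_add, map_add, ha, ha']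
        | hom m c hc =>
          rw [D.dualPair_lTensor_comul _ _ hb hc, D.dualPair_assoc_rTensor_comul _ _ ha hb,
            D.dualPair_comul v ha (mul_mem_gr hb hc), D.dualPair_comul v (mul_mem_gr ha hb) hc,
            ← mul_assoc, ← mul_assoc, mul_assoc a b c, mul_comm (koszulSign k i l),
            koszulSign_cocycle, mul_comm (koszulSign k l m)]

/-- The counit is the evaluation at `1`. -/
def counit : V →ₗ[k] k := Module.Dual.eval k A 1 ∘ₗ D.j

theorem counit_apply (v : V) : D.counit v = D.j v 1 := rfl

variable (G) in
theorem one_mem_gr : (1 : A) ∈ G.gr 0 := G.one_eq ▸ G.one_mem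

theorem rTensor_counit (v : V) : D.counit.rTensor V (D.comul v) = 1 ⊗ₜ[k] v := by
  have key : ∀ t : V ⊗[k] V, ∀ a,
      D.j (TensorProduct.lid k V (D.counit.rTensor V t)) a = dualPair D.j D.j t (1 ⊗ₜ a) := by
    intro t a
    induction t with
    | zero => simp
    | add s t hs ht => simp only [map_add, LinearMap.add_apply, hs, ht]
    | tmul u v => simp [dualPair_tmul, counit_apply]
  apply (TensorProduct.lid k V).injective
  refine D.injective (LinearMap.ext fun a => ?_)
  rw [key]
  induction a using super_induction G.gr G.isInternal with
  | add a a' ha ha' => simp only [TensorProduct.tmul_add, map_add, ha, ha']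
  | hom i a ha => rw [D.dualPair_comul v (one_mem_gr G) ha]; simp [koszulSign_zero_left]

theorem lTensor_counit (v : V) : D.counit.lTensor V (D.comul v) = v ⊗ₜ[k] 1 := by
  have key : ∀ t : V ⊗[k] V, ∀ a,
      D.j (TensorProduct.rid k V (D.counit.lTensor V t)) a = dualPair D.j D.j t (a ⊗ₜ 1) := by
    intro t a
    induction t with
    | zero => simp
    | add s t hs ht => simp only [map_add, LinearMap.add_apply, hs, ht]
    | tmul u v => simp [dualPair_tmul, counit_apply, mul_comm]
  apply (TensorProduct.rid k V).injective
  refine D.injective (LinearMap.ext fun a => ?_)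
  rw [key]
  induction a using super_induction G.gr G.isInternal with
  | add a a' ha ha' => simp only [TensorProduct.add_tmul, map_add, ha, ha']
  | hom i a ha => rw [D.dualPair_comul v ha (one_mem_gr G)]; simp [koszulSign_zero_right]

/-- The projections of $V$ are transposes of those of $A$, and the pairing of $\Delta(v)$ with
$a\otimes b$ is $\pm j(v)(ab)$, which vanishes unless $|a|+|b|=i$. So $\Delta(v)$ is the sum of its
components of total parity $i$. -/
theorem comul_mem (i : ZMod 2) (v : V) (hv : v ∈ D.gr i) : D.comul v ∈ superTensorGr D.gr i := by
  have h1 : ∀ (t : V ⊗[k] V) l m, ∀ a ∈ G.gr l, ∀ b ∈ G.gr m, ∀ p q,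
      dualPair D.j D.j (TensorProduct.map (D.proj p) (D.proj q) t) (a ⊗ₜ b) =
      if l = p ∧ m = q then dualPair D.j D.j t (a ⊗ₜ b) else 0 := by
    intro t l m a ha b hb p q
    induction t with
    | zero => simp
    | add s t hs ht => simp only [map_add, LinearMap.add_apply, hs, ht]; split_ifs <;> simp
    | tmul u v =>
      rw [TensorProduct.map_tmul, dualPair_tmul, dualPair_tmul, D.j_proj, D.j_proj,
        LinearMap.comp_apply, LinearMap.comp_apply, superProj_of_mem _ _ ha,
        superProj_of_mem _ _ hb]
      by_cases h1 : p = l <;> by_cases h2 : q = m <;> simp [h1, h2, Ne.symm]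
  have h2 : D.comul v = ∑ p : ZMod 2, TensorProduct.map (D.proj p) (D.proj (i - p))
      (D.comul v) := by
    refine D.tensor_ext fun l m a ha b hb => ?_
    rw [map_sum, LinearMap.sum_apply]
    simp only [h1 _ l m a ha b hb]
    by_cases hlm : m = i - l
    · rw [Finset.sum_eq_single l]
      · rw [if_pos ⟨rfl, hlm⟩]
      · intro p _ hp
        rw [if_neg (fun h => hp h.1.symm)]
      · simp
    · rw [Finset.sum_eq_zero, D.dualPair_comul v ha hb, D.apply_eq_zero hv (mul_mem_gr ha hb),
        mul_zero]
      · intro h; exact hlm (by rw [← h]; ring)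
      · rintro p -
        refine if_neg ?_
        rintro ⟨rfl, h'⟩
        exact hlm h'
  rw [h2]
  refine Submodule.sum_mem _ fun p _ => ?_
  generalize D.comul v = t
  induction t with
  | zero => simp
  | add s t hs ht => rw [map_add]; exact add_mem hs ht
  | tmul x y => exact tmul_mem_superTensorGr _ (D.proj_mem _ _) (D.proj_mem _ _) (by ring)

theorem j_mul_of_mem {i l : ZMod 2} {u v : V} (hu : u ∈ D.gr i) (hv : v ∈ D.gr l) :
    D.j (D.mul u v) = koszulSign k i l • G.uconv (D.j u) (D.j v) := by
  rw [D.j_mul, conv_homogeneous hu hv]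

theorem mul_mem (i l : ZMod 2) (u : V) (hu : u ∈ D.gr i) (v : V) (hv : v ∈ D.gr l) :
    D.mul u v ∈ D.gr (i + l) := by
  rw [mem_gr, D.j_mul]
  exact conv_mem hu hv

theorem one_mem : D.one ∈ D.gr 0 := by
  rw [mem_gr, D.j_one]
  exact Points.ev_mem _

theorem comul_one : D.comul D.one = D.one ⊗ₜ[k] D.one := by
  refine D.tensor_ext fun i l a ha b hb => ?_
  rw [D.dualPair_comul _ ha hb, dualPair_tmul, D.j_one]
  have h1 : ∀ a ∈ G.gr 1, ev (1 : G.Points) a = 0 := (1 : G.Points).2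
  have h2 : ev (1 : G.Points) (a * b) = ev (1 : G.Points) a * ev (1 : G.Points) b :=
    map_mul (1 : G.Points).1 a b
  rw [h2]
  unfold koszulSign
  split_ifs with h
  · obtain ⟨rfl, rfl⟩ := h
    simp [h1 a ha]
  · ring

/-- With homogeneous expansions of $\Delta(u)$, $\Delta(v)$, $\mu^*(a)$ and $\mu^*(b)$, both sides
evaluated at $a\otimes b$ are fourfold sums of the same products and differ only in signs. The
multiplicativity of $\mu^*$ enters through `hcab`. -/
theorem comul_mul_of_mem {i l : ZMod 2} {u v : V} (hu : u ∈ D.gr i) (hv : v ∈ D.gr l) :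
    D.comul (D.mul u v) =
      superTensorMul D.gr D.isInternal D.mul (D.comul u) (D.comul v) := by
  obtain ⟨I, _, x, x', p, hx, hx', hI⟩ := exists_sum_of_mem_superTensorGr _ (D.comul_mem i u hu)
  obtain ⟨L, _, y, y', q, hy, hy', hL⟩ := exists_sum_of_mem_superTensorGr _ (D.comul_mem l v hv)
  refine D.tensor_ext fun m n a ha b hb => ?_
  obtain ⟨M, _, c, c', r, hc, hc', hM⟩ :=
    exists_sum_of_mem_superTensorGr _ (G.comul_mem m a ha)
  obtain ⟨N, _, d, d', s, hd, hd', hN⟩ :=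
    exists_sum_of_mem_superTensorGr _ (G.comul_mem n b hb)
  have hab := G.comul_mul a b
  rw [hM, hN, G.mul_eq] at hab
  have huu : ∀ e f, ∀ e' f' : A, e' ∈ G.gr e → f' ∈ G.gr f →
      D.j u (e' * f') = koszulSign k e f * ∑ i, D.j (x i) e' * D.j (x' i) f' := by
    intro e f e' f' he hf
    have := D.dualPair_comul u he hf
    rw [hI, map_sum, LinearMap.sum_apply] at this
    simp only [dualPair_tmul] at this
    rw [this, ← mul_assoc, koszulSign_mul_self, one_mul]
  have hvv : ∀ e f, ∀ e' f' : A, e' ∈ G.gr e → f' ∈ G.gr f →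
      D.j v (e' * f') = koszulSign k e f * ∑ i, D.j (y i) e' * D.j (y' i) f' := by
    intro e f e' f' he hf
    have := D.dualPair_comul v he hf
    rw [hL, map_sum, LinearMap.sum_apply] at this
    simp only [dualPair_tmul] at this
    rw [this, ← mul_assoc, koszulSign_mul_self, one_mul]
  have hca : ∀ φ ψ : Module.Dual k A, G.uconv φ ψ a = ∑ μ, φ (c μ) * ψ (c' μ) := by
    intro φ ψ
    simp [uconv, hM]
  have hcb : ∀ φ ψ : Module.Dual k A, G.uconv φ ψ b = ∑ ν, φ (d ν) * ψ (d' ν) := by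
    intro φ ψ
    simp [uconv, hN]
  have hcab : G.uconv (D.j u) (D.j v) (a * b) = ∑ μ, ∑ ν, koszulSign k (m - r μ) (s ν) *
      (D.j u (c μ * d ν) * D.j v (c' μ * d' ν)) := by
    simp only [uconv, LinearMap.comp_apply, hab, map_sum, LinearMap.sum_apply]
    rw [Finset.sum_comm]
    refine Finset.sum_congr rfl fun μ _ => Finset.sum_congr rfl fun ν _ => ?_
    rw [superTensorMul_of_mem _ _ _ _ _ (hc' _) (hd _)]
    simp [G.mul_eq]
  rw [D.dualPair_comul _ ha hb, D.j_mul_of_mem hu hv, LinearMap.smul_apply, hcab, hI, hL]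
  simp only [map_sum, LinearMap.sum_apply]
  rw [Finset.sum_comm]
  have hrhs : ∀ α β, dualPair D.j D.j (superTensorMul D.gr D.isInternal D.mul
      (x α ⊗ₜ[k] x' α) (y β ⊗ₜ[k] y' β)) (a ⊗ₜ[k] b) = ∑ μ, ∑ ν,
      koszulSign k (i - p α) (q β) * koszulSign k (p α) (q β) * koszulSign k (i - p α) (l - q β) *
      (D.j (x α) (c μ) * D.j (y β) (c' μ) * (D.j (x' α) (d ν) * D.j (y' β) (d' ν))) := by
    intro α β
    rw [superTensorMul_of_mem _ _ _ _ _ (hx' _) (hy _), map_smul, LinearMap.smul_apply,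
      dualPair_tmul, D.j_mul_of_mem (hx _) (hy _), D.j_mul_of_mem (hx' _) (hy' _)]
    simp only [LinearMap.smul_apply, hca, hcb, smul_eq_mul]
    rw [mul_mul_mul_comm, Finset.sum_mul_sum, ← mul_assoc, ← mul_assoc]
    simp only [Finset.mul_sum]
  simp only [hrhs]
  have hlhs : ∀ μ ν, koszulSign k (m - r μ) (s ν) * (D.j u (c μ * d ν) * D.j v (c' μ * d' ν)) =
      ∑ α, ∑ β, koszulSign k (m - r μ) (s ν) * koszulSign k (r μ) (s ν) *
        koszulSign k (m - r μ) (n - s ν) *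
      (D.j (x α) (c μ) * D.j (y β) (c' μ) * (D.j (x' α) (d ν) * D.j (y' β) (d' ν))) := by
    intro μ ν
    rw [huu _ _ _ _ (hc _) (hd _), hvv _ _ _ _ (hc' _) (hd' _), mul_mul_mul_comm,
      Finset.sum_mul_sum, ← mul_assoc, ← mul_assoc]
    simp only [Finset.mul_sum]
    refine Finset.sum_congr rfl fun α _ => Finset.sum_congr rfl fun β _ => ?_
    ring
  simp only [hlhs, smul_eq_mul, Finset.mul_sum]
  rw [sum_reverse]
  refine Finset.sum_congr rfl fun β _ => Finset.sum_congr rfl fun α _ =>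
    Finset.sum_congr rfl fun μ _ => Finset.sum_congr rfl fun ν _ => ?_
  -- A homogeneous functional kills the functions of the other parity, so a term survives only if
  -- the parities of functions and functionals match. Every sign is then a function of four
  -- parities, and `koszulSign_shuffle` applies.
  by_cases e1 : r μ = p α
  swap
  · rw [D.apply_eq_zero (hx α) (hc μ) e1]; ring
  by_cases e2 : m - r μ = q β
  swap
  · have := D.apply_eq_zero (hy β) (hc' μ) e2
    rw [this]; ring
  by_cases e3 : s ν = i - p α
  swap
  · have := D.apply_eq_zero (hx' α) (hd ν) e3
    rw [this]; ring
  by_cases e4 : n - s ν = l - q β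
  swap
  · have := D.apply_eq_zero (hy' β) (hd' ν) e4
    rw [this]; ring
  have hsign := koszulSign_shuffle k (p α) (q β) (i - p α) (l - q β)
  rw [e2, e4, e3, e1, show m = p α + q β by rw [← e2, e1]; ring,
    show n = i - p α + (l - q β) by rw [← e4, e3]; ring]
  rw [show p α + (i - p α) = i by ring, show q β + (l - q β) = l by ring] at hsign
  linear_combination (D.j (x α) (c μ) * D.j (y β) (c' μ) *
    (D.j (x' α) (d ν) * D.j (y' β) (d' ν))) * hsign

theorem comul_mul (u v : V) : D.comul (D.mul u v) =
    superTensorMul D.gr D.isInternal D.mul (D.comul u) (D.comul v) := by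
  induction u using super_induction D.gr D.isInternal with
  | add u u' hu hu' => simp only [map_add, LinearMap.add_apply, hu, hu']
  | hom i u hu =>
    induction v using super_induction D.gr D.isInternal with
    | add u u' hu hu' => simp only [map_add, hu, hu']
    | hom l v hv => exact D.comul_mul_of_mem hu hv

/-- The product is dual to $\mu^*$ at the level of tensors; it turns the antipode axioms for $V$
into those for $\mathcal O(G)$. -/
theorem j_lift_mul (t : V ⊗[k] V) : D.j (TensorProduct.lift D.mul t) =
    superDualDistrib G.gr G.isInternal (TensorProduct.map D.j D.j t) ∘ₗ G.comul := by
  induction t with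
  | zero => simp
  | add s t hs ht => simp only [map_add, hs, ht, LinearMap.add_comp]
  | tmul u v => rw [TensorProduct.lift.tmul, D.j_mul]; rfl

theorem superDualDistrib_rTensor_antipode (t : V ⊗[k] V) :
    superDualDistrib G.gr G.isInternal (TensorProduct.map D.j D.j (D.antipode.rTensor V t)) =
      superDualDistrib G.gr G.isInternal (TensorProduct.map D.j D.j t) ∘ₗ
        G.antipode.rTensor A := by
  have h : TensorProduct.map D.j D.j (D.antipode.rTensor V t) = TensorProduct.map
      (G.antipode).dualMap (LinearMap.id (R := k) (M := A)).dualMap (TensorProduct.map D.j D.j t) := by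
    induction t with
    | zero => simp
    | add s t hs ht => simp only [map_add, hs, ht]
    | tmul u v =>
      simp only [LinearMap.rTensor_tmul, TensorProduct.map_tmul, D.j_antipode]
      rfl
  rw [h, G.superDualDistrib_map_dualMap G.antipode_mem (fun _ _ h => h)]
  rfl

theorem superDualDistrib_lTensor_antipode (t : V ⊗[k] V) :
    superDualDistrib G.gr G.isInternal (TensorProduct.map D.j D.j (D.antipode.lTensor V t)) =
      superDualDistrib G.gr G.isInternal (TensorProduct.map D.j D.j t) ∘ₗ
        G.antipode.lTensor A := by
  have h : TensorProduct.map D.j D.j (D.antipode.lTensor V t) = TensorProduct.map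
      (LinearMap.id (R := k) (M := A)).dualMap (G.antipode).dualMap (TensorProduct.map D.j D.j t) := by
    induction t with
    | zero => simp
    | add s t hs ht => simp only [map_add, hs, ht]
    | tmul u v =>
      simp only [LinearMap.lTensor_tmul, TensorProduct.map_tmul, D.j_antipode]
      rfl
  rw [h, G.superDualDistrib_map_dualMap (fun _ _ h => h) G.antipode_mem]
  rfl

theorem antipode_left (v : V) :
    TensorProduct.lift D.mul (D.antipode.rTensor V (D.comul v)) = D.counit v • D.one := by
  refine D.injective (LinearMap.ext fun a => ?_)
  rw [j_lift_mul, superDualDistrib_rTensor_antipode, D.j_comul, map_smul, D.j_one]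
  have h := G.antipode_left a
  rw [lift_mul_eq, G.one_eq] at h
  simp only [LinearMap.comp_apply, LinearMap.smul_apply, h, map_smul, smul_eq_mul,
    counit_apply]
  exact mul_comm _ _

theorem antipode_right (v : V) :
    TensorProduct.lift D.mul (D.antipode.lTensor V (D.comul v)) = D.counit v • D.one := by
  refine D.injective (LinearMap.ext fun a => ?_)
  rw [j_lift_mul, superDualDistrib_lTensor_antipode, D.j_comul, map_smul, D.j_one]
  have h := G.antipode_right a
  rw [lift_mul_eq, G.one_eq] at h
  simp only [LinearMap.comp_apply, LinearMap.smul_apply, h, map_smul, smul_eq_mul,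
    counit_apply]
  exact mul_comm _ _

theorem antipode_mem (i : ZMod 2) (v : V) (hv : v ∈ D.gr i) : D.antipode v ∈ D.gr i := by
  refine D.mem_gr_of_apply fun l hl a ha => ?_
  rw [D.j_antipode, LinearMap.comp_apply]
  exact D.apply_eq_zero hv (G.antipode_mem l a ha) hl

theorem counit_mul (u v : V) : D.counit (D.mul u v) = D.counit u * D.counit v := by
  have h := G.comul_one
  rw [G.one_eq] at h
  rw [counit_apply, D.j_mul]
  change superDualDistrib G.gr G.isInternal (D.j u ⊗ₜ D.j v) (G.comul 1) = _
  rw [h, superDualDistrib_tmul G _ (one_mem_gr G) (one_mem_gr G), koszulSign_zero_left, one_mul,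
    TensorProduct.dualDistrib_apply]
  rfl

/-- The Hopf superalgebra structure on a space embedded in `𝒪(G)^*`. -/
def toHopf : HopfSuperalgebra k V where
  comul := D.comul
  counit := D.counit
  coassoc := D.coassoc
  rTensor_counit_comp_comul := LinearMap.ext D.rTensor_counit
  lTensor_counit_comp_comul := LinearMap.ext D.lTensor_counit
  gr := D.gr
  isInternal := D.isInternal
  mul := D.mul
  one := D.one
  mul_assoc a b c := D.injective (by simp only [D.j_mul, conv_assoc])
  one_mul a := D.injective (by rw [D.j_mul, D.j_one, ev_one_conv])
  mul_one a := D.injective (by rw [D.j_mul, D.j_one, conv_ev_one])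
  one_mem := D.one_mem
  mul_mem := D.mul_mem
  counit_odd a ha := D.apply_eq_zero ha (one_mem_gr G) zero_ne_one
  comul_mem := D.comul_mem
  counit_one := by
    rw [counit_apply, D.j_one]
    exact map_one (1 : G.Points).1
  counit_mul := D.counit_mul
  comul_one := D.comul_one
  comul_mul := D.comul_mul
  antipode := D.antipode
  antipode_mem := D.antipode_mem
  antipode_left := D.antipode_left
  antipode_right := D.antipode_right

theorem isDualHopf_toHopf : G.IsDualHopf D.j D.toHopf where
  gr_eq _ := rfl
  mul_eq := D.j_mul
  one_eq := D.j_one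
  comul_eq := D.j_comul
  counit_eq _ := rfl
  antipode_eq := D.j_antipode

end DualHopfMaps

/-! ### Spaces of functionals closed under the dual operations. -/

/-- A space of functionals closed under the operations dual to those of `𝒪(G)`. -/
structure IsHopfSubspace (G : AffineSupergroup k A) (R : Submodule k (Module.Dual k A)) :
    Prop where
  conv_mem : ∀ φ ∈ R, ∀ ψ ∈ R, G.conv φ ψ ∈ R
  ev_one_mem : ev (1 : G.Points) ∈ R
  proj_mem : ∀ i, ∀ φ ∈ R, φ ∘ₗ superProj G.gr G.isInternal i ∈ R
  antipode_mem : ∀ φ ∈ R, φ ∘ₗ G.antipode ∈ R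
  comul_mem : ∀ φ ∈ R, ∃ t : R ⊗[k] R, superDualDistrib G.gr G.isInternal
    (TensorProduct.map R.subtype R.subtype t) = φ ∘ₗ LinearMap.mul' k A

/-- Closure means that each operation on functionals factors through the injective map `j`. Allowing
an abstract `V` in place of `R` matters: $D(G)$ and $k|G|\otimes\mathcal U(\mathfrak g)$ are two
such `V` for one `R`. -/
theorem IsHopfSubspace.exists_isDualHopf {G : AffineSupergroup k A}
    {R : Submodule k (Module.Dual k A)} (hR : G.IsHopfSubspace R) {V : Type*} [AddCommGroup V]
    [Module k V] {j : V →ₗ[k] Module.Dual k A} (hj : Function.Injective j)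
    (hjR : LinearMap.range j = R) : ∃ D : HopfSuperalgebra k V, G.IsDualHopf j D := by
  subst hjR
  let mulMap : V ⊗[k] V →ₗ[k] V := factorThrough j hj (TensorProduct.lift (G.conv.compl₁₂ j j))
    (fun t => by
      induction t with
      | zero => simp
      | add s t hs ht => rw [map_add]; exact add_mem hs ht
      | tmul u v => exact hR.conv_mem _ ⟨u, rfl⟩ _ ⟨v, rfl⟩)
  let projMap : ZMod 2 → V →ₗ[k] V := fun i => factorThrough j hj
    ((superProj G.gr G.isInternal i).dualMap ∘ₗ j) (fun v => hR.proj_mem i _ ⟨v, rfl⟩)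
  let antipodeMap : V →ₗ[k] V := factorThrough j hj (G.antipode.dualMap ∘ₗ j)
    (fun v => hR.antipode_mem _ ⟨v, rfl⟩)
  let comulMap : V →ₗ[k] V ⊗[k] V := factorThrough
    (superDualDistrib G.gr G.isInternal ∘ₗ TensorProduct.map j j)
    (G.superDualDistrib_map_injective hj) ((LinearMap.mul' k A).dualMap ∘ₗ j) (fun v => by
      -- The coproduct is given in `R ⊗ R`; the inverse of `j` on its range moves it to `V ⊗ V`.
      obtain ⟨t, ht⟩ := hR.comul_mem _ ⟨v, rfl⟩
      refine ⟨TensorProduct.map (LinearEquiv.ofInjective j hj).symm.toLinearMap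
        (LinearEquiv.ofInjective j hj).symm.toLinearMap t, ?_⟩
      have h1 : TensorProduct.map j j ∘ₗ TensorProduct.map
          (LinearEquiv.ofInjective j hj).symm.toLinearMap
          (LinearEquiv.ofInjective j hj).symm.toLinearMap =
          TensorProduct.map (LinearMap.range j).subtype (LinearMap.range j).subtype := by
        rw [← TensorProduct.map_comp]
        congr 1 <;>
          exact LinearMap.ext fun w => congrArg Subtype.val
            (LinearEquiv.apply_symm_apply (LinearEquiv.ofInjective j hj) w)
      rw [LinearMap.comp_apply]
      refine Eq.trans ?_ ht
      exact congrArg _ (LinearMap.congr_fun h1 t))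
  obtain ⟨one, hone⟩ := hR.ev_one_mem
  let D : DualHopfMaps G V :=
    { j := j
      injective := hj
      proj := projMap
      mul := TensorProduct.curry mulMap
      one := one
      comul := comulMap
      antipode := antipodeMap
      j_proj := fun i v => factorThrough_apply j hj _ _ v
      j_mul := fun u v => factorThrough_apply j hj _ _ (u ⊗ₜ v)
      j_one := hone
      j_comul := fun v => factorThrough_apply _ (G.superDualDistrib_map_injective hj) _ _ v
      j_antipode := fun v => factorThrough_apply j hj _ _ v }
  exact ⟨D.toHopf, D.isDualHopf_toHopf⟩

end AffineSupergroup

namespace AffineSupergroup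

variable {k A : Type*} [Field k] [Ring A] [Algebra k A] {G : AffineSupergroup k A}

/-! ### Powers of the maximal ideal of a point -/

theorem ev_apply_mul (x : G.Points) (a b : A) : ev x (a * b) = ev x a * ev x b := map_mul x.1 a b

theorem ev_apply_one (x : G.Points) : ev x 1 = 1 := map_one x.1

theorem ev_apply_proj (x : G.Points) (i : ZMod 2) (a : A) :
    ev x (superProj G.gr G.isInternal i a) = if i = 0 then ev x a else 0 := by
  rcases zmod_two_cases i with rfl | rfl
  · exact x.proj_zero a
  · exact x.proj_one a

theorem mem_maxIdeal {x : G.Points} {a : A} : a ∈ maxIdeal x ↔ ev x a = 0 := Iff.rfl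

theorem sub_smul_mem_maxIdeal (x : G.Points) (a : A) : a - ev x a • 1 ∈ maxIdeal x := by
  rw [mem_maxIdeal, map_sub, map_smul, ev_apply_one, smul_eq_mul, mul_one, sub_self]

/-- The powers of the maximal ideal of a point as ideals: the power with exponent `0` is the whole
algebra. -/
def idealPow (x : G.Points) : ℕ → Submodule k A
  | 0 => ⊤
  | n + 1 => maxIdeal x * idealPow x n

theorem idealPow_zero (x : G.Points) : idealPow x 0 = ⊤ := rfl

theorem idealPow_succ (x : G.Points) (n : ℕ) :
    idealPow x (n + 1) = maxIdeal x * idealPow x n := rfl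

theorem top_mul_maxIdeal (x : G.Points) : ⊤ * maxIdeal x ≤ maxIdeal x :=
  Submodule.mul_le.2 fun a _ b hb => by
    rw [mem_maxIdeal, ev_apply_mul, mem_maxIdeal.1 hb, mul_zero]

theorem maxIdeal_mul_top (x : G.Points) : maxIdeal x * ⊤ = maxIdeal x := by
  refine le_antisymm (Submodule.mul_le.2 fun a ha b _ => ?_) fun a ha => ?_
  · rw [mem_maxIdeal, ev_apply_mul, mem_maxIdeal.1 ha, zero_mul]
  · simpa using Submodule.mul_mem_mul ha (Submodule.mem_top (x := (1 : A)))

theorem idealPow_one (x : G.Points) : idealPow x 1 = maxIdeal x := maxIdeal_mul_top x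

theorem idealPow_succ_eq_pow (x : G.Points) (n : ℕ) : idealPow x (n + 1) = maxIdeal x ^ (n + 1) := by
  induction n with
  | zero => rw [zero_add, pow_one, idealPow_one]
  | succ n ih => rw [idealPow_succ, ih, pow_succ' _ (n + 1)]

theorem idealPow_mul_idealPow (x : G.Points) (n l : ℕ) :
    idealPow x n * idealPow x l ≤ idealPow x (n + l) := by
  induction n with
  | zero =>
    rw [zero_add, idealPow_zero]
    cases l with
    | zero => exact le_top
    | succ l =>
      rw [idealPow_succ, ← mul_assoc]
      exact mul_le_mul' (top_mul_maxIdeal x) le_rfl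
  | succ n ih =>
    rw [add_right_comm, idealPow_succ, idealPow_succ, mul_assoc]
    exact mul_le_mul' le_rfl ih

theorem mul_mem_idealPow {x : G.Points} {n l m : ℕ} {a b : A} (ha : a ∈ idealPow x n)
    (hb : b ∈ idealPow x l) (h : n + l = m) : a * b ∈ idealPow x m :=
  h ▸ idealPow_mul_idealPow x n l (Submodule.mul_mem_mul ha hb)

theorem mul_mem_idealPow_left {x : G.Points} {n : ℕ} (a : A) {b : A}
    (hb : b ∈ idealPow x n) : a * b ∈ idealPow x n :=
  mul_mem_idealPow (n := 0) Submodule.mem_top hb (zero_add n)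

theorem mul_mem_idealPow_right {x : G.Points} {n : ℕ} {a : A} (b : A)
    (ha : a ∈ idealPow x n) : a * b ∈ idealPow x n :=
  mul_mem_idealPow (l := 0) ha Submodule.mem_top (add_zero n)

theorem idealPow_antitone (x : G.Points) : Antitone (idealPow x) :=
  antitone_nat_of_succ_le fun n => by
    rw [idealPow_succ]
    exact Submodule.mul_le.2 fun a _ b hb => mul_mem_idealPow_left a hb

theorem idealPow_map_le {x y : G.Points} {T : A →ₗ[k] A} (hT : ∀ a b, T (a * b) = T a * T b)
    (h : ∀ a ∈ maxIdeal x, T a ∈ maxIdeal y) (n : ℕ) : ∀ a ∈ idealPow x n, T a ∈ idealPow y n := by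
  induction n with
  | zero => exact fun _ _ => Submodule.mem_top
  | succ n ih =>
    intro a ha
    rw [idealPow_succ] at ha ⊢
    induction ha using Submodule.mul_induction_on' with
    | mem_mul_mem a ha b hb => rw [hT]; exact Submodule.mul_mem_mul (h a ha) (ih b hb)
    | add a _ b _ ha hb => rw [map_add]; exact add_mem ha hb

/-- The ideal $m_x$ is homogeneous because $\mathrm{ev}_x$ kills odd functions, and `proj_mul`
passes homogeneity on to products. -/
theorem proj_mem_idealPow {x : G.Points} (i : ZMod 2) {n : ℕ} {a : A} (ha : a ∈ idealPow x n) :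
    superProj G.gr G.isInternal i a ∈ idealPow x n := by
  have h1 : ∀ i, ∀ a ∈ maxIdeal x, superProj G.gr G.isInternal i a ∈ maxIdeal x := by
    intro i a ha
    rw [mem_maxIdeal] at *
    rw [ev_apply_proj, ha, ite_self]
  induction n generalizing i a with
  | zero => exact Submodule.mem_top
  | succ n ih =>
    rw [idealPow_succ] at ha ⊢
    induction ha using Submodule.mul_induction_on' with
    | mem_mul_mem a ha b hb =>
      rw [proj_mul]
      exact add_mem (Submodule.mul_mem_mul (h1 _ a ha) (ih _ hb))
        (Submodule.mul_mem_mul (h1 _ a ha) (ih _ hb))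
    | add a _ b _ ha hb => rw [map_add]; exact add_mem ha hb

/-! ### Distributions of bounded order -/

/-- The functionals that vanish on the `n`-th power of the maximal ideal of `x`. -/
def distBelow (x : G.Points) (n : ℕ) : Submodule k (Module.Dual k A) :=
  (idealPow x n).dualAnnihilator

theorem mem_distBelow {x : G.Points} {n : ℕ} {φ : Module.Dual k A} :
    φ ∈ distBelow x n ↔ ∀ a ∈ idealPow x n, φ a = 0 := Submodule.mem_dualAnnihilator _

/-- With this shift of the index `distBelow x 0` is the zero space, so inductions on the order have
a trivial start. -/
theorem distBelow_succ (x : G.Points) (n : ℕ) : distBelow x (n + 1) = distOrder x n := by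
  rw [distBelow, distOrder, idealPow_succ_eq_pow]

theorem distBelow_zero (x : G.Points) : distBelow x 0 = ⊥ := Submodule.dualAnnihilator_top

theorem distBelow_monotone (x : G.Points) : Monotone (distBelow x) := fun _ _ h =>
  Submodule.dualAnnihilator_anti (idealPow_antitone x h)

theorem distBelow_le_distAt (x : G.Points) (n : ℕ) : distBelow x n ≤ distAt x := by
  cases n with
  | zero => rw [distBelow_zero]; exact bot_le
  | succ n => rw [distBelow_succ]; exact le_iSup (distOrder x) n

theorem mem_distAt {x : G.Points} {φ : Module.Dual k A} :
    φ ∈ distAt x ↔ ∃ n, φ ∈ distBelow x n := by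
  constructor
  · intro h
    rw [distAt, Submodule.mem_iSup_of_directed] at h
    · obtain ⟨n, hn⟩ := h
      exact ⟨n + 1, distBelow_succ x n ▸ hn⟩
    · simp only [← distBelow_succ]
      exact ((distBelow_monotone x).comp (fun _ _ h => Nat.succ_le_succ h)).directed_le
  · rintro ⟨n, hn⟩
    exact distBelow_le_distAt x n hn

theorem proj_mem_distAt {x : G.Points} {φ : Module.Dual k A} (hφ : φ ∈ distAt x) (i : ZMod 2) :
    φ ∘ₗ superProj G.gr G.isInternal i ∈ distAt x := by
  rw [mem_distAt] at *
  obtain ⟨n, hn⟩ := hφ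
  exact ⟨n, mem_distBelow.2 fun a ha => mem_distBelow.1 hn _ (proj_mem_idealPow i ha)⟩

theorem ev_mem_distAt (x : G.Points) : ev x ∈ distAt x :=
  mem_distAt.2 ⟨1, mem_distBelow.2 fun a ha => by rwa [idealPow_one] at ha⟩

/-! ### Translations -/

variable (G)

/-- The operator `(X ⊗ 1) ∘ μ^*` on `𝒪(G)`. -/
def leftAct (X : Module.Dual k A) : A →ₗ[k] A :=
  (TensorProduct.lid k A).toLinearMap ∘ₗ X.rTensor A ∘ₗ G.comul

/-- The operator `(1 ⊗ X) ∘ μ^*` on `𝒪(G)`. -/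
def rightAct (X : Module.Dual k A) : A →ₗ[k] A :=
  (TensorProduct.rid k A).toLinearMap ∘ₗ X.lTensor A ∘ₗ G.comul

variable {G}

theorem uconv_eq_comp_leftAct (X φ : Module.Dual k A) : G.uconv X φ = φ ∘ₗ G.leftAct X := by
  ext a
  simp only [uconv, leftAct, LinearMap.comp_apply]
  generalize G.comul a = t
  induction t with
  | zero => simp
  | add s t hs ht => simp only [map_add, hs, ht]
  | tmul u v => simp

theorem uconv_eq_comp_rightAct (φ X : Module.Dual k A) : G.uconv φ X = φ ∘ₗ G.rightAct X := by
  ext a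
  simp only [uconv, rightAct, LinearMap.comp_apply]
  generalize G.comul a = t
  induction t with
  | zero => simp
  | add s t hs ht => simp only [map_add, hs, ht]
  | tmul u v => simp [mul_comm]

/-- The functional $\mathrm{ev}_x$ is even, so no sign appears. -/
theorem ev_conv (x : G.Points) (φ : Module.Dual k A) :
    G.conv (ev x) φ = φ ∘ₗ G.leftAct (ev x) := by
  rw [← uconv_eq_comp_leftAct]
  obtain ⟨φ₀, h0, φ₁, h1, rfl⟩ := exists_homogeneous (G := G) φ
  rw [map_add, conv_homogeneous x.ev_mem h0, conv_homogeneous x.ev_mem h1]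
  simp [koszulSign_zero_left, uconv_eq_comp_leftAct, LinearMap.add_comp]

theorem conv_ev (φ : Module.Dual k A) (x : G.Points) :
    G.conv φ (ev x) = φ ∘ₗ G.rightAct (ev x) := by
  rw [← uconv_eq_comp_rightAct]
  obtain ⟨φ₀, h0, φ₁, h1, rfl⟩ := exists_homogeneous (G := G) φ
  rw [map_add, LinearMap.add_apply, conv_homogeneous h0 x.ev_mem, conv_homogeneous h1 x.ev_mem]
  simp [koszulSign_zero_right, uconv_eq_comp_rightAct, LinearMap.add_comp]

theorem ev_mul (x y : G.Points) : ev (x * y) = G.uconv (ev x) (ev y) := rfl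

theorem conv_ev_ev (x y : G.Points) : G.conv (ev x) (ev y) = ev (x * y) := by
  rw [ev_conv, ← uconv_eq_comp_leftAct, ev_mul]

/-- In $\mu^*(a)\mu^*(b)$ the terms with a Koszul sign have an odd first factor coming from $b$, and
$\mathrm{ev}_x$ kills them. Translation by a point is therefore multiplicative. -/
theorem leftAct_ev_mul (x : G.Points) (a b : A) : G.leftAct (ev x) (a * b) =
    G.leftAct (ev x) a * G.leftAct (ev x) b := by
  have h := G.comul_mul a b
  rw [G.mul_eq] at h
  simp only [leftAct, LinearMap.comp_apply, h, LinearEquiv.coe_coe]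
  generalize G.comul a = s
  generalize G.comul b = t
  induction s with
  | zero => simp
  | add s s' hs hs' => simp only [map_add, LinearMap.add_apply, hs, hs', add_mul]
  | tmul a b =>
    induction t with
    | zero => simp
    | add t t' ht ht' => simp only [map_add, ht, ht', mul_add]
    | tmul c d =>
      rw [superTensorMul_tmul]
      simp only [sum_zmod_two, map_add, map_smul, LinearMap.rTensor_tmul, ev_apply_mul,
        ev_apply_proj, TensorProduct.lid_tmul, koszulSign]
      simp
      rw [← smul_add, ← add_mul, superProj_add, mul_smul, smul_comm]

theorem rightAct_ev_mul (x : G.Points) (a b : A) : G.rightAct (ev x) (a * b) =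
    G.rightAct (ev x) a * G.rightAct (ev x) b := by
  have h := G.comul_mul a b
  rw [G.mul_eq] at h
  simp only [rightAct, LinearMap.comp_apply, h, LinearEquiv.coe_coe]
  generalize G.comul a = s
  generalize G.comul b = t
  induction s with
  | zero => simp
  | add s s' hs hs' => simp only [map_add, LinearMap.add_apply, hs, hs', add_mul]
  | tmul a b =>
    induction t with
    | zero => simp
    | add t t' ht ht' => simp only [map_add, ht, ht', mul_add]
    | tmul c d =>
      rw [superTensorMul_tmul]
      simp only [sum_zmod_two, map_add, map_smul, LinearMap.lTensor_tmul, ev_apply_mul,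
        ev_apply_proj, TensorProduct.rid_tmul, koszulSign]
      simp
      rw [← smul_add, ← mul_add, superProj_add, mul_smul, smul_comm]

/-- Since $\mathrm{ev}_y$ composed with the translation is $\mathrm{ev}_{xy}$, the translation maps
$m_{xy}$ into $m_y$, hence powers into powers. -/
theorem ev_conv_mem_distAt (x : G.Points) {y : G.Points} {φ : Module.Dual k A}
    (hφ : φ ∈ distAt y) : G.conv (ev x) φ ∈ distAt (x * y) := by
  rw [mem_distAt] at *
  obtain ⟨n, hn⟩ := hφ
  refine ⟨n, mem_distBelow.2 fun a ha => ?_⟩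
  rw [ev_conv, LinearMap.comp_apply]
  refine mem_distBelow.1 hn _ (idealPow_map_le (leftAct_ev_mul x) (fun b hb => ?_) n a ha)
  rw [mem_maxIdeal, ev_mul, uconv_eq_comp_leftAct] at hb
  exact hb

theorem conv_ev_mem_distAt {x : G.Points} (y : G.Points) {φ : Module.Dual k A}
    (hφ : φ ∈ distAt x) : G.conv φ (ev y) ∈ distAt (x * y) := by
  rw [mem_distAt] at *
  obtain ⟨n, hn⟩ := hφ
  refine ⟨n, mem_distBelow.2 fun a ha => ?_⟩
  rw [conv_ev, LinearMap.comp_apply]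
  refine mem_distBelow.1 hn _ (idealPow_map_le (rightAct_ev_mul y) (fun b hb => ?_) n a ha)
  rw [mem_maxIdeal, ev_mul, uconv_eq_comp_rightAct] at hb
  exact hb

/-! ### Generators of the maximal ideals -/

/-- The generators are the homogeneous parts of algebra generators, each minus its value at `x`. -/
theorem exists_finite_generators (x : G.Points) : ∃ B : Set A, B.Finite ∧
    (∀ b ∈ B, b ∈ maxIdeal x ∧ ∃ i, b ∈ G.gr i) ∧
      maxIdeal x ≤ Submodule.span k B ⊔ idealPow x 2 := by
  obtain ⟨S, hS⟩ := G.finiteType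
  let c : ZMod 2 → A → A := fun i s =>
    superProj G.gr G.isInternal i s - ev x (superProj G.gr G.isInternal i s) • 1
  have hfin : (⋃ i : ZMod 2, c i '' (S : Set A)).Finite :=
    Set.finite_iUnion fun i => S.finite_toSet.image _
  refine ⟨_, hfin, ?_, ?_⟩
  · intro b hb
    obtain ⟨i, s, hs, rfl⟩ := Set.mem_iUnion.1 hb
    refine ⟨sub_smul_mem_maxIdeal x _, i, sub_mem (superProj_mem _ _ _ _) ?_⟩
    rw [ev_apply_proj]
    rcases zmod_two_cases i with rfl | rfl
    · exact Submodule.smul_mem _ _ (DualHopfMaps.one_mem_gr G)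
    · simp
  · set W := Submodule.span k (⋃ i : ZMod 2, c i '' (S : Set A)) ⊔ idealPow x 2 with hW
    have h2 : ∀ a ∈ maxIdeal x, ∀ b ∈ maxIdeal x, a * b ∈ W := fun a ha b hb =>
      Submodule.mem_sup_right (mul_mem_idealPow (n := 1) (l := 1) (by rwa [idealPow_one])
        (by rwa [idealPow_one]) rfl)
    -- The functions with this property form a subalgebra, by
    -- $ab-a(x)b(x)=(a-a(x))(b-b(x))+a(x)(b-b(x))+b(x)(a-a(x))$.
    have key : ∀ a : A, a - ev x a • 1 ∈ W := by
      intro a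
      have ha : a ∈ Algebra.adjoin k (S : Set A) := hS ▸ Algebra.mem_top
      induction ha using Algebra.adjoin_induction with
      | mem s hs =>
        have h3 : ∀ i, c i s ∈ W := fun i =>
          Submodule.mem_sup_left (Submodule.subset_span (Set.mem_iUnion.2 ⟨i, s, hs, rfl⟩))
        have h4 : s - ev x s • 1 = c 0 s + c 1 s := by
          simp only [c]
          rw [sub_add_sub_comm, superProj_add, ← add_smul, ← map_add, superProj_add]
        exact h4 ▸ add_mem (h3 0) (h3 1)
      | algebraMap r =>
        rw [Algebra.algebraMap_eq_smul_one, map_smul, ev_apply_one, smul_eq_mul, mul_one, sub_self]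
        exact zero_mem _
      | add a b _ _ ha hb =>
        rw [map_add, add_smul, add_sub_add_comm]
        exact add_mem ha hb
      | mul a b _ _ ha hb =>
        have h5 : a * b - ev x (a * b) • 1 = (a - ev x a • 1) * (b - ev x b • 1) +
            ev x a • (b - ev x b • 1) + ev x b • (a - ev x a • 1) := by
          rw [ev_apply_mul]
          simp only [sub_mul, mul_sub, smul_mul_assoc, mul_smul_comm, one_mul, mul_one, smul_sub,
            mul_smul]
          rw [smul_comm (ev x b) (ev x a)]
          abel
        rw [h5]
        exact add_mem (add_mem (h2 _ (sub_smul_mem_maxIdeal x a) _ (sub_smul_mem_maxIdeal x b))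
          (Submodule.smul_mem _ _ hb)) (Submodule.smul_mem _ _ ha)
    intro a ha
    have := key a
    rwa [mem_maxIdeal.1 ha, zero_smul, sub_zero] at this

theorem exists_finite_span_idealPow (x : G.Points) (n : ℕ) : ∃ T : Set A, T.Finite ∧
    idealPow x n ≤ Submodule.span k T ⊔ idealPow x (n + 1) := by
  obtain ⟨B, hB, -, hB2⟩ := exists_finite_generators x
  induction n with
  | zero =>
    refine ⟨{1}, Set.finite_singleton _, fun a _ => ?_⟩
    rw [← add_sub_cancel (ev x a • 1) a]
    refine Submodule.add_mem_sup (Submodule.smul_mem _ _ (Submodule.subset_span rfl)) ?_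
    rw [zero_add, idealPow_one]
    exact sub_smul_mem_maxIdeal x a
  | succ n ih =>
    obtain ⟨T, hT, h⟩ := ih
    refine ⟨B * T, hB.mul hT, ?_⟩
    rw [idealPow_succ]
    refine Submodule.mul_le.2 fun a ha b hb => ?_
    obtain ⟨u, hu, v, hv, rfl⟩ := Submodule.mem_sup.1 (hB2 ha)
    obtain ⟨s, hs, t, ht, rfl⟩ := Submodule.mem_sup.1 (h hb)
    have hu1 : u ∈ idealPow x 1 := by
      rw [idealPow_one]
      have : u + v - v ∈ maxIdeal x := sub_mem ha (by
        rw [← idealPow_one]; exact idealPow_antitone x (by norm_num) hv)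
      simpa using this
    rw [add_mul, mul_add, add_assoc (u * s)]
    refine Submodule.add_mem_sup ?_ (add_mem (mul_mem_idealPow (m := n + 1 + 1) hu1 ht (by ring))
      (mul_mem_idealPow (m := n + 1 + 1) hv hb (by ring)))
    rw [← Submodule.span_mul_span]
    exact Submodule.mul_mem_mul hu hs

/-- Finite codimension makes $\phi\circ\mathrm{mult}$ an element of an algebraic tensor product of
duals, when $\phi$ is a distribution. Finite generation of $\mathcal O(G)$ enters through it and
through the frame. -/
instance finiteDimensional_quotient_idealPow (x : G.Points) (n : ℕ) :
    FiniteDimensional k (A ⧸ idealPow x n) := by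
  have h : ∃ T : Set A, T.Finite ∧ (⊤ : Submodule k A) ≤ Submodule.span k T ⊔ idealPow x n := by
    induction n with
    | zero => exact ⟨∅, Set.finite_empty, le_sup_right⟩
    | succ n ih =>
      obtain ⟨T, hT, h⟩ := ih
      obtain ⟨T', hT', h'⟩ := exists_finite_span_idealPow x n
      refine ⟨T ∪ T', hT.union hT', h.trans ?_⟩
      rw [Submodule.span_union, sup_assoc]
      exact sup_le_sup_left h' _
  obtain ⟨T, hT, h⟩ := h
  refine ⟨Submodule.fg_def.2 ⟨(idealPow x n).mkQ '' T, hT.image _, ?_⟩⟩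
  rw [← Submodule.map_span, eq_top_iff, ← (idealPow x n).range_mkQ, LinearMap.range_eq_map]
  refine (Submodule.map_mono h).trans ?_
  rw [Submodule.map_sup]
  refine sup_le le_rfl ?_
  rw [Submodule.mkQ_map_self]
  exact bot_le

/-! ### Coproducts of distributions -/

/-- If the $c_i$ lift a basis $e_i$ of $A/M$, then $\beta=\sum e_i^*\otimes\beta(c_i\otimes\cdot)$.
Finite codimension is needed on one side only. -/
theorem exists_dualDistrib_eq (M N : Submodule k A) [FiniteDimensional k (A ⧸ M)]
    (β : Module.Dual k (A ⊗[k] A)) (hM : ∀ a ∈ M, ∀ b, β (a ⊗ₜ b) = 0)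
    (hN : ∀ a, ∀ b ∈ N, β (a ⊗ₜ b) = 0) :
    ∃ t : M.dualAnnihilator ⊗[k] N.dualAnnihilator, TensorProduct.dualDistrib k A A
      (TensorProduct.map M.dualAnnihilator.subtype N.dualAnnihilator.subtype t) = β := by
  let e := Module.finBasis k (A ⧸ M)
  choose c hc using fun i => M.mkQ_surjective (e i)
  refine ⟨∑ i, ⟨e.coord i ∘ₗ M.mkQ, ?_⟩ ⊗ₜ ⟨β ∘ₗ TensorProduct.mk k A A (c i), ?_⟩, ?_⟩
  · rw [Submodule.mem_dualAnnihilator]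
    intro a ha
    rw [LinearMap.comp_apply, (Submodule.Quotient.mk_eq_zero M).2 ha |> fun h =>
      (show M.mkQ a = 0 from h), map_zero]
  · rw [Submodule.mem_dualAnnihilator]
    exact hN (c i)
  · refine TensorProduct.ext' fun a b => ?_
    have h1 : a - ∑ i, e.coord i (M.mkQ a) • c i ∈ M := by
      rw [← Submodule.Quotient.mk_eq_zero, ← Submodule.mkQ_apply, map_sub, map_sum]
      simp only [map_smul, hc]
      exact sub_eq_zero.2 (e.sum_repr _).symm
    have h2 := hM _ h1 b
    rw [TensorProduct.sub_tmul, map_sub, sub_eq_zero, TensorProduct.sum_tmul, map_sum] at h2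
    rw [h2, map_sum, map_sum, LinearMap.sum_apply]
    refine Finset.sum_congr rfl fun i _ => ?_
    rw [← TensorProduct.smul_tmul', map_smul]
    simp

/-- The unsigned version is applied to the Koszul twist of `β`; homogeneity of `M` and `N` preserves
the vanishing conditions. -/
theorem exists_superDualDistrib_eq (M N : Submodule k A) [FiniteDimensional k (A ⧸ M)]
    (hMp : ∀ i, ∀ a ∈ M, superProj G.gr G.isInternal i a ∈ M)
    (hNp : ∀ i, ∀ a ∈ N, superProj G.gr G.isInternal i a ∈ N)
    (β : Module.Dual k (A ⊗[k] A)) (hM : ∀ a ∈ M, ∀ b, β (a ⊗ₜ b) = 0)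
    (hN : ∀ a, ∀ b ∈ N, β (a ⊗ₜ b) = 0) :
    ∃ t : M.dualAnnihilator ⊗[k] N.dualAnnihilator, superDualDistrib G.gr G.isInternal
      (TensorProduct.map M.dualAnnihilator.subtype N.dualAnnihilator.subtype t) = β := by
  obtain ⟨t, ht⟩ := exists_dualDistrib_eq M N (β ∘ₗ koszulTwist G.gr G.isInternal)
    (fun a ha b => by simp [koszulTwist, hM _ (hMp _ a ha)])
    (fun a b hb => by simp [koszulTwist, hN _ _ (hNp _ b hb)])
  refine ⟨t, LinearMap.ext fun w => ?_⟩
  rw [superDualDistrib, LinearMap.comp_apply, ht, LinearMap.dualMap_apply, LinearMap.comp_apply,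
    koszulTwist_koszulTwist]

theorem exists_comul_of_mem_distBelow {x : G.Points} {n : ℕ} {φ : Module.Dual k A}
    (hφ : φ ∈ distBelow x n) : ∃ t : distBelow x n ⊗[k] distBelow x n,
      superDualDistrib G.gr G.isInternal
        (TensorProduct.map (distBelow x n).subtype (distBelow x n).subtype t) =
        φ ∘ₗ LinearMap.mul' k A :=
  exists_superDualDistrib_eq _ _ (fun i _ ha => proj_mem_idealPow i ha)
    (fun i _ ha => proj_mem_idealPow i ha) _
    (fun _ ha b => mem_distBelow.1 hφ _ (mul_mem_idealPow_right b ha))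
    (fun a _ hb => mem_distBelow.1 hφ _ (mul_mem_idealPow_left a hb))

theorem superDualDistrib_tmul_ev (φ : Module.Dual k A) (x : G.Points) (a b : A) :
    superDualDistrib G.gr G.isInternal (φ ⊗ₜ ev x) (a ⊗ₜ b) = φ a * ev x b := by
  simp only [superDualDistrib, LinearMap.comp_apply, LinearMap.dualMap_apply, koszulTwist,
    sum_zmod_two, LinearMap.add_apply, LinearMap.smul_apply, TensorProduct.map_tmul, map_add,
    map_smul, TensorProduct.dualDistrib_apply, ev_apply_proj, koszulSign_zero_right]
  conv_rhs => rw [← superProj_add G.gr G.isInternal a, map_add]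
  simp
  ring

theorem superDualDistrib_ev_tmul (x : G.Points) (φ : Module.Dual k A) (a b : A) :
    superDualDistrib G.gr G.isInternal (ev x ⊗ₜ φ) (a ⊗ₜ b) = ev x a * φ b := by
  simp only [superDualDistrib, LinearMap.comp_apply, LinearMap.dualMap_apply, koszulTwist,
    sum_zmod_two, LinearMap.add_apply, LinearMap.smul_apply, TensorProduct.map_tmul, map_add,
    map_smul, TensorProduct.dualDistrib_apply, ev_apply_proj, koszulSign_zero_left]
  conv_rhs => rw [← superProj_add G.gr G.isInternal b, map_add]
  simp
  ring

/-- Removing $\phi\otimes\mathrm{ev}_x$ from the coproduct lowers the order of the first factors.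
This drives the induction for the antipode. -/
theorem exists_reduced_comul {x : G.Points} {n : ℕ} {φ : Module.Dual k A}
    (hφ : φ ∈ distBelow x (n + 1)) : ∃ t : distBelow x n ⊗[k] distBelow x (n + 1),
      superDualDistrib G.gr G.isInternal (φ ⊗ₜ ev x) + superDualDistrib G.gr G.isInternal
        (TensorProduct.map (distBelow x n).subtype (distBelow x (n + 1)).subtype t) =
        φ ∘ₗ LinearMap.mul' k A := by
  obtain ⟨t, ht⟩ := exists_superDualDistrib_eq (G := G) (idealPow x n) (idealPow x (n + 1))
    (fun i _ ha => proj_mem_idealPow i ha) (fun i _ ha => proj_mem_idealPow i ha)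
    (φ ∘ₗ LinearMap.mul' k A - superDualDistrib G.gr G.isInternal (φ ⊗ₜ ev x))
    (fun a ha b => by
      rw [LinearMap.sub_apply, superDualDistrib_tmul_ev, LinearMap.comp_apply,
        LinearMap.mul'_apply]
      -- For $a\in m_x^n$ the element $a(b-b(x))$ lies in $m_x^{n+1}$, so $\phi(ab)=\phi(a)\,b(x)$.
      have := mem_distBelow.1 hφ (a * (b - ev x b • 1)) (mul_mem_idealPow (l := 1) ha
        (by rw [idealPow_one]; exact sub_smul_mem_maxIdeal x b) rfl)
      rw [mul_sub, map_sub, mul_smul_comm, mul_one, map_smul, smul_eq_mul, mul_comm (ev x b)] at this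
      exact this)
    (fun a b hb => by
      have h1 : b ∈ maxIdeal x := by
        rw [← idealPow_one]; exact idealPow_antitone x (by omega) hb
      rw [LinearMap.sub_apply, superDualDistrib_tmul_ev, LinearMap.comp_apply,
        LinearMap.mul'_apply, mem_distBelow.1 hφ _ (mul_mem_idealPow_left a hb),
        mem_maxIdeal.1 h1, mul_zero, sub_zero])
  exact ⟨t, (congrArg (_ + ·) ht).trans (add_sub_cancel _ _)⟩

end AffineSupergroup

namespace AffineSupergroup

variable {k A : Type*} [Field k] [Ring A] [Algebra k A] {G : AffineSupergroup k A}

/-! ### The action of the Lie superalgebra by superderivations -/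

theorem mem_dualGr_apply_proj {X : Module.Dual k A} {p : ZMod 2} (hX : X ∈ dualGr G.gr p)
    (i : ZMod 2) (a : A) : X (superProj G.gr G.isInternal i a) = if i = p then X a else 0 := by
  have := LinearMap.congr_fun (comp_proj_of_mem hX i) a
  rw [LinearMap.comp_apply] at this
  rw [this]; split_ifs <;> simp

variable (G) in
/-- The automorphism `a ↦ (-1)^(|a| p) a`. -/
def parityTwist (p : ZMod 2) : A →ₗ[k] A :=
  ∑ i : ZMod 2, koszulSign k i p • superProj G.gr G.isInternal i

theorem parityTwist_of_mem {p i : ZMod 2} {a : A} (ha : a ∈ G.gr i) :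
    G.parityTwist p a = koszulSign k i p • a := by
  simp only [parityTwist, sum_zmod_two, LinearMap.add_apply, LinearMap.smul_apply,
    superProj_of_mem G.gr G.isInternal ha]
  rcases zmod_two_cases i with rfl | rfl <;> simp

theorem parityTwist_mem_maxIdeal {x : G.Points} {p : ZMod 2} {a : A} (ha : a ∈ maxIdeal x) :
    G.parityTwist p a ∈ maxIdeal x := by
  rw [mem_maxIdeal] at *
  simp [parityTwist, sum_zmod_two, ev_apply_proj, ha]

theorem leftAct_ev_one (a : A) : G.leftAct (ev (1 : G.Points)) a = a := by
  have h := G.rTensor_counit_comp_comul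
  have h2 := LinearMap.congr_fun h a
  simp only [leftAct, LinearMap.comp_apply, LinearEquiv.coe_coe]
  exact (congrArg (TensorProduct.lid k A) h2).trans (by simp)

/-- The functional $X$ is a derivation at $e$. Where it falls on $b$, only the part of parity $p$ of
the first factor of $\mu^*(b)$ counts, and moving this part past $a$ produces the sign
$(-1)^{|a|p}$. -/
theorem leftAct_mul {X : Module.Dual k A} {p : ZMod 2} (hX : X ∈ G.lieSpace)
    (hp : X ∈ dualGr G.gr p) (a b : A) :
    G.leftAct X (a * b) = G.leftAct X a * b + G.parityTwist p a * G.leftAct X b := by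
  have hX' := mem_lieSpace.1 hX
  have key : ∀ s t : A ⊗[k] A, TensorProduct.lid k A (X.rTensor A
      (superTensorMul G.gr G.isInternal G.mul s t)) =
      TensorProduct.lid k A (X.rTensor A s) *
        TensorProduct.lid k A ((ev (1 : G.Points)).rTensor A t) +
      G.parityTwist p (TensorProduct.lid k A ((ev (1 : G.Points)).rTensor A s)) *
        TensorProduct.lid k A (X.rTensor A t) := by
    intro s t
    induction s with
    | zero => simp
    | add s s' hs hs' =>
      simp only [map_add, LinearMap.add_apply, hs, hs', add_mul]
      abel
    | tmul a b =>
      induction t with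
      | zero => simp
      | add t t' ht ht' =>
        simp only [map_add, ht, ht', mul_add]
        abel
      | tmul c d =>
        rw [superTensorMul_tmul]
        simp only [sum_zmod_two, map_add, map_smul, LinearMap.rTensor_tmul, hX', counit_proj,
          mem_dualGr_apply_proj hp, TensorProduct.lid_tmul, parityTwist, LinearMap.add_apply,
          LinearMap.smul_apply]
        change _ = X a • b * G.counit c • d + G.counit a • _ * X c • d
        conv_lhs => rw [← superProj_add G.gr G.isInternal b]
        conv_rhs => enter [1]; rw [← superProj_add G.gr G.isInternal b]
        simp only [map_add, superProj_of_mem G.gr G.isInternal (superProj_mem G.gr G.isInternal _ _),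
          add_mul, smul_add, smul_mul_assoc, mul_smul_comm]
        rcases zmod_two_cases p with rfl | rfl <;> simp [koszulSign] <;> module
  have h := G.comul_mul a b
  rw [G.mul_eq] at h
  have h2 := key (G.comul a) (G.comul b)
  rw [← h] at h2
  have h3 := leftAct_ev_one (G := G) a
  have h4 := leftAct_ev_one (G := G) b
  simp only [leftAct, LinearMap.comp_apply, LinearEquiv.coe_coe] at h3 h4 ⊢
  rw [h2, h3, h4]

theorem ev_one_leftAct (X : Module.Dual k A) (a : A) :
    ev (1 : G.Points) (G.leftAct X a) = X a := by
  have := LinearMap.congr_fun (uconv_eq_comp_leftAct (G := G) X (ev (1 : G.Points))) a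
  rw [LinearMap.comp_apply] at this
  rw [← this]
  exact LinearMap.congr_fun (uconv_counit X) a

theorem leftAct_mem_idealPow {X : Module.Dual k A} {p : ZMod 2} (hX : X ∈ G.lieSpace)
    (hp : X ∈ dualGr G.gr p) {n : ℕ} {a : A} (ha : a ∈ idealPow (1 : G.Points) (n + 1)) :
    G.leftAct X a ∈ idealPow (1 : G.Points) n := by
  induction n generalizing a with
  | zero => exact Submodule.mem_top
  | succ n ih =>
    rw [idealPow_succ] at ha
    induction ha using Submodule.mul_induction_on' with
    | mem_mul_mem a ha b hb =>
      rw [leftAct_mul hX hp]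
      exact add_mem (mul_mem_idealPow_left _ hb)
        (Submodule.mul_mem_mul (parityTwist_mem_maxIdeal ha) (ih hb))
    | add a _ b _ ha hb => rw [map_add]; exact add_mem ha hb

/-! ### Dual systems of functions and tangent vectors at the unit -/

variable (G) in
/-- Homogeneous functions that generate the maximal ideal of the unit modulo its square, and
homogeneous elements of `Lie(G)` dual to them. -/
structure Frame (ι : Type*) where
  p : ι → ZMod 2
  f : ι → A
  x : ι → G.Lie
  f_mem : ∀ i, f i ∈ G.gr (p i)
  f_mem_maxIdeal : ∀ i, f i ∈ maxIdeal (1 : G.Points)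
  x_mem : ∀ i, G.lieInclusion (x i) ∈ dualGr G.gr (p i)
  dual_self : ∀ i, G.lieInclusion (x i) (f i) = 1
  dual_ne : ∀ i l, i ≠ l → G.lieInclusion (x i) (f l) = 0
  span : maxIdeal (1 : G.Points) ≤ Submodule.span k (Set.range f) ⊔ idealPow (1 : G.Points) 2

theorem lieInclusion_mem (X : G.Lie) : G.lieInclusion X ∈ G.lieSpace := X.2

theorem mem_lieSpace_iff {X : Module.Dual k A} : X ∈ G.lieSpace ↔
    (∀ a ∈ idealPow (1 : G.Points) 2, X a = 0) ∧ X 1 = 0 := by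
  rw [lieSpace, Submodule.mem_inf, ← distBelow_succ, mem_distBelow]
  rfl

/-- A basis is extracted from the finitely many homogeneous generators of $m_e$ modulo $m_e^2$; its
coordinate functionals, made homogeneous, are the dual vectors. -/
theorem exists_frame {k : Type*} {A : Type u} [Field k] [Ring A] [Algebra k A]
    (G : AffineSupergroup k A) : ∃ (ι : Type u) (_ : Finite ι), Nonempty (Frame G ι) := by
  classical
  obtain ⟨B, hB, hB1, hB2⟩ := exists_finite_generators (1 : G.Points)
  -- Dividing by the constants as well as by $m_e^2$ makes the coordinates functionals on all of $A$
  -- that vanish on $1$ and $m_e^2$, that is, elements of $\mathrm{Lie}(G)$.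
  let W : Submodule k A := Submodule.span k {1} ⊔ idealPow (1 : G.Points) 2
  obtain ⟨κ, c, hc, hspan, hli⟩ := exists_linearIndependent' k (fun b : B => W.mkQ b.1)
  have hfin : Finite B := hB
  have hspanB : (⊤ : Submodule k (A ⧸ W)) ≤
      Submodule.span k (Set.range ((fun b : B => W.mkQ b.1) ∘ c)) := by
    rw [hspan]
    rintro q -
    obtain ⟨a, rfl⟩ := W.mkQ_surjective q
    obtain ⟨u, hu, v, hv, huv⟩ :=
      Submodule.mem_sup.1 (hB2 (sub_smul_mem_maxIdeal (1 : G.Points) a))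
    have h1 : W.mkQ a = W.mkQ u := by
      rw [← sub_eq_zero, ← map_sub]
      refine (Submodule.Quotient.mk_eq_zero W).2 ?_
      have : a - u = ev (1 : G.Points) a • 1 + v := by
        rw [sub_eq_iff_eq_add, add_assoc, add_comm v u, huv]; abel
      rw [this]
      exact Submodule.add_mem_sup (Submodule.smul_mem _ _ (Submodule.subset_span rfl)) hv
    rw [h1]
    have h2 : Set.range (fun b : B => W.mkQ b.1) = W.mkQ '' B := by
      ext z; simp
    rw [h2, ← Submodule.map_span]
    exact ⟨u, hu, rfl⟩
  let b := Module.Basis.mk hli hspanB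
  choose p hp using fun i => (hB1 (c i) (c i).2).2
  have hlie : ∀ i, b.coord i ∘ₗ W.mkQ ∈ G.lieSpace := fun i => by
    have h0 : ∀ a ∈ W, (b.coord i ∘ₗ W.mkQ) a = 0 := fun a ha => by
      have : W.mkQ a = 0 := (Submodule.Quotient.mk_eq_zero W).2 ha
      rw [LinearMap.comp_apply, this, map_zero]
    exact mem_lieSpace_iff.2 ⟨fun a ha => h0 a (Submodule.mem_sup_right ha),
      h0 1 (Submodule.mem_sup_left (Submodule.subset_span rfl))⟩
  have hval : ∀ i l, (b.coord i ∘ₗ W.mkQ) (c l : A) = if i = l then 1 else 0 := fun i l => by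
    have : W.mkQ (c l : A) = b l := by simp [b]
    rw [LinearMap.comp_apply, this, Module.Basis.coord_apply, Module.Basis.repr_self,
      Finsupp.single_apply]
    simp [eq_comm]
  -- Replacing a coordinate by its component of parity `p i` keeps duality: it is unchanged on
  -- functions of that parity and becomes zero on the others, where it was zero already.
  have hval2 : ∀ i l, (b.coord i ∘ₗ W.mkQ ∘ₗ superProj G.gr G.isInternal (p i)) (c l : A) =
      if i = l then 1 else 0 := fun i l => by
    have h3 := hval i l
    rw [LinearMap.comp_apply] at h3
    rw [LinearMap.comp_apply, LinearMap.comp_apply, superProj_of_mem _ _ (hp l)]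
    by_cases hil : i = l
    · rw [hil] at h3 ⊢
      rw [if_pos rfl, h3]
    · rw [if_neg hil] at h3 ⊢
      split_ifs
      · exact h3
      · simp
  refine ⟨κ, Finite.of_injective c hc, ⟨{
    p := p
    f := fun i => c i
    x := fun i => ⟨_, lieSpace_comp_proj (hlie i) (p i)⟩
    f_mem := hp
    f_mem_maxIdeal := fun i => (hB1 (c i) (c i).2).1
    x_mem := fun i => comp_proj_mem _ _
    dual_self := fun i => (hval2 i i).trans (if_pos rfl)
    dual_ne := fun i l h => (hval2 i l).trans (if_neg h)
    span := ?_ }⟩⟩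
  intro a ha
  have h4 := hspanB (Submodule.mem_top (x := W.mkQ a))
  have h5 : Set.range ((fun b : B => W.mkQ b.1) ∘ c) = W.mkQ '' Set.range (fun i => (c i : A)) := by
    rw [← Set.range_comp]; rfl
  rw [h5, ← Submodule.map_span] at h4
  obtain ⟨u, hu, hua⟩ := h4
  have h6 : a - u ∈ W := by
    rw [← Submodule.Quotient.mk_eq_zero, ← Submodule.mkQ_apply, map_sub, hua, sub_self]
  obtain ⟨r, hr, v, hv, hrv⟩ := Submodule.mem_sup.1 h6
  obtain ⟨r, rfl⟩ := Submodule.mem_span_singleton.1 hr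
  have h7 : ev (1 : G.Points) u = 0 := by
    have : Submodule.span k (Set.range fun i => (c i : A)) ≤ maxIdeal (1 : G.Points) := by
      rw [Submodule.span_le]
      rintro _ ⟨i, rfl⟩
      exact (hB1 (c i) (c i).2).1
    exact this hu
  have h8 : ev (1 : G.Points) v = 0 := by
    have := idealPow_antitone (1 : G.Points) (show 1 ≤ 2 by norm_num) hv
    rw [idealPow_one] at this
    exact this
  -- All other terms vanish at the unit, so the constant does too.
  have h9 : r = 0 := by
    have := congrArg (ev (1 : G.Points)) hrv
    rw [map_add, map_smul, ev_apply_one, map_sub, h7, h8, mem_maxIdeal.1 ha] at this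
    simpa using this
  rw [h9, zero_smul, zero_add] at hrv
  rw [← add_sub_cancel u a, ← hrv]
  exact Submodule.add_mem_sup hu hv

end AffineSupergroup

namespace AffineSupergroup

variable {k A : Type*} [Field k] [Ring A] [Algebra k A] {G : AffineSupergroup k A}

namespace Frame

variable {ι : Type*} (F : Frame G ι)

/-! ### Words in the functions of a frame -/

/-- The product of the functions with indices in `l`. -/
def funWord (l : List ι) : A := (l.map F.f).prod

theorem funWord_nil : F.funWord [] = 1 := rfl

theorem funWord_cons (i : ι) (l : List ι) : F.funWord (i :: l) = F.f i * F.funWord l := by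
  simp [funWord]

theorem f_mem_idealPow (i : ι) : F.f i ∈ idealPow (1 : G.Points) 1 := by
  rw [idealPow_one]; exact F.f_mem_maxIdeal i

theorem funWord_mem (l : List ι) : F.funWord l ∈ idealPow (1 : G.Points) l.length := by
  induction l with
  | nil => exact Submodule.mem_top
  | cons i l ih =>
    rw [funWord_cons, List.length_cons, idealPow_succ]
    exact Submodule.mul_mem_mul (F.f_mem_maxIdeal i) ih

/-- Only spans of words matter later, so the sign is left as an unspecified scalar. -/
theorem funWord_perm {l l' : List ι} (h : l.Perm l') : ∃ c : k, F.funWord l = c • F.funWord l' := by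
  induction h with
  | nil => exact ⟨1, (one_smul _ _).symm⟩
  | cons i _ ih =>
    obtain ⟨c, hc⟩ := ih
    exact ⟨c, by rw [funWord_cons, funWord_cons, hc, mul_smul_comm]⟩
  | swap i j l =>
    refine ⟨koszulSign k (F.p j) (F.p i), ?_⟩
    simp only [funWord_cons]
    rw [← mul_assoc, G.supercomm _ _ _ (F.f_mem j) _ (F.f_mem i), smul_mul_assoc, mul_assoc]
  | trans _ _ ih ih' =>
    obtain ⟨c, hc⟩ := ih
    obtain ⟨d, hd⟩ := ih'
    exact ⟨c * d, by rw [hc, hd, mul_smul]⟩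

theorem exists_perm_of_two_le_count [DecidableEq ι] {i : ι} {l : List ι} (h : 2 ≤ l.count i) :
    ∃ l', l.Perm (i :: i :: l') := by
  have h1 : i ∈ l := List.count_pos_iff.1 (by omega)
  have h2 : i ∈ l.erase i := by
    rw [← List.count_pos_iff, List.count_erase_self]; omega
  exact ⟨(l.erase i).erase i, (List.perm_cons_erase h1).trans ((List.perm_cons_erase h2).cons i)⟩

/-- An odd function has square zero because 2 is invertible. -/
theorem funWord_eq_zero [CharZero k] [DecidableEq ι] {i : ι} {l : List ι} (hi : F.p i = 1)
    (h : 2 ≤ l.count i) : F.funWord l = 0 := by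
  obtain ⟨l', hl⟩ := exists_perm_of_two_le_count h
  obtain ⟨c, hc⟩ := F.funWord_perm hl
  have h1 := G.supercomm _ _ _ (F.f_mem i) _ (F.f_mem i)
  have h2 : F.f i * F.f i = 0 := by
    rw [hi, show koszulSign k 1 1 = -1 by simp [koszulSign], neg_one_smul] at h1
    have h3 : (2 : k) • (F.f i * F.f i) = 0 := by
      rw [two_smul]
      nth_rewrite 1 [h1]
      exact neg_add_cancel _
    exact (smul_eq_zero.1 h3).resolve_left two_ne_zero
  rw [hc, funWord_cons, funWord_cons, ← mul_assoc, h2, zero_mul, smul_zero]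

theorem idealPow_le_span (n : ℕ) : idealPow (1 : G.Points) n ≤
    Submodule.span k (F.funWord '' {l | l.length = n}) ⊔ idealPow (1 : G.Points) (n + 1) := by
  induction n with
  | zero =>
    intro a _
    rw [← add_sub_cancel (ev (1 : G.Points) a • 1) a]
    refine Submodule.add_mem_sup (Submodule.smul_mem _ _ (Submodule.subset_span ⟨[], rfl, rfl⟩)) ?_
    rw [zero_add, idealPow_one]
    exact sub_smul_mem_maxIdeal _ a
  | succ n ih =>
    rw [idealPow_succ]
    refine Submodule.mul_le.2 fun a ha b hb => ?_
    obtain ⟨u, hu, v, hv, rfl⟩ := Submodule.mem_sup.1 (F.span ha)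
    obtain ⟨s, hs, t, ht, rfl⟩ := Submodule.mem_sup.1 (ih hb)
    have hu1 : u ∈ idealPow (1 : G.Points) 1 := by
      refine (Submodule.span_le.2 ?_ : Submodule.span k (Set.range F.f) ≤ _) hu
      rintro _ ⟨i, rfl⟩
      exact F.f_mem_idealPow i
    rw [add_mul, mul_add, add_assoc (u * s)]
    refine Submodule.add_mem_sup ?_ (add_mem (mul_mem_idealPow (m := n + 1 + 1) hu1 ht (by ring))
      (mul_mem_idealPow (m := n + 1 + 1) hv hb (by ring)))
    have h1 := Submodule.mul_mem_mul hu hs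
    rw [Submodule.span_mul_span] at h1
    refine Submodule.span_mono ?_ h1
    rintro _ ⟨_, ⟨i, rfl⟩, _, ⟨l, hl, rfl⟩, rfl⟩
    refine ⟨i :: l, ?_, F.funWord_cons i l⟩
    simpa using hl

/-- The multisets of indices that index the monomials: odd indices are not repeated. -/
def Monomial (n : ℕ) : Type _ :=
  {s : Sym ι n // ∀ i, F.p i = 1 → ¬ ({i, i} : Multiset ι) ≤ (s : Multiset ι)}

instance [Finite ι] (n : ℕ) : Finite (F.Monomial n) := by
  classical
  have := Fintype.ofFinite ι
  exact Subtype.finite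

variable {F} in
/-- A list of the indices of a monomial. -/
def Monomial.toList {n : ℕ} (s : F.Monomial n) : List ι := (s.1 : Multiset ι).toList

variable {F} in
theorem Monomial.length_toList {n : ℕ} (s : F.Monomial n) : s.toList.length = n := by
  rw [Monomial.toList, Multiset.length_toList]
  exact s.1.2

variable {F} in
theorem Monomial.perm_iff {n : ℕ} {s t : F.Monomial n} : s.toList.Perm t.toList ↔ s = t := by
  constructor
  · intro h
    have h1 := Multiset.coe_eq_coe.2 h
    rw [Monomial.toList, Monomial.toList, Multiset.coe_toList, Multiset.coe_toList] at h1
    exact Subtype.ext (Subtype.ext h1)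
  · rintro rfl
    exact List.Perm.refl _

theorem not_two_le_count_iff [DecidableEq ι] {i : ι} {l : List ι} :
    ¬ ({i, i} : Multiset ι) ≤ (l : Multiset ι) ↔ l.count i ≤ 1 := by
  rw [show ({i, i} : Multiset ι) = Multiset.replicate 2 i from rfl,
    ← Multiset.le_count_iff_replicate_le, Multiset.coe_count]
  omega

variable {F} in
theorem Monomial.count_le_one [DecidableEq ι] {n : ℕ} (s : F.Monomial n) {i : ι}
    (hi : F.p i = 1) : s.toList.count i ≤ 1 := by
  rw [← not_two_le_count_iff, Monomial.toList, Multiset.coe_toList]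
  exact s.2 i hi

theorem exists_monomial_perm [DecidableEq ι] (l : List ι) (h : ∀ i, F.p i = 1 → l.count i ≤ 1) :
    ∃ s : F.Monomial l.length, l.Perm s.toList := by
  refine ⟨⟨⟨(l : Multiset ι), Multiset.coe_card l⟩, fun i hi => not_two_le_count_iff.2 (h i hi)⟩, ?_⟩
  exact Multiset.coe_eq_coe.1 (Multiset.coe_toList (l : Multiset ι)).symm

theorem idealPow_le_span_monomial [CharZero k] (n : ℕ) : idealPow (1 : G.Points) n ≤
    Submodule.span k (Set.range fun s : F.Monomial n => F.funWord s.toList) ⊔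
      idealPow (1 : G.Points) (n + 1) := by
  classical
  refine (F.idealPow_le_span n).trans (sup_le_sup_right (Submodule.span_le.2 ?_) _)
  rintro _ ⟨l, rfl, rfl⟩
  by_cases h : ∀ i, F.p i = 1 → l.count i ≤ 1
  · obtain ⟨s, hs⟩ := F.exists_monomial_perm l h
    obtain ⟨c, hc⟩ := F.funWord_perm hs
    rw [hc]
    exact Submodule.smul_mem _ _ (Submodule.subset_span ⟨s, rfl⟩)
  · push Not at h
    obtain ⟨i, hi, h⟩ := h
    rw [F.funWord_eq_zero hi h]
    exact zero_mem _

/-! ### Pairing of words -/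

/-- The derivation of `𝒪(G)` given by a vector of the frame. -/
def act (i : ι) : A →ₗ[k] A := G.leftAct (G.lieInclusion (F.x i))

theorem act_f_mul (i l : ι) (a : A) : F.act i (F.f l * a) =
    F.act i (F.f l) * a + koszulSign k (F.p l) (F.p i) • (F.f l * F.act i a) := by
  rw [act, leftAct_mul (lieInclusion_mem _) (F.x_mem i), parityTwist_of_mem (F.f_mem l),
    smul_mul_assoc]

theorem act_mem (i : ι) {n : ℕ} {a : A} (ha : a ∈ idealPow (1 : G.Points) (n + 1)) :
    F.act i a ∈ idealPow (1 : G.Points) n :=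
  leftAct_mem_idealPow (lieInclusion_mem _) (F.x_mem i) ha

theorem act_f_self (i : ι) : F.act i (F.f i) - 1 ∈ idealPow (1 : G.Points) 1 := by
  have := sub_smul_mem_maxIdeal (1 : G.Points) (F.act i (F.f i))
  rwa [act, ev_one_leftAct, F.dual_self, one_smul, ← idealPow_one] at this

theorem act_f_of_ne {i l : ι} (h : i ≠ l) : F.act i (F.f l) ∈ idealPow (1 : G.Points) 1 := by
  have := sub_smul_mem_maxIdeal (1 : G.Points) (F.act i (F.f l))
  rwa [act, ev_one_leftAct, F.dual_ne i l h, zero_smul, sub_zero, ← idealPow_one] at this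

theorem act_f_self_mul (i : ι) {n : ℕ} {a : A} (ha : a ∈ idealPow (1 : G.Points) n) :
    F.act i (F.f i) * a - a ∈ idealPow (1 : G.Points) (n + 1) := by
  rw [← sub_one_mul]
  exact mul_mem_idealPow (F.act_f_self i) ha (add_comm _ _)

/-- By the Leibniz rule and duality, $x_i$ strikes out one factor $f_i$ up to terms of higher order.
No coefficients are recorded; this suffices for the off-diagonal entries and for odd indices. -/
theorem act_funWord_mem (i : ι) (l : List ι) : F.act i (F.funWord l) ∈
    Submodule.span k (F.funWord '' {l' | (i :: l').Perm l}) ⊔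
      idealPow (1 : G.Points) l.length := by
  induction l with
  | nil => exact Submodule.mem_sup_right Submodule.mem_top
  | cons j l ih =>
    rw [funWord_cons, act_f_mul]
    refine add_mem ?_ (Submodule.smul_mem _ _ ?_)
    · by_cases h : i = j
      · subst h
        rw [← add_sub_cancel (F.funWord l) (F.act i (F.f i) * _)]
        exact Submodule.add_mem_sup (Submodule.subset_span ⟨l, List.Perm.refl _, rfl⟩)
          (F.act_f_self_mul i (F.funWord_mem l))
      · exact Submodule.mem_sup_right
          (mul_mem_idealPow (F.act_f_of_ne h) (F.funWord_mem l) (add_comm _ _))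
    · obtain ⟨v, hv, w, hw, hvw⟩ := Submodule.mem_sup.1 ih
      rw [← hvw, mul_add]
      refine Submodule.add_mem_sup ?_
        (mul_mem_idealPow (F.f_mem_idealPow j) hw (add_comm _ _))
      have h1 := Submodule.mem_map_of_mem (f := LinearMap.mulLeft k (F.f j)) hv
      rw [Submodule.map_span] at h1
      refine Submodule.span_mono ?_ h1
      rintro _ ⟨_, ⟨l', hl', rfl⟩, rfl⟩
      refine ⟨j :: l', (List.Perm.swap _ _ _).trans (hl'.cons j), ?_⟩
      rw [funWord_cons]
      rfl

theorem f_mul_comm_of_even {i : ι} (hi : F.p i = 0) (l : ι) (a : A) :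
    F.f i * (F.f l * a) = F.f l * (F.f i * a) := by
  rw [← mul_assoc, G.supercomm _ _ _ (F.f_mem i) _ (F.f_mem l), hi, koszulSign_zero_left, one_smul,
    mul_assoc]

theorem f_mul_funWord_erase [DecidableEq ι] {i : ι} (hi : F.p i = 0) {l : List ι} (h : i ∈ l) :
    F.f i * F.funWord (l.erase i) = F.funWord l := by
  induction l with
  | nil => simp at h
  | cons j l ih =>
    by_cases hij : i = j
    · subst hij
      rw [List.erase_cons_head, funWord_cons]
    · have h1 : i ∈ l := by simpa [hij] using h
      rw [List.erase_cons_tail (by simpa using Ne.symm hij), funWord_cons, funWord_cons,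
        F.f_mul_comm_of_even hi, ih h1]

/-- For an even index the coefficient is the multiplicity, as for $\partial/\partial f_i$ on
polynomials; it is the source of the characteristic zero condition on the diagonal. -/
theorem act_funWord_of_even [DecidableEq ι] {i : ι} (hi : F.p i = 0) (l : List ι) :
    F.act i (F.funWord l) - (l.count i : k) • F.funWord (l.erase i) ∈
      idealPow (1 : G.Points) l.length := by
  induction l with
  | nil => exact Submodule.mem_top
  | cons j l ih =>
    rw [funWord_cons, act_f_mul, hi, koszulSign_zero_right, one_smul]
    have h1 := mul_mem_idealPow (m := l.length + 1) (F.f_mem_idealPow j) ih (add_comm _ _)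
    by_cases hij : i = j
    · subst hij
      rw [List.erase_cons_head, List.count_cons_self]
      have h2 : F.f i * (l.count i : k) • F.funWord (l.erase i) =
          (l.count i : k) • F.funWord l := by
        -- If `i` does not occur, the multiplicity is zero and the value of `erase` is irrelevant.
        by_cases h : i ∈ l
        · rw [mul_smul_comm, F.f_mul_funWord_erase hi h]
        · simp [List.count_eq_zero_of_not_mem h]
      rw [mul_sub, h2] at h1
      have h3 := add_mem (F.act_f_self_mul i (F.funWord_mem l)) h1
      refine (congrArg (· ∈ idealPow (1 : G.Points) (l.length + 1)) ?_).mp h3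
      rw [Nat.cast_add, Nat.cast_one, add_smul, one_smul]
      abel
    · rw [List.erase_cons_tail (by simpa using Ne.symm hij), List.count_cons_of_ne (Ne.symm hij),
        funWord_cons, add_sub_assoc]
      rw [mul_sub, mul_smul_comm] at h1
      exact add_mem (mul_mem_idealPow (F.act_f_of_ne hij) (F.funWord_mem l) (add_comm _ _)) h1

/-- The product, up to sign, of the vectors with indices in `l` as a functional. -/
def functional : List ι → Module.Dual k A
  | [] => ev (1 : G.Points)
  | i :: l => functional l ∘ₗ F.act i

theorem functional_cons (i : ι) (l : List ι) :
    F.functional (i :: l) = F.functional l ∘ₗ F.act i := rfl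

theorem functional_cons_uconv (i : ι) (l : List ι) :
    F.functional (i :: l) = G.uconv (G.lieInclusion (F.x i)) (F.functional l) := by
  rw [uconv_eq_comp_leftAct]; rfl

theorem functional_mem_dualGr (l : List ι) :
    ∃ p, F.functional l ∈ dualGr G.gr p := by
  induction l with
  | nil => exact ⟨0, Points.ev_mem _⟩
  | cons i l ih =>
    obtain ⟨p, hp⟩ := ih
    rw [functional_cons_uconv]
    exact ⟨_, uconv_grade _ _ _ _ (F.x_mem i) hp⟩

theorem functional_mem (l : List ι) :
    F.functional l ∈ distBelow (1 : G.Points) (l.length + 1) := by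
  rw [mem_distBelow]
  induction l with
  | nil =>
    intro a ha
    rw [List.length_nil, zero_add, idealPow_one] at ha
    exact ha
  | cons i l ih => exact fun a ha => ih _ (F.act_mem i ha)

/-- Each vector strikes out a function with its own index, and the error terms lie in a power of
$m_e$ that the remaining functional kills. A nonzero value would require the two lists to match. -/
theorem functional_funWord_of_not_perm {l l' : List ι} (h : l.length = l'.length)
    (hp : ¬ l.Perm l') : F.functional l (F.funWord l') = 0 := by
  induction l generalizing l' with
  | nil =>
    rw [List.length_nil, eq_comm, List.length_eq_zero_iff] at h
    exact absurd (h ▸ List.Perm.refl _) hp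
  | cons i l ih =>
    rw [functional_cons, LinearMap.comp_apply]
    have h1 : Submodule.span k (F.funWord '' {m | (i :: m).Perm l'}) ⊔
        idealPow (1 : G.Points) l'.length ≤ LinearMap.ker (F.functional l) := by
      refine sup_le (Submodule.span_le.2 ?_) fun a ha => ?_
      · rintro _ ⟨m, hm, rfl⟩
        refine ih ?_ fun hlm => hp ((hlm.cons i).trans hm)
        have := hm.length_eq
        rw [← h] at this
        simpa using this.symm
      · rw [← h] at ha
        exact mem_distBelow.1 (F.functional_mem l) a ha
    exact h1 (F.act_funWord_mem i l')

/-- The value is built up one index at a time. An even index contributes its multiplicity, nonzero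
in characteristic zero. An odd index does not recur in the tail, so the derivative of the tail has
higher order and only $x_i(f_i)=1$ contributes. -/
theorem functional_funWord_self [CharZero k] [DecidableEq ι] {l : List ι}
    (h : ∀ i, F.p i = 1 → l.count i ≤ 1) : F.functional l (F.funWord l) ≠ 0 := by
  induction l with
  | nil =>
    rw [functional, funWord_nil, ev_apply_one]
    exact one_ne_zero
  | cons i l ih =>
    have h1 := ih fun j hj => (List.count_le_count_cons).trans (h j hj)
    have h0 := mem_distBelow.1 (F.functional_mem l)
    rw [functional_cons, LinearMap.comp_apply]
    rcases zmod_two_cases (F.p i) with hi | hi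
    · have h2 := h0 _ (F.act_funWord_of_even hi (i :: l))
      rw [map_sub, map_smul, sub_eq_zero, List.erase_cons_head, List.count_cons_self] at h2
      rw [h2, smul_eq_mul]
      exact mul_ne_zero (Nat.cast_ne_zero.2 (Nat.succ_ne_zero _)) h1
    · have h2 : i ∉ l := by
        have := h i hi
        rw [List.count_cons_self] at this
        exact List.count_eq_zero.1 (by omega)
      have h3 := F.act_funWord_mem i l
      have h4 : {l' | (i :: l').Perm l} = ∅ := by
        ext l'
        simp only [Set.mem_ofPred_eq, Set.mem_empty_iff_false, iff_false]
        exact fun hl => h2 (hl.subset List.mem_cons_self)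
      rw [h4, Set.image_empty, Submodule.span_empty, bot_sup_eq] at h3
      have h5 := h0 _ (F.act_f_self_mul i (F.funWord_mem l))
      have h6 := h0 _ (mul_mem_idealPow (F.f_mem_idealPow i) h3 (add_comm _ _))
      rw [map_sub, sub_eq_zero] at h5
      rw [funWord_cons, act_f_mul, map_add, map_smul, h6, h5, smul_zero, add_zero]
      exact h1

end Frame

end AffineSupergroup

/-! ### The enveloping superalgebra and its generators. -/

namespace LieSuperalgebra

variable {k L : Type*} [Field k] [AddCommGroup L] [Module k L] (𝔤 : LieSuperalgebra k L)

theorem ι_mul_ι {i j : ZMod 2} {x y : L} (hx : x ∈ 𝔤.gr i) (hy : y ∈ 𝔤.gr j) :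
    𝔤.ι x * 𝔤.ι y = koszulSign k i j • (𝔤.ι y * 𝔤.ι x) + 𝔤.ι (𝔤.bracket x y) := by
  have h := RingQuot.mkAlgHom_rel k (EnvRel.comm (𝔤 := 𝔤) i j x y hx hy)
  rw [map_add, map_smul, map_mul, map_mul] at h
  exact h

theorem env_induction {P : Submodule k 𝔤.Env} (one : 1 ∈ P)
    (ι_mul : ∀ x, ∀ u ∈ P, 𝔤.ι x * u ∈ P) (u : 𝔤.Env) : u ∈ P := by
  have key : ∀ t : TensorAlgebra k L, ∀ u ∈ P, RingQuot.mkAlgHom k 𝔤.EnvRel t * u ∈ P := by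
    intro t
    induction t using TensorAlgebra.induction with
    | algebraMap r =>
      intro u hu
      rw [AlgHom.commutes, ← Algebra.smul_def]
      exact P.smul_mem r hu
    | ι x => exact ι_mul x
    | mul a b ha hb =>
      intro u hu
      rw [map_mul, mul_assoc]
      exact ha _ (hb _ hu)
    | add a b ha hb =>
      intro u hu
      rw [map_add, add_mul]
      exact add_mem (ha _ hu) (hb _ hu)
  obtain ⟨t, rfl⟩ := RingQuot.mkAlgHom_surjective k 𝔤.EnvRel u
  simpa using key t 1 one

end LieSuperalgebra

namespace AffineSupergroup

variable {k A : Type*} [Field k] [Ring A] [Algebra k A] {G : AffineSupergroup k A}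

theorem alpha_mul (u v : G.lie.Env) : G.alpha (u * v) = G.conv (G.alpha u) (G.alpha v) :=
  map_mul G.alphaHom u v

theorem alpha_one : G.alpha 1 = ev (1 : G.Points) := map_one G.alphaHom

theorem alpha_ι (X : G.Lie) : G.alpha (G.lie.ι X) = G.lieInclusion X := by
  refine Eq.trans (RingQuot.liftAlgHom_mkAlgHom_apply (B := G.ConvAlgebra) k _ _ _) ?_
  exact TensorAlgebra.lift_ι_apply (A := G.ConvAlgebra) _ _

namespace Frame

variable {ι : Type*} (F : Frame G ι)

/-! ### Words in the enveloping superalgebra -/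

/-- The product of the vectors with indices in `l`. -/
def word (l : List ι) : G.lie.Env := (l.map fun i => G.lie.ι (F.x i)).prod

theorem word_nil : F.word [] = 1 := rfl

theorem word_cons (i : ι) (l : List ι) : F.word (i :: l) = G.lie.ι (F.x i) * F.word l := by
  simp [word]

/-- Convolution of homogeneous functionals differs from the unsigned one by a sign only, so
nonvanishing of pairings can be read on `functional`. -/
theorem alpha_word (l : List ι) : ∃ c : k, c ≠ 0 ∧ G.alpha (F.word l) = c • F.functional l := by
  induction l with
  | nil => exact ⟨1, one_ne_zero, by rw [word_nil, alpha_one, one_smul]; rfl⟩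
  | cons i l ih =>
    obtain ⟨c, hc, h⟩ := ih
    obtain ⟨p, hp⟩ := F.functional_mem_dualGr l
    refine ⟨c * koszulSign k (F.p i) p, mul_ne_zero hc (koszulSign_ne_zero _ _), ?_⟩
    rw [word_cons, alpha_mul, alpha_ι, h, map_smul, conv_homogeneous (F.x_mem i) hp,
      functional_cons_uconv, mul_smul]

/-- The difference vanishes on $1$, on the $f_i$ and on $m_e^2$, which together span $A$. -/
theorem lie_eq_sum [Fintype ι] (X : G.Lie) : X = ∑ i, G.lieInclusion X (F.f i) • F.x i := by
  classical
  have h0 : G.lieInclusion (X - ∑ i, G.lieInclusion X (F.f i) • F.x i) = 0 := by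
    obtain ⟨h2, h1⟩ := mem_lieSpace_iff.1
      (lieInclusion_mem (X - ∑ i, G.lieInclusion X (F.f i) • F.x i))
    have hf : ∀ l, G.lieInclusion (X - ∑ i, G.lieInclusion X (F.f i) • F.x i) (F.f l) = 0 := by
      intro l
      rw [map_sub, map_sum, LinearMap.sub_apply, LinearMap.sum_apply, Finset.sum_eq_single l]
      · rw [map_smul, LinearMap.smul_apply, F.dual_self, smul_eq_mul, mul_one, sub_self]
      · intro i _ hi
        rw [map_smul, LinearMap.smul_apply, F.dual_ne i l hi, smul_zero]
      · simp
    have h3 : maxIdeal (1 : G.Points) ≤ LinearMap.ker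
        (G.lieInclusion (X - ∑ i, G.lieInclusion X (F.f i) • F.x i)) := by
      refine F.span.trans (sup_le (Submodule.span_le.2 ?_) h2)
      rintro _ ⟨l, rfl⟩
      exact hf l
    ext a
    have h4 := h3 (sub_smul_mem_maxIdeal (1 : G.Points) a)
    rw [LinearMap.mem_ker, map_sub, map_smul, h1, smul_zero, sub_zero] at h4
    rw [h4, LinearMap.zero_apply]
  exact sub_eq_zero.1 (G.lieInclusion_injective (h0.trans (map_zero _).symm))

/-- The elements of the enveloping superalgebra of filtration less than `n`. -/
def envBelow (n : ℕ) : Submodule k G.lie.Env := Submodule.span k (F.word '' {l | l.length < n})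

theorem word_mem {l : List ι} {n : ℕ} (h : l.length < n) : F.word l ∈ F.envBelow n :=
  Submodule.subset_span ⟨l, h, rfl⟩

theorem envBelow_zero : F.envBelow 0 = ⊥ := by simp [envBelow]

theorem envBelow_monotone : Monotone F.envBelow := fun _ _ h =>
  Submodule.span_mono (Set.image_mono fun _ hl => lt_of_lt_of_le hl h)

theorem ι_mul_mem [Finite ι] (X : G.Lie) {u : G.lie.Env} {n : ℕ} (hu : u ∈ F.envBelow n) :
    G.lie.ι X * u ∈ F.envBelow (n + 1) := by
  have := Fintype.ofFinite ι
  have h1 : ∀ i, G.lie.ι (F.x i) * u ∈ F.envBelow (n + 1) := fun i => by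
    have h := Submodule.mem_map_of_mem (f := LinearMap.mulLeft k (G.lie.ι (F.x i))) hu
    rw [envBelow, Submodule.map_span] at h
    refine Submodule.span_mono ?_ h
    rintro _ ⟨_, ⟨l, hl, rfl⟩, rfl⟩
    exact ⟨i :: l, by simpa using hl, F.word_cons i l⟩
  rw [F.lie_eq_sum X, map_sum, Finset.sum_mul]
  refine Submodule.sum_mem _ fun i _ => ?_
  rw [map_smul, smul_mul_assoc]
  exact Submodule.smul_mem _ _ (h1 i)

theorem exists_mem_envBelow [Finite ι] (u : G.lie.Env) : ∃ n, u ∈ F.envBelow n := by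
  have h : u ∈ ⨆ n, F.envBelow n := by
    refine G.lie.env_induction ?_ ?_ u
    · exact Submodule.mem_iSup_of_mem 1 (F.word_mem (l := []) Nat.zero_lt_one)
    · intro X u hu
      rw [Submodule.mem_iSup_of_directed _ F.envBelow_monotone.directed_le] at hu ⊢
      obtain ⟨n, hn⟩ := hu
      exact ⟨n + 1, F.ι_mul_mem X hn⟩
  rwa [Submodule.mem_iSup_of_directed _ F.envBelow_monotone.directed_le] at h

/-- Interchanging two neighbours costs a bracket, which lies in $\mathfrak g$ and leaves words
shorter by one. -/
theorem word_perm [Finite ι] {l l' : List ι} (h : l.Perm l') :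
    ∃ c : k, F.word l - c • F.word l' ∈ F.envBelow l.length := by
  induction h with
  | nil => exact ⟨1, by rw [one_smul, sub_self]; exact zero_mem _⟩
  | cons i _ ih =>
    obtain ⟨c, hc⟩ := ih
    refine ⟨c, ?_⟩
    rw [word_cons, word_cons, ← mul_smul_comm, ← mul_sub]
    exact F.ι_mul_mem _ hc
  | swap i j l =>
    refine ⟨koszulSign k (F.p j) (F.p i), ?_⟩
    simp only [word_cons]
    rw [← mul_assoc, G.lie.ι_mul_ι (F.x_mem j) (F.x_mem i), add_mul, smul_mul_assoc, mul_assoc,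
      add_sub_cancel_left]
    exact F.ι_mul_mem _ (F.word_mem (Nat.lt_succ_self _))
  | trans h h' ih ih' =>
    obtain ⟨c, hc⟩ := ih
    obtain ⟨d, hd⟩ := ih'
    refine ⟨c * d, ?_⟩
    rw [← h.length_eq] at hd
    have := add_mem hc (Submodule.smul_mem _ c hd)
    rwa [smul_sub, smul_smul, sub_add_sub_cancel] at this

/-- For odd $x$ the defining relation gives $x^2=\tfrac12[x,x]$, so a repeated odd index lowers the
filtration. -/
theorem word_mem_of_two_le_count [CharZero k] [Finite ι] [DecidableEq ι] {i : ι} {l : List ι}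
    (hi : F.p i = 1) (h : 2 ≤ l.count i) : F.word l ∈ F.envBelow l.length := by
  obtain ⟨l', hl⟩ := exists_perm_of_two_le_count h
  obtain ⟨c, hc⟩ := F.word_perm hl
  have h1 := G.lie.ι_mul_ι (F.x_mem i) (F.x_mem i)
  have h2 : G.lie.ι (F.x i) * G.lie.ι (F.x i) =
      (2⁻¹ : k) • G.lie.ι (G.lie.bracket (F.x i) (F.x i)) := by
    rw [hi, show koszulSign k 1 1 = -1 by simp [koszulSign]] at h1
    generalize G.lie.ι (F.x i) * G.lie.ι (F.x i) = a at h1 ⊢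
    have h3 : a + (-1 : k) • a = 0 := by
      nth_rewrite 1 [← one_smul k a]
      rw [← add_smul, add_neg_cancel, zero_smul]
    have h4 : (2 : k) • a = G.lie.ι (G.lie.bracket (F.x i) (F.x i)) := by
      rw [two_smul]
      nth_rewrite 2 [h1]
      rw [← add_assoc, h3, zero_add]
    rw [← h4, smul_smul, inv_mul_cancel₀ two_ne_zero, one_smul]
  have h3 : F.word (i :: i :: l') ∈ F.envBelow l.length := by
    rw [word_cons, word_cons, ← mul_assoc, h2, smul_mul_assoc, hl.length_eq]
    exact Submodule.smul_mem _ _ (F.ι_mul_mem _ (F.word_mem (Nat.lt_succ_self _)))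
  have := add_mem hc (Submodule.smul_mem _ c h3)
  rwa [sub_add_cancel] at this

/-- The spanning half of Poincaré–Birkhoff–Witt; independence comes from the pairing with monomials.
-/
theorem envBelow_succ_le [CharZero k] [Finite ι] (n : ℕ) : F.envBelow (n + 1) ≤
    Submodule.span k (Set.range fun s : F.Monomial n => F.word s.toList) ⊔ F.envBelow n := by
  classical
  rw [envBelow, Submodule.span_le]
  rintro _ ⟨l, hl, rfl⟩
  rcases Nat.lt_succ_iff_lt_or_eq.1 hl with hl | rfl
  · exact Submodule.mem_sup_right (F.word_mem hl)
  by_cases h : ∀ i, F.p i = 1 → l.count i ≤ 1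
  · obtain ⟨s, hs⟩ := F.exists_monomial_perm l h
    obtain ⟨c, hc⟩ := F.word_perm hs
    rw [← add_sub_cancel (c • F.word s.toList) (F.word l)]
    exact Submodule.add_mem_sup (Submodule.smul_mem _ _ (Submodule.subset_span ⟨s, rfl⟩)) hc
  · push Not at h
    obtain ⟨i, hi, h⟩ := h
    exact Submodule.mem_sup_right (F.word_mem_of_two_le_count hi h)

theorem alpha_mem_distBelow {n : ℕ} {u : G.lie.Env} (hu : u ∈ F.envBelow n) :
    G.alpha u ∈ distBelow (1 : G.Points) n := by
  have : F.envBelow n ≤ (distBelow (1 : G.Points) n).comap G.alpha := by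
    rw [envBelow, Submodule.span_le]
    rintro _ ⟨l, hl, rfl⟩
    obtain ⟨c, -, hc⟩ := F.alpha_word l
    change G.alpha (F.word l) ∈ distBelow (1 : G.Points) n
    rw [hc]
    exact Submodule.smul_mem _ _ (distBelow_monotone _ hl (F.functional_mem l))
  exact this hu

theorem alpha_word_funWord_self [CharZero k] {n : ℕ} (s : F.Monomial n) :
    G.alpha (F.word s.toList) (F.funWord s.toList) ≠ 0 := by
  classical
  obtain ⟨c, hc, h⟩ := F.alpha_word s.toList
  rw [h, LinearMap.smul_apply]
  exact mul_ne_zero hc (F.functional_funWord_self fun i hi => s.count_le_one hi)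

/-- The pairing matrix between words and monomials of the same degree is diagonal. -/
theorem alpha_sum_word_apply [CharZero k] {n : ℕ} [Fintype (F.Monomial n)] (c : F.Monomial n → k)
    (s : F.Monomial n) : G.alpha (∑ t, c t • F.word t.toList) (F.funWord s.toList) =
      c s * G.alpha (F.word s.toList) (F.funWord s.toList) := by
  rw [map_sum, LinearMap.sum_apply, Finset.sum_eq_single s]
  · rw [map_smul, LinearMap.smul_apply, smul_eq_mul]
  · intro t _ hts
    obtain ⟨d, -, h⟩ := F.alpha_word t.toList
    rw [map_smul, LinearMap.smul_apply, h, LinearMap.smul_apply,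
      F.functional_funWord_of_not_perm (by rw [Monomial.length_toList, Monomial.length_toList])
        (fun hp => hts (Monomial.perm_iff.1 hp)), smul_zero, smul_zero]
  · simp

/-- Evaluation on monomials of degree $n$ kills the lower filtration and isolates each top
coefficient. -/
theorem eq_zero_of_alpha_eq_zero [CharZero k] [Finite ι] {n : ℕ} {u : G.lie.Env}
    (hu : u ∈ F.envBelow n) (h : G.alpha u = 0) : u = 0 := by
  induction n generalizing u with
  | zero => rwa [envBelow_zero, Submodule.mem_bot] at hu
  | succ n ih =>
    have := Fintype.ofFinite (F.Monomial n)
    obtain ⟨v, hv, w, hw, rfl⟩ := Submodule.mem_sup.1 (F.envBelow_succ_le n hu)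
    obtain ⟨c, rfl⟩ := (Submodule.mem_span_range_iff_exists_fun k).1 hv
    have hc : ∀ s, c s = 0 := fun s => by
      have h1 := LinearMap.congr_fun h (F.funWord s.toList)
      have h2 := F.funWord_mem s.toList
      rw [s.length_toList] at h2
      rw [map_add, LinearMap.add_apply, alpha_sum_word_apply,
        mem_distBelow.1 (F.alpha_mem_distBelow hw) _ h2, add_zero, LinearMap.zero_apply] at h1
      exact (mul_eq_zero.1 h1).resolve_right (F.alpha_word_funWord_self s)
    simp only [hc, zero_smul, Finset.sum_const_zero, zero_add] at h ⊢
    exact ih hw h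

/-- The coefficients are chosen so that subtracting $\alpha(u)$ cancels the values of `φ` on the
monomials of degree $n$. The difference then vanishes on $m_e^n$. -/
theorem mem_range_alpha {ι : Type*} (F : Frame G ι) [CharZero k] [Finite ι] {n : ℕ} {φ : Module.Dual k A}
    (hφ : φ ∈ distBelow (1 : G.Points) n) : φ ∈ LinearMap.range G.alpha := by
  induction n generalizing φ with
  | zero =>
    rw [distBelow_zero, Submodule.mem_bot] at hφ
    exact hφ ▸ zero_mem _
  | succ n ih =>
    have := Fintype.ofFinite (F.Monomial n)
    let c : F.Monomial n → k := fun s => φ (F.funWord s.toList) /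
      G.alpha (F.word s.toList) (F.funWord s.toList)
    let u := ∑ s, c s • F.word s.toList
    have hu : u ∈ F.envBelow (n + 1) := Submodule.sum_mem _ fun s _ =>
      Submodule.smul_mem _ _ (F.word_mem (by rw [s.length_toList]; exact Nat.lt_succ_self n))
    have h1 : φ - G.alpha u ∈ distBelow (1 : G.Points) n := by
      have h2 := sub_mem hφ (F.alpha_mem_distBelow hu)
      rw [mem_distBelow] at h2 ⊢
      have h3 : idealPow (1 : G.Points) n ≤ LinearMap.ker (φ - G.alpha u) := by
        refine (F.idealPow_le_span_monomial n).trans (sup_le (Submodule.span_le.2 ?_) h2)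
        rintro _ ⟨s, rfl⟩
        change (φ - G.alpha u) _ = 0
        rw [LinearMap.sub_apply, F.alpha_sum_word_apply c s,
          div_mul_cancel₀ _ (F.alpha_word_funWord_self s), sub_self]
      exact h3
    rw [← sub_add_cancel φ (G.alpha u)]
    exact add_mem (ih h1) ⟨u, rfl⟩

end Frame

theorem alpha_injective [CharZero k] : Function.Injective G.alpha := by
  obtain ⟨ι, _, ⟨F⟩⟩ := exists_frame G
  rw [← LinearMap.ker_eq_bot, LinearMap.ker_eq_bot']
  intro u hu
  obtain ⟨n, hn⟩ := F.exists_mem_envBelow u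
  exact F.eq_zero_of_alpha_eq_zero hn hu

theorem range_alpha [CharZero k] : LinearMap.range G.alpha = distAt (1 : G.Points) := by
  obtain ⟨ι, _, ⟨F⟩⟩ := exists_frame G
  refine le_antisymm ?_ fun φ hφ => ?_
  · rintro _ ⟨u, rfl⟩
    obtain ⟨n, hn⟩ := F.exists_mem_envBelow u
    exact distBelow_le_distAt _ _ (F.alpha_mem_distBelow hn)
  · obtain ⟨n, hn⟩ := mem_distAt.1 hφ
    exact F.mem_range_alpha hn

end AffineSupergroup

namespace AffineSupergroup

variable {k A : Type*} [Field k] [Ring A] [Algebra k A] {G : AffineSupergroup k A}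

/-! ### The antipode and translations -/

/-- Coassociativity: both sides apply $X$ to the middle factor of the iterated coproduct. -/
theorem rTensor_rightAct_comul (X : Module.Dual k A) (a : A) :
    (G.rightAct X).rTensor A (G.comul a) = (G.leftAct X).lTensor A (G.comul a) := by
  have key : ∀ t : (A ⊗[k] A) ⊗[k] A,
      ((TensorProduct.rid k A).toLinearMap ∘ₗ X.lTensor A).rTensor A t =
      ((TensorProduct.lid k A).toLinearMap ∘ₗ X.rTensor A).lTensor A
        (TensorProduct.assoc k A A A t) := by
    intro t
    refine LinearMap.congr_fun (f := ((TensorProduct.rid k A).toLinearMap ∘ₗ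
      X.lTensor A).rTensor A) (g := ((TensorProduct.lid k A).toLinearMap ∘ₗ
      X.rTensor A).lTensor A ∘ₗ (TensorProduct.assoc k A A A).toLinearMap) ?_ t
    refine TensorProduct.ext_threefold fun a b c => ?_
    simp [TensorProduct.smul_tmul]
  have h := LinearMap.congr_fun G.coassoc a
  have h1 := key (G.comul.rTensor A (G.comul a))
  rw [show TensorProduct.assoc k A A A (G.comul.rTensor A (G.comul a)) =
    G.comul.lTensor A (G.comul a) from h] at h1
  rw [← LinearMap.rTensor_comp_apply, ← LinearMap.lTensor_comp_apply] at h1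
  exact h1

theorem leftAct_ev_apply_one (x : G.Points) : G.leftAct (ev x) 1 = 1 := by
  have h := G.comul_one
  rw [G.one_eq] at h
  simp [leftAct, h, ev_apply_one]

/-- Let $L$ and $R$ be the left and right translations by $x$. As $L$ is multiplicative,
`rTensor_rightAct_comul` shows that $L\circ i^*\circ R$ is a left convolution inverse of the
identity of $\mathcal O(G)$. The antipode is a right inverse, so the two coincide. -/
theorem leftAct_antipode_rightAct (x : G.Points) (a : A) :
    G.leftAct (ev x) (G.antipode (G.rightAct (ev x) a)) = G.antipode a := by
  let := G.toCoalgebra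
  let T : WithConv (A →ₗ[k] A) :=
    WithConv.toConv (G.leftAct (ev x) ∘ₗ G.antipode ∘ₗ G.rightAct (ev x))
  let I : WithConv (A →ₗ[k] A) := WithConv.toConv LinearMap.id
  let S : WithConv (A →ₗ[k] A) := WithConv.toConv G.antipode
  have hIS : I * S = 1 := by
    ext b
    have h := G.antipode_right b
    rw [lift_mul_eq, G.one_eq] at h
    exact h.trans (Algebra.algebraMap_eq_smul_one _).symm
  have hTI : T * I = 1 := by
    ext b
    have h := G.antipode_left b
    rw [lift_mul_eq, G.one_eq] at h
    have h1 : ∀ t : A ⊗[k] A, LinearMap.mul' k A (TensorProduct.map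
        (G.leftAct (ev x) ∘ₗ G.antipode) LinearMap.id ((G.leftAct (ev x)).lTensor A t)) =
        G.leftAct (ev x) (LinearMap.mul' k A (G.antipode.rTensor A t)) := by
      intro t
      induction t with
      | zero => simp
      | add s t hs ht => simp only [map_add, hs, ht]
      | tmul c d => simp [leftAct_ev_mul]
    have h2 : ∀ t : A ⊗[k] A, TensorProduct.map T.ofConv I.ofConv t = TensorProduct.map
        (G.leftAct (ev x) ∘ₗ G.antipode) LinearMap.id ((G.rightAct (ev x)).rTensor A t) := by
      intro t
      induction t with
      | zero => simp
      | add s t hs ht => simp only [map_add, hs, ht]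
      | tmul c d => rfl
    have h3 : LinearMap.mul' k A (TensorProduct.map T.ofConv I.ofConv (G.comul b)) =
        G.counit b • 1 := by
      rw [h2, rTensor_rightAct_comul, h1, h, map_smul, leftAct_ev_apply_one]
    exact h3.trans (Algebra.algebraMap_eq_smul_one _).symm
  exact LinearMap.congr_fun (congrArg WithConv.ofConv (left_inv_eq_right_inv hTI hIS)) a

theorem ev_conv_comp_antipode (x : G.Points) (φ : Module.Dual k A) :
    G.conv (ev x) φ ∘ₗ G.antipode = G.conv (φ ∘ₗ G.antipode) (ev x⁻¹) := by
  have h : φ ∘ₗ G.antipode = G.conv (G.conv (ev x) φ ∘ₗ G.antipode) (ev x) := by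
    rw [conv_ev, ev_conv]
    ext a
    exact congrArg φ (leftAct_antipode_rightAct x a).symm
  rw [h, conv_assoc, conv_ev_ev, mul_inv_cancel, conv_ev_one]

/-! ### Products of distributions -/

theorem ev_inv_conv_mem {x : G.Points} {φ : Module.Dual k A} (hφ : φ ∈ distAt x) :
    G.conv (ev x⁻¹) φ ∈ distAt (1 : G.Points) := by
  have := ev_conv_mem_distAt x⁻¹ hφ
  rwa [inv_mul_cancel] at this

theorem ev_conv_ev_inv_conv (x : G.Points) (φ : Module.Dual k A) :
    G.conv (ev x) (G.conv (ev x⁻¹) φ) = φ := by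
  rw [← conv_assoc, conv_ev_ev, mul_inv_cancel, ev_one_conv]

theorem ev_inv_conv_ev_conv (x : G.Points) (φ : Module.Dual k A) :
    G.conv (ev x⁻¹) (G.conv (ev x) φ) = φ := by
  rw [← conv_assoc, conv_ev_ev, inv_mul_cancel, ev_one_conv]

/-- Translating `φ` from the left and `ψ` from the right moves both to the unit, where the range of
$\alpha$ is a subalgebra. -/
theorem conv_mem_distAt [CharZero k] {x y : G.Points} {φ ψ : Module.Dual k A}
    (hφ : φ ∈ distAt x) (hψ : ψ ∈ distAt y) : G.conv φ ψ ∈ distAt (x * y) := by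
  have h1 := ev_inv_conv_mem hφ
  have h2 := conv_ev_mem_distAt y⁻¹ hψ
  rw [mul_inv_cancel] at h2
  rw [← range_alpha] at h1 h2
  obtain ⟨u, hu⟩ := h1
  obtain ⟨v, hv⟩ := h2
  have h3 : G.conv φ ψ = G.conv (G.conv (ev x) (G.alpha (u * v))) (ev y) := by
    rw [alpha_mul, hu, hv, ← conv_assoc (ev x), ev_conv_ev_inv_conv, conv_assoc, conv_assoc,
      conv_ev_ev, inv_mul_cancel, conv_ev_one]
  have h4 : G.alpha (u * v) ∈ distAt (1 : G.Points) := range_alpha (G := G) ▸ ⟨_, rfl⟩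
  have h5 := conv_ev_mem_distAt y (ev_conv_mem_distAt x h4)
  rwa [mul_one, ← h3] at h5

/-- The antipode identity $\sum S(\phi_1)\star\phi_2=\phi(1)\,\mathrm{ev}_e$ expresses
$S(\phi)\star\mathrm{ev}_x$ through antipodes of distributions of lower order. Translation by
$x^{-1}$ recovers $S(\phi)$. -/
theorem comp_antipode_mem_distAt [CharZero k] {x : G.Points} {φ : Module.Dual k A}
    (hφ : φ ∈ distAt x) : φ ∘ₗ G.antipode ∈ distAt x⁻¹ := by
  obtain ⟨n, hn⟩ := mem_distAt.1 hφ
  clear hφ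
  induction n generalizing φ with
  | zero =>
    rw [distBelow_zero, Submodule.mem_bot] at hn
    rw [hn, LinearMap.zero_comp]
    exact zero_mem _
  | succ n ih =>
    obtain ⟨t, ht⟩ := exists_reduced_comul hn
    have hJ : ∀ φ₁ φ₂ : Module.Dual k A,
        (superDualDistrib G.gr G.isInternal (φ₁ ⊗ₜ φ₂) ∘ₗ G.antipode.rTensor A) ∘ₗ G.comul =
          G.conv (φ₁ ∘ₗ G.antipode) φ₂ := by
      intro φ₁ φ₂
      have := G.superDualDistrib_map_dualMap (T' := LinearMap.id) G.antipode_mem (fun _ _ h => h)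
        (φ₁ ⊗ₜ φ₂)
      rw [TensorProduct.map_tmul] at this
      exact congrArg (· ∘ₗ G.comul) this.symm
    have h1 : (superDualDistrib G.gr G.isInternal (TensorProduct.map (distBelow x n).subtype
        (distBelow x (n + 1)).subtype t) ∘ₗ G.antipode.rTensor A) ∘ₗ G.comul ∈
          distAt (1 : G.Points) := by
      clear ht
      induction t with
      | zero => simp
      | add s t hs ht => simp only [map_add, LinearMap.add_comp]; exact add_mem hs ht
      | tmul u v =>
        rw [TensorProduct.map_tmul, hJ]
        have := conv_mem_distAt (ih u.2) (distBelow_le_distAt _ _ v.2)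
        rwa [inv_mul_cancel] at this
    have h2 : ((φ ∘ₗ LinearMap.mul' k A) ∘ₗ G.antipode.rTensor A) ∘ₗ G.comul =
        φ 1 • ev (1 : G.Points) := by
      ext a
      have h := G.antipode_left a
      rw [lift_mul_eq, G.one_eq] at h
      simp only [LinearMap.comp_apply, LinearMap.smul_apply, h, map_smul, smul_eq_mul]
      exact mul_comm _ _
    rw [← ht, LinearMap.add_comp, LinearMap.add_comp, hJ] at h2
    have h3 : G.conv (φ ∘ₗ G.antipode) (ev x) ∈ distAt (1 : G.Points) := by
      rw [eq_sub_of_add_eq h2]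
      exact sub_mem (Submodule.smul_mem _ _ (ev_mem_distAt _)) h1
    have h4 := conv_ev_mem_distAt x⁻¹ h3
    rwa [conv_assoc, conv_ev_ev, mul_inv_cancel, conv_ev_one, one_mul] at h4

theorem exists_comul_mem {R : Submodule k (Module.Dual k A)} {x : G.Points} (hR : distAt x ≤ R)
    {φ : Module.Dual k A} (hφ : φ ∈ distAt x) : ∃ t : R ⊗[k] R,
      superDualDistrib G.gr G.isInternal (TensorProduct.map R.subtype R.subtype t) =
        φ ∘ₗ LinearMap.mul' k A := by
  obtain ⟨n, hn⟩ := mem_distAt.1 hφ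
  obtain ⟨t, ht⟩ := exists_comul_of_mem_distBelow hn
  let i := Submodule.inclusion ((distBelow_le_distAt x n).trans hR)
  refine ⟨TensorProduct.map i i t, ?_⟩
  rw [← ht, ← LinearMap.comp_apply (TensorProduct.map R.subtype R.subtype),
    ← TensorProduct.map_comp]
  rfl

theorem isHopfSubspace_distAt_one [CharZero k] : G.IsHopfSubspace (distAt (1 : G.Points)) where
  conv_mem φ hφ ψ hψ := by
    have := conv_mem_distAt hφ hψ
    rwa [one_mul] at this
  ev_one_mem := ev_mem_distAt _
  proj_mem i φ hφ := proj_mem_distAt hφ i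
  antipode_mem φ hφ := by
    have := comp_antipode_mem_distAt hφ
    rwa [inv_one] at this
  comul_mem φ hφ := exists_comul_mem le_rfl hφ

theorem distAt_le_dist (x : G.Points) : distAt x ≤ G.dist := le_iSup (distAt (G := G)) x

theorem dist_le {P : Submodule k (Module.Dual k A)} (h : ∀ x : G.Points, distAt x ≤ P) :
    G.dist ≤ P := iSup_le h

theorem isHopfSubspace_dist [CharZero k] : G.IsHopfSubspace G.dist where
  conv_mem φ hφ ψ hψ := by
    have h1 : ∀ x : G.Points, ∀ φ ∈ distAt x, ∀ ψ ∈ G.dist, G.conv φ ψ ∈ G.dist := by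
      intro x φ hφ ψ hψ
      exact dist_le (P := G.dist.comap (G.conv φ))
        (fun y ψ hψ => distAt_le_dist _ (conv_mem_distAt hφ hψ)) hψ
    exact dist_le (P := G.dist.comap (G.conv.flip ψ)) (fun x φ hφ => h1 x φ hφ ψ hψ) hφ
  ev_one_mem := distAt_le_dist _ (ev_mem_distAt _)
  proj_mem i φ hφ := dist_le (P := G.dist.comap (superProj G.gr G.isInternal i).dualMap)
    (fun _ _ hφ => distAt_le_dist _ (proj_mem_distAt hφ i)) hφ
  antipode_mem φ hφ := dist_le (P := G.dist.comap G.antipode.dualMap)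
    (fun _ _ hφ => distAt_le_dist _ (comp_antipode_mem_distAt hφ)) hφ
  comul_mem φ hφ := by
    -- Having a coproduct in $D(G)\otimes D(G)$ is a linear condition on `φ`, so it can be checked
    -- on each $D(G,x)$.
    have := dist_le (P := (LinearMap.range (superDualDistrib G.gr G.isInternal ∘ₗ
      TensorProduct.map G.dist.subtype G.dist.subtype)).comap (LinearMap.mul' k A).dualMap)
      (fun x φ hφ => exists_comul_mem (distAt_le_dist x) hφ) hφ
    exact this

/-! ### Distributions at different points -/

/-- Even functions act on $\mathcal O(G)^*$ by commuting operators, the transposes of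
multiplication. On $D(G,x)$ the operator of $a$ minus $a(x)$ is locally nilpotent, since it lowers
the order. Points are separated by even functions because they vanish on odd ones. -/
theorem iSupIndep_distAt : iSupIndep fun x : G.Points => distAt x := by
  let T : G.gr 0 → Module.End k (Module.Dual k A) := fun a => (LinearMap.mulLeft k (a : A)).dualMap
  have hcomm : ∀ a b, Commute (T a) (T b) := by
    intro a b
    refine LinearMap.ext fun φ => LinearMap.ext fun c => ?_
    change φ (b * (a * c)) = φ (a * (b * c))
    rw [← mul_assoc, G.supercomm 0 0 _ b.2 _ a.2, koszulSign_zero_left, one_smul, mul_assoc]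
  have h1 := Module.End.independent_iInf_maxGenEigenspace_of_forall_mapsTo T
    fun a b μ => Module.End.mapsTo_maxGenEigenspace_of_comm (hcomm b a) μ
  let χ : G.Points → G.gr 0 → k := fun x a => ev x a
  have hχ : Function.Injective χ := by
    intro x y hxy
    refine Points.ext fun a => ?_
    have h2 := congrFun hxy ⟨superProj G.gr G.isInternal 0 a, superProj_mem _ _ _ _⟩
    simp only [χ, ev_apply_proj, if_true] at h2
    exact h2
  refine (h1.comp hχ).mono fun x φ hφ => ?_
  obtain ⟨n, hn⟩ := mem_distAt.1 hφ
  refine (Submodule.mem_iInf _).2 fun a => (Module.End.mem_maxGenEigenspace _ _ _).2 ⟨n, ?_⟩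
  clear hφ
  induction n generalizing φ with
  | zero =>
    rw [distBelow_zero, Submodule.mem_bot] at hn
    rw [hn, map_zero]
  | succ n ih =>
    rw [pow_succ]
    refine ih (φ := (T a - ev x a • 1) φ) ?_
    rw [mem_distBelow] at hn ⊢
    intro b hb
    have h3 : (T a - ev x a • 1) φ b = φ ((a - ev x a • 1) * b) := by
      rw [sub_mul, smul_mul_assoc, one_mul, map_sub, map_smul]
      rfl
    rw [h3]
    exact hn _ (Submodule.mul_mem_mul (sub_smul_mem_maxIdeal x _) hb)

/-! ### The space `k|G| ⊗ U(𝔤)` as a space of distributions -/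

variable (G) in
/-- The linear map with `g ↦ ev_g` on the group algebra. -/
def evLinear : MonoidAlgebra k G.Points →ₗ[k] Module.Dual k A :=
  Finsupp.linearCombination k (fun g : G.Points => ev g) ∘ₗ
    (MonoidAlgebra.coeffLinearEquiv k).toLinearMap

theorem evLinear_single (g : G.Points) : G.evLinear (MonoidAlgebra.single g 1) = ev g := by
  simp [evLinear]

variable (G) in
/-- The linear map `g ⊗ X ↦ ev_g ⋆ α(X)`. -/
def smashMap : MonoidAlgebra k G.Points ⊗[k] G.lie.Env →ₗ[k] Module.Dual k A :=
  TensorProduct.lift (G.conv.compl₁₂ G.evLinear G.alpha)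

theorem smashMap_tmul (g : G.Points) (X : G.lie.Env) :
    G.smashMap (MonoidAlgebra.single g 1 ⊗ₜ X) = G.conv (ev g) (G.alpha X) := by
  simp [smashMap, evLinear_single]

theorem alpha_mem_distAt [CharZero k] (X : G.lie.Env) : G.alpha X ∈ distAt (1 : G.Points) :=
  range_alpha (G := G) ▸ ⟨X, rfl⟩

theorem ev_conv_alpha_mem [CharZero k] (g : G.Points) (X : G.lie.Env) :
    G.conv (ev g) (G.alpha X) ∈ distAt g := by
  have := ev_conv_mem_distAt g (alpha_mem_distAt X)
  rwa [mul_one] at this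

theorem range_smashMap [CharZero k] : LinearMap.range G.smashMap = G.dist := by
  refine le_antisymm ?_ (dist_le fun g φ hφ => ?_)
  · rintro _ ⟨w, rfl⟩
    induction w with
    | zero => rw [map_zero]; exact zero_mem _
    | add s t hs ht => rw [map_add]; exact add_mem hs ht
    | tmul a X =>
      induction a using MonoidAlgebra.induction_on with
      | of g => exact smashMap_tmul g X ▸ distAt_le_dist g (ev_conv_alpha_mem g X)
      | add x y hx hy => rw [TensorProduct.add_tmul, map_add]; exact add_mem hx hy
      | smul r x hx => rw [← TensorProduct.smul_tmul', map_smul]; exact Submodule.smul_mem _ r hx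
  · have h1 := ev_inv_conv_mem hφ
    rw [← range_alpha] at h1
    obtain ⟨X, hX⟩ := h1
    exact ⟨MonoidAlgebra.single g 1 ⊗ₜ X, by rw [smashMap_tmul, hX, ev_conv_ev_inv_conv]⟩

/-- Every tensor is a sum $\sum g\otimes X_g$, whose image has its $g$-term in $D(G,g)$. By
independence each $\mathrm{ev}_g\star\alpha(X_g)$ is zero; translating back and using the
injectivity of $\alpha$ gives $X_g=0$. -/
theorem smashMap_injective [CharZero k] : Function.Injective G.smashMap := by
  classical
  let Θ : (G.Points →₀ G.lie.Env) →ₗ[k] MonoidAlgebra k G.Points ⊗[k] G.lie.Env :=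
    Finsupp.lsum k fun g => TensorProduct.mk k _ _ (MonoidAlgebra.single g 1)
  have hΘ : Function.Surjective Θ := by
    rw [← LinearMap.range_eq_top, eq_top_iff]
    rintro w -
    induction w with
    | zero => exact zero_mem _
    | add s t hs ht => exact add_mem hs ht
    | tmul a X =>
      induction a using MonoidAlgebra.induction_on with
      | of g => exact ⟨Finsupp.single g X, by simp [Θ]⟩
      | add x y hx hy => rw [TensorProduct.add_tmul]; exact add_mem hx hy
      | smul r x hx => rw [← TensorProduct.smul_tmul']; exact Submodule.smul_mem _ r hx
  rw [← LinearMap.ker_eq_bot, LinearMap.ker_eq_bot']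
  intro w hw
  obtain ⟨F, rfl⟩ := hΘ w
  have h1 : ∑ g ∈ F.support, G.conv (ev g) (G.alpha (F g)) = 0 := by
    rw [← hw]
    simp only [Θ, Finsupp.lsum_apply, Finsupp.sum, map_sum, TensorProduct.mk_apply, smashMap_tmul]
  have h2 := (iSupIndep_iff_finsetSum_eq_zero_imp_eq_zero (fun g : G.Points => distAt g)).1
    iSupIndep_distAt F.support _ (fun g _ => ev_conv_alpha_mem g (F g)) h1
  have h3 : F = 0 := by
    ext g
    by_cases hg : g ∈ F.support
    · refine alpha_injective (G := G) ?_
      rw [Finsupp.zero_apply, map_zero, ← ev_inv_conv_ev_conv g (G.alpha (F g)), h2 g hg, map_zero]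
    · exact Finsupp.notMem_support_iff.1 hg
  rw [h3, map_zero]

end AffineSupergroup

namespace AffineSupergroup

variable {k A : Type*} [Field k] [Ring A] [Algebra k A] {G : AffineSupergroup k A}

/-! ### The Hopf superalgebra structures -/

theorem IsDualHopf.isDistributionHopf {D : HopfSuperalgebra k G.Dist}
    (h : G.IsDualHopf G.distInclusion D) : G.IsDistributionHopf D where
  gr_eq := h.gr_eq
  mul_eq := h.mul_eq
  one_eq := h.one_eq
  comul_eq φ f g := LinearMap.congr_fun (h.comul_eq φ) (f ⊗ₜ g)
  counit_eq := h.counit_eq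
  antipode_eq φ := LinearMap.congr_fun (h.antipode_eq φ)

theorem superDualDistrib_primitive (X : Module.Dual k A) (a b : A) :
    superDualDistrib G.gr G.isInternal (X ⊗ₜ ev (1 : G.Points) + ev (1 : G.Points) ⊗ₜ X)
      (a ⊗ₜ b) = X a * G.counit b + G.counit a * X b := by
  rw [map_add, LinearMap.add_apply, superDualDistrib_tmul_ev, superDualDistrib_ev_tmul]
  rfl

/-- Primitivity of $x\in\mathfrak g$ is the Leibniz rule at the unit, `mem_lieSpace`, in dual form.
-/
theorem IsDualHopf.isNaturalHopf [CharZero k] {U : HopfSuperalgebra k G.lie.Env}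
    (h : G.IsDualHopf G.alpha U) : G.lie.IsNaturalHopf U where
  mul_eq a b := alpha_injective (by rw [h.mul_eq, alpha_mul])
  one_eq := alpha_injective (by rw [h.one_eq, alpha_one])
  ι_mem i x hx := by
    rw [h.gr_eq, Submodule.mem_comap, alpha_ι]
    exact hx
  comul_ι x := G.superDualDistrib_map_injective alpha_injective (by
    rw [LinearMap.comp_apply, LinearMap.comp_apply, h.comul_eq, map_add, TensorProduct.map_tmul,
      TensorProduct.map_tmul, alpha_ι, alpha_one]
    refine TensorProduct.ext' fun a b => ?_
    rw [superDualDistrib_primitive]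
    exact mem_lieSpace.1 (lieInclusion_mem x) a b)

theorem leftAct_ev_mem (x : G.Points) (i : ZMod 2) (a : A) (ha : a ∈ G.gr i) :
    G.leftAct (ev x) a ∈ G.gr i := by
  obtain ⟨I, _, y, z, p, hy, hz, h⟩ := exists_sum_of_mem_superTensorGr _ (G.comul_mem i a ha)
  simp only [leftAct, LinearMap.comp_apply, h, map_sum, LinearMap.rTensor_tmul,
    LinearEquiv.coe_coe, TensorProduct.lid_tmul]
  refine Submodule.sum_mem _ fun l _ => ?_
  rcases zmod_two_cases (p l) with hp | hp
  · have h1 := hz l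
    rw [hp, sub_zero] at h1
    exact Submodule.smul_mem _ _ h1
  · have h1 : ev x (y l) = 0 := x.2 _ (hp ▸ hy l)
    rw [h1, zero_smul]
    exact zero_mem _

/-- Translation by $g$ is an algebra morphism, so its transpose commutes with coproducts:
$\mathrm{ev}_g$ acts as a grouplike element. -/
theorem smashMap_tmul_comul [CharZero k] {U : HopfSuperalgebra k G.lie.Env}
    {H : HopfSuperalgebra k (MonoidAlgebra k G.Points ⊗[k] G.lie.Env)}
    (hU : G.IsDualHopf G.alpha U) (hH : G.IsDualHopf G.smashMap H)
    (a : MonoidAlgebra k G.Points) (X : G.lie.Env) : H.comul (a ⊗ₜ[k] X) =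
      TensorProduct.tensorTensorTensorComm k (MonoidAlgebra k G.Points)
        (MonoidAlgebra k G.Points) G.lie.Env G.lie.Env
        (Coalgebra.comul a ⊗ₜ[k] U.comul X) := by
  induction a using MonoidAlgebra.induction_on with
  | add x y hx hy => simp only [TensorProduct.add_tmul, map_add, hx, hy]
  | smul r x hx => simp only [← TensorProduct.smul_tmul', map_smul, hx]
  | of g =>
    refine G.superDualDistrib_map_injective smashMap_injective ?_
    rw [LinearMap.comp_apply, LinearMap.comp_apply, hH.comul_eq, MonoidAlgebra.of_apply,
      smashMap_tmul, ev_conv, MonoidAlgebra.comul_single]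
    have h1 : ∀ t : G.lie.Env ⊗[k] G.lie.Env, TensorProduct.map G.smashMap G.smashMap
        (TensorProduct.tensorTensorTensorComm k _ _ _ _ (((MonoidAlgebra.single g (1 : k)) ⊗ₜ[k]
          (MonoidAlgebra.single g (1 : k))) ⊗ₜ[k] t)) =
        TensorProduct.map (G.leftAct (ev g)).dualMap (G.leftAct (ev g)).dualMap
          (TensorProduct.map G.alpha G.alpha t) := by
      intro t
      induction t with
      | zero => simp
      | add s t hs ht => simp only [TensorProduct.tmul_add, map_add, hs, ht]
      | tmul u v =>
        simp only [TensorProduct.tensorTensorTensorComm_tmul, TensorProduct.map_tmul,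
          smashMap_tmul, ev_conv]
        rfl
    have h2 : TensorProduct.map (MonoidAlgebra.lsingle g) (MonoidAlgebra.lsingle g)
        (Coalgebra.comul (R := k) (1 : k)) = (MonoidAlgebra.single g (1 : k)) ⊗ₜ[k]
          (MonoidAlgebra.single g (1 : k)) := by
      simp
    rw [h2, h1, G.superDualDistrib_map_dualMap (leftAct_ev_mem g) (leftAct_ev_mem g),
      hU.comul_eq]
    refine TensorProduct.ext' fun a b => ?_
    exact congrArg (G.alpha X) (leftAct_ev_mul g a b)

/-- The evenness of $\mathrm{ev}_g$ gives one inclusion for both parities. The two ranges together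
span the tensor product, and the parts of `H` meet in zero, so the inclusions are equalities. -/
theorem smashMap_gr [CharZero k] {U : HopfSuperalgebra k G.lie.Env}
    {H : HopfSuperalgebra k (MonoidAlgebra k G.Points ⊗[k] G.lie.Env)}
    (hU : G.IsDualHopf G.alpha U) (hH : G.IsDualHopf G.smashMap H) (i : ZMod 2) :
    H.gr i = LinearMap.range
      (LinearMap.lTensor (MonoidAlgebra k G.Points) (U.gr i).subtype) := by
  have h1 : ∀ i, LinearMap.range (LinearMap.lTensor (MonoidAlgebra k G.Points)
      (U.gr i).subtype) ≤ H.gr i := by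
    rintro i _ ⟨w, rfl⟩
    induction w with
    | zero => rw [map_zero]; exact zero_mem _
    | add s t hs ht => rw [map_add]; exact add_mem hs ht
    | tmul a X =>
      induction a using MonoidAlgebra.induction_on with
      | add x y hx hy => rw [TensorProduct.add_tmul, map_add]; exact add_mem hx hy
      | smul r x hx => rw [← TensorProduct.smul_tmul', map_smul]; exact Submodule.smul_mem _ r hx
      | of g =>
        have h2 : G.alpha X ∈ dualGr G.gr i := (hU.gr_eq i).le X.2
        rw [hH.gr_eq, Submodule.mem_comap, LinearMap.lTensor_tmul, MonoidAlgebra.of_apply,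
          smashMap_tmul]
        have h3 := conv_mem g.ev_mem h2
        rwa [zero_add] at h3
  refine le_antisymm (fun w hw => ?_) (h1 i)
  have h2 : ∀ w : MonoidAlgebra k G.Points ⊗[k] G.lie.Env, w ∈ LinearMap.range
      (LinearMap.lTensor (MonoidAlgebra k G.Points) (U.gr i).subtype) ⊔ LinearMap.range
      (LinearMap.lTensor (MonoidAlgebra k G.Points) (U.gr (i + 1)).subtype) := by
    intro w
    induction w with
    | zero => exact zero_mem _
    | add s t hs ht => exact add_mem hs ht
    | tmul a X =>
      have h3 : superProj U.gr U.isInternal i X + superProj U.gr U.isInternal (i + 1) X = X := by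
        rcases zmod_two_cases i with rfl | rfl
        · exact superProj_add _ _ _
        · rw [add_comm]; exact superProj_add _ _ _
      rw [← h3, TensorProduct.tmul_add]
      exact Submodule.add_mem_sup
        ⟨a ⊗ₜ ⟨_, superProj_mem U.gr U.isInternal i X⟩, LinearMap.lTensor_tmul _ _ _ _⟩
        ⟨a ⊗ₜ ⟨_, superProj_mem U.gr U.isInternal (i + 1) X⟩, LinearMap.lTensor_tmul _ _ _ _⟩
  obtain ⟨u, hu, v, hv, rfl⟩ := Submodule.mem_sup.1 (h2 w)
  have h3 := superProj_of_mem H.gr H.isInternal hw i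
  rw [map_add, superProj_of_mem H.gr H.isInternal (h1 _ hu),
    superProj_of_mem H.gr H.isInternal (h1 _ hv), if_pos rfl, if_pos rfl,
    if_neg (by clear * -; revert i; decide), add_zero] at h3
  rwa [← h3]

end AffineSupergroup

/-! ### The main theorem. -/

theorem mainTheorem5 {k A : Type*} [Field k] [CharZero k] [Ring A] [Algebra k A]
    (G : AffineSupergroup k A) :
    -- `α` identifies `U(𝔤)` with `D(G, e)`
    Function.Injective G.alpha ∧
    LinearMap.range G.alpha = AffineSupergroup.distAt (1 : G.Points) ∧
    ∃ (Ψ : G.Dist ≃ₗ[k] MonoidAlgebra k G.Points ⊗[k] G.lie.Env)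
      (D : HopfSuperalgebra k G.Dist)
      (U : HopfSuperalgebra k G.lie.Env)
      (H : HopfSuperalgebra k (MonoidAlgebra k G.Points ⊗[k] G.lie.Env)),
      -- `Ψ` maps `φ_g` to `g ⊗ φ_e`, where `φ_e = ev_{g⁻¹} ⋆ φ_g`
      (∀ (g : G.Points) (φ : G.Dist), G.distInclusion φ ∈ AffineSupergroup.distAt g →
        ∃ u : G.lie.Env, G.alpha u = G.conv (AffineSupergroup.ev g⁻¹) (G.distInclusion φ) ∧
          Ψ φ = MonoidAlgebra.single g (1 : k) ⊗ₜ[k] u) ∧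
      -- the Hopf superalgebra `D(G)`, transported by `Ψ`, is `H`
      G.IsDistributionHopf D ∧
      HopfSuperalgebra.IsIso D H Ψ ∧
      -- the coalgebra, the grading, the unit and the antipode of `H` come from the natural
      -- Hopf structures of `k|G|` and of `U(𝔤)`
      G.lie.IsNaturalHopf U ∧
      (∀ i, H.gr i = LinearMap.range
        (LinearMap.lTensor (MonoidAlgebra k G.Points) (U.gr i).subtype)) ∧
      H.one = 1 ⊗ₜ[k] 1 ∧
      (∀ a X, H.comul (a ⊗ₜ[k] X) =
        TensorProduct.tensorTensorTensorComm k (MonoidAlgebra k G.Points)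
          (MonoidAlgebra k G.Points) G.lie.Env G.lie.Env
          (Coalgebra.comul a ⊗ₜ[k] U.comul X)) ∧
      (∀ a X, H.counit (a ⊗ₜ[k] X) = Coalgebra.counit (R := k) a * U.counit X) ∧
      (∀ a X, H.antipode (a ⊗ₜ[k] X) =
        H.mul (1 ⊗ₜ[k] U.antipode X) (HopfAlgebra.antipode k a ⊗ₜ[k] 1)) ∧
      -- `(g ⊗ X) (h ⊗ Y) = g h ⊗ (h⁻¹ X) Y`, where `h⁻¹ X = ev_{h⁻¹} ⋆ X ⋆ ev_h`
      (∀ (g h : G.Points) (X Y : G.lie.Env),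
        ∃ Z : G.lie.Env,
          G.alpha Z = G.conv (G.conv (AffineSupergroup.ev h⁻¹) (G.alpha X))
            (AffineSupergroup.ev h) ∧
          H.mul (MonoidAlgebra.single g (1 : k) ⊗ₜ[k] X) (MonoidAlgebra.single h (1 : k) ⊗ₜ[k] Y) =
            MonoidAlgebra.single (g * h) (1 : k) ⊗ₜ[k] (Z * Y)) := by
  open AffineSupergroup in
  refine ⟨alpha_injective, range_alpha, ?_⟩
  have hj : Function.Injective G.distInclusion := G.dist.subtype_injective
  obtain ⟨D, hD⟩ := (isHopfSubspace_dist (G := G)).exists_isDualHopf hj G.dist.range_subtype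
  obtain ⟨U, hU⟩ := (isHopfSubspace_distAt_one (G := G)).exists_isDualHopf alpha_injective
    range_alpha
  obtain ⟨H, hH⟩ := (isHopfSubspace_dist (G := G)).exists_isDualHopf smashMap_injective
    range_smashMap
  have hrange : ∀ φ, G.distInclusion φ ∈ LinearMap.range G.smashMap := fun φ =>
    range_smashMap (G := G) ▸ φ.2
  have hspec := factorThrough_apply G.smashMap smashMap_injective G.distInclusion hrange
  -- The map is the inclusion of $D(G)$ followed by the inverse of `smashMap` on their common image.
  let Ψ : G.Dist ≃ₗ[k] MonoidAlgebra k G.Points ⊗[k] G.lie.Env := LinearEquiv.ofBijective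
    (factorThrough G.smashMap smashMap_injective G.distInclusion hrange)
    ⟨fun φ ψ h => hj (by rw [← hspec, h, hspec]), fun w =>
      ⟨⟨G.smashMap w, range_smashMap (G := G) ▸ ⟨w, rfl⟩⟩, smashMap_injective (hspec _)⟩⟩
  have hΨ : ∀ φ, G.smashMap (Ψ φ) = G.distInclusion φ := hspec
  have h1 : (1 : MonoidAlgebra k G.Points) = MonoidAlgebra.single 1 1 := rfl
  refine ⟨Ψ, D, U, H, ?_, hD.isDistributionHopf, hD.isIso hH smashMap_injective Ψ hΨ,
    hU.isNaturalHopf, smashMap_gr hU hH, ?_, smashMap_tmul_comul hU hH, ?_, ?_, ?_⟩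
  · intro g φ hφ
    have h2 := ev_inv_conv_mem hφ
    rw [← range_alpha] at h2
    obtain ⟨u, hu⟩ := h2
    refine ⟨u, hu, smashMap_injective ?_⟩
    rw [hΨ, smashMap_tmul, hu, ev_conv_ev_inv_conv]
  · refine smashMap_injective ?_
    rw [hH.one_eq, h1, smashMap_tmul, alpha_one, conv_ev_one]
  · intro a X
    induction a using MonoidAlgebra.induction_on with
    | add x y hx hy => simp only [TensorProduct.add_tmul, map_add, hx, hy, add_mul]
    | smul r x hx => simp only [← TensorProduct.smul_tmul', map_smul, hx, smul_eq_mul, mul_assoc]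
    | of g =>
      rw [hH.counit_eq, hU.counit_eq, MonoidAlgebra.of_apply, smashMap_tmul, ev_conv,
        LinearMap.comp_apply, leftAct_ev_apply_one]
      simp
  · intro a X
    induction a using MonoidAlgebra.induction_on with
    | add x y hx hy => simp only [TensorProduct.add_tmul, map_add, hx, hy]
    | smul r x hx => simp only [← TensorProduct.smul_tmul', map_smul, hx]
    | of g =>
      -- Both sides correspond to $S(\alpha(X))\star\mathrm{ev}_{g^{-1}}$.
      refine smashMap_injective ?_
      rw [hH.antipode_eq, hH.mul_eq, MonoidAlgebra.of_apply, MonoidAlgebra.antipode_single, h1,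
        smashMap_tmul, smashMap_tmul, ev_conv_comp_antipode, ev_one_conv, hU.antipode_eq]
      simp [smashMap_tmul, alpha_one, conv_ev_one]
  · intro g h X Y
    -- The conjugate $\mathrm{ev}_{h^{-1}}\star\alpha(X)\star\mathrm{ev}_h$ is supported at
    -- $h^{-1}h=e$, so it comes from $\mathcal U(\mathfrak g)$.
    have h2 := conv_mem_distAt (ev_conv_alpha_mem h⁻¹ X) (ev_mem_distAt h)
    rw [inv_mul_cancel, ← range_alpha] at h2
    obtain ⟨Z, hZ⟩ := h2
    refine ⟨Z, hZ, smashMap_injective ?_⟩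
    rw [hH.mul_eq, smashMap_tmul, smashMap_tmul, smashMap_tmul, alpha_mul, hZ, ← conv_ev_ev]
    simp only [conv_assoc, ev_conv_ev_inv_conv]

end
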